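/- Let $[x]=\vartheta_{11}(x)$ be the odd Jacobi theta function with modulus $\omega$, $\operatorname{Im}\omega>0$. For parameters $\varepsilon_0,\dots,\varepsilon_9\in\mathbb C$ write $[ij]=[\varepsilon_i-\varepsilon_j]$, $[ijk]=[\varepsilon_0-\varepsilon_i-\varepsilon_j-\varepsilon_k]$, $\delta=3\varepsilon_0-\sum_{i=1}^9\varepsilon_i$, $\varepsilon_{\overline 7}=\varepsilon_7+\delta$, $\varepsilon_{\underline 6}=\varepsilon_6+\delta$, $\alpha_0=\varepsilon_0-\varepsilon_1-\varepsilon_2-\varepsilon_3$. The simple reflections $s_0,\dots,s_8$ of the affine Weyl group $W(E_8^{(1)})$ act birationally on the variables $(\varepsilon;f_1,f_2,f_3;\tau_1,\dots,\tau_9)$ as follows; variables not mentioned are fixed. * $s_0(\varepsilon_0)=2\varepsilon_0-\varepsilon_1-\varepsilon_2-\varepsilon_3$ and, for $i=1,2,3$, $s_0(\varepsilon_i)=\varepsilon_i+\alpha_0$, $s_0(f_i)=1/f_i$, $s_0(\tau_i)=f_i\tau_i$. * For $k\ge1$, $s_k$ exchanges $\varepsilon_k,\varepsilon_{k+1}$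 and $\tau_k,\tau_{k+1}$, and for $k=1,2$ also $f_k,f_{k+1}$. * $s_3(f_i)=\frac{\tau_3}{\tau_4}(c_{i,3}f_i+c_{3,i}f_3)$ for $i=1,2$ and $s_3(f_3)=\frac{\tau_3}{\tau_4}f_3$, where $c_{i,j}=\frac{[\varepsilon_i-\varepsilon_4][\alpha_0+\varepsilon_j-\varepsilon_4]}{[\varepsilon_i-\varepsilon_j][\alpha_0]}$. Let $T=T_{\alpha_6}=s_{126}s_{346}s_{589}s_{346}s_{126}s_{67}$ be the translation along $\alpha_6=e_6-e_7$, where $s_{ijk}$ and $s_{ij}$ are the reflections in the roots $e_0-e_i-e_j-e_k$ and $e_i-e_j$, written as words in the simple reflections; specifically, $s_{67}=s_6$ and, for $a<b<c$, $s_{abc}=w\,s_0\,w^{-1}$ with $$w=(s_{a-1}\cdots s_1)(s_{b-1}\cdots s_2)(s_{c-1}\cdots s_3).$$ A solution of the elliptic Painlevé equation for $T_{\alpha_6}$ is a sequence of points $x_n=(\varepsilon^{(n)},f^{(n)},\tau^{(n)})$, $n\in\mathbb Z$, with $x_{n+1}$ obtained by evaluating $T$ at $x_n$. Along the word for $T$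 every simple reflection is required to be defined at the point it is applied to and at the image of that point, and all $\tau_i$ are required to be nonzero. Put $$P_i=\Big(\tfrac{[23i]}{[1i]}:\tfrac{[13i]}{[2i]}:\tfrac{[12i]}{[3i]}\Big)\ (i=4,\dots,9),\qquad P_{10}=(f_1:f_2:f_3).$$ Assume that for all $n$ the parameters are in general position: $[ij]\ne0$ for $1\le i<j\le 9$, $[ijk]\neq0$ for $1\le i<j<k\le9$ with $\{i,j,k\}\ne\{4,5,9\}$, and $[6\overline7]\ne0$. **Theorem.** Suppose that at $n=0$ the points $P_4,P_5,P_9,P_{10}$ lie on a line. 1. There is one line that contains these four points for every $n\in\mathbb Z$. 2. For every $n$, with brackets evaluated at $\varepsilon^{(n)}$ and $\overline f_1=f_1^{(n+1)}$, $f_1=f_1^{(n)}$, $\underline f_1=f_1^{(n-1)}$, $$c_1\Big(\tfrac{[26][13\overline7]}{[2\overline7][136]}\,\overline f_1-f_1\Big)-c_2\Big(\tfrac{[27][13\underline6]}{[2\underline6][137]}\,\underline f_1-f_1\Big)=c_3f_1,\qquad(\ast)$$ where $$c_1=\frac{[27][2\overline7][46][56][12\overline7][136][237][456]}{[6\overline7]},\quad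 c_2=\frac{[26][2\underline6][47][57][12\underline6][137][236][457]}{[7\underline6]},$$ $$c_3=[24][25][76][123][1\overline76][245][376].$$ 3. Put $$u_0=2\varepsilon_2+\varepsilon_3-\varepsilon_0-\delta,\quad u_1=\varepsilon_2-\varepsilon_4,\quad u_2=\varepsilon_2-\varepsilon_5,\quad u_3=\varepsilon_2+\varepsilon_4+\varepsilon_5-\varepsilon_0,\quad u_4=\varepsilon_1+\varepsilon_2+\varepsilon_3-\varepsilon_0,$$ $$u_5=\varepsilon_0-\varepsilon_1-\varepsilon_6-\varepsilon_7-\delta,\quad u_6=\varepsilon_2+\varepsilon_3+\varepsilon_6-\varepsilon_0,\quad u_7=\varepsilon_2+\varepsilon_3+\varepsilon_7-\varepsilon_0.$$ Then $2\delta+3u_0-\sum_{i=1}^7u_i=0$, and the step $n\mapsto n+1$ fixes $\delta,u_0,\dots,u_5$ and maps $u_6\mapsto u_6-\delta$, $u_7\mapsto u_7+\delta$. 4. There is a nowhere vanishing $g:\mathbb Z\to\mathbb C$ with $g_{n+1}=\frac{[2\overline7][136]}{[26][13\overline7]}\,g_n$ (brackets at $\varepsilon^{(n)}$) such that for all sequences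 $F_n=g_n\Phi_n$ and every $n$, $F$ satisfies $(\ast)$ at $n$ (with $F$ in place of $f_1$) if and only if $\Phi$ satisfies the ${}_{10}E_9$ equation $$\frac{[u_7][u_0-u_7][\delta+u_0-u_7]\prod_{i=1}^5[\delta+u_0-u_i-u_6]}{[u_7-u_6][u_7-u_6+\delta]}(\Phi_{n+1}-\Phi_n)$$ $$=\frac{[u_6][u_0-u_6][\delta+u_0-u_6]\prod_{i=1}^5[\delta+u_0-u_i-u_7]}{[u_7-u_6][u_7-u_6-\delta]}(\Phi_n-\Phi_{n-1})+\prod_{i=1}^5[u_i]\,[u_7+u_6-u_0-\delta]\,\Phi_n,$$ where $u$ is taken at $\varepsilon^{(n)}$; thus $\Phi_{n+1}=\Phi(6^-7^+)$ and $\Phi_{n-1}=\Phi(7^-6^+)$. -/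

import Mathlib

noncomputable section

namespace EllipticPainleve

open Complex

/-- The odd Jacobi theta function `[x] = ϑ₁₁(x)` with modulus `ω`, i.e.
`∑ₙ exp (π i (n + 1/2)² ω + 2 π i (n + 1/2) (x + 1/2))`. -/
def th (ω : UpperHalfPlane) (x : ℂ) : ℂ :=
  ∑' n : ℤ, cexp (Real.pi * I * (n + 1 / 2) ^ 2 * (ω : ℂ)
    + 2 * Real.pi * I * (n + 1 / 2) * (x + 1 / 2))

/-- A point of the phase space: the parameters `ε₀, …, ε₉`, the homogeneous coordinates
`f₁, f₂, f₃` of the point `P₁₀`, and the variables `τ₁, …, τ₉`. The numbering is that of the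
mathematics; entries with other indices play no role. -/
@[ext]
structure PState where
  /-- parameters `ε₀, …, ε₉` -/
  ε : ℕ → ℂ
  /-- coordinates `f₁, f₂, f₃` -/
  f : ℕ → ℂ
  /-- variables `τ₁, …, τ₉` -/
  τ : ℕ → ℂ

/-- The value of the root `α₀ = e₀ - e₁ - e₂ - e₃`. -/
def root0 (ε : ℕ → ℂ) : ℂ := ε 0 - ε 1 - ε 2 - ε 3

/-- `c_{i,j} = [ε_i - ε_4] [α₀ + ε_j - ε_4] / ([ε_i - ε_j] [α₀])`. -/
def cCoef (ω : UpperHalfPlane) (ε : ℕ → ℂ) (i j : ℕ) : ℂ :=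
  th ω (ε i - ε 4) * th ω (root0 ε + ε j - ε 4) / (th ω (ε i - ε j) * th ω (root0 ε))

/-- The values `s₀(ε_i)`, `s₀(f_i)`, `s₀(τ_i)` at a given point. -/
def sRefl0 (x : PState) : PState where
  ε := fun i =>
    if i = 0 then 2 * x.ε 0 - x.ε 1 - x.ε 2 - x.ε 3
    else if i = 1 then x.ε 0 - x.ε 2 - x.ε 3
    else if i = 2 then x.ε 0 - x.ε 1 - x.ε 3
    else if i = 3 then x.ε 0 - x.ε 1 - x.ε 2
    else x.ε i
  f := fun i => 1 / x.f i
  τ := fun i => if 1 ≤ i ∧ i ≤ 3 then x.f i * x.τ i else x.τ i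

/-- The values `s_k(ε_i)`, `s_k(f_i)`, `s_k(τ_i)` at a given point for the simple reflections
`s₀, s₁, …, s₈` of the affine Weyl group of type `E₈⁽¹⁾`. -/
def sRefl (ω : UpperHalfPlane) (k : ℕ) (x : PState) : PState :=
  if k = 0 then sRefl0 x
  else
    { ε := fun i => x.ε (Equiv.swap k (k + 1) i)
      τ := fun i => x.τ (Equiv.swap k (k + 1) i)
      f := fun i =>
        if k < 3 then x.f (Equiv.swap k (k + 1) i)
        else if k = 3 then
          if i = 1 ∨ i = 2 then
            x.τ 3 / x.τ 4 * (cCoef ω x.ε i 3 * x.f i + cCoef ω x.ε 3 i * x.f 3)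
          else if i = 3 then x.τ 3 / x.τ 4 * x.f 3
          else x.f i
        else x.f i }

/-- No denominator in the formulas for `s_k` vanishes at `x`, and all `τ_i` are invertible. -/
def Defined (ω : UpperHalfPlane) (k : ℕ) (x : PState) : Prop :=
  (∀ i, 1 ≤ i → i ≤ 9 → x.τ i ≠ 0) ∧
  (k = 0 → ∀ i, 1 ≤ i → i ≤ 3 → x.f i ≠ 0) ∧
  (k = 3 → th ω (x.ε 1 - x.ε 3) ≠ 0 ∧ th ω (x.ε 2 - x.ε 3) ≠ 0 ∧ th ω (root0 x.ε) ≠ 0)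

/-- Evaluation at `x` of the composite `s_{k₁} s_{k₂} ⋯ s_{k_r}`. Since the `s_k` act on functions,
`(w w')(φ)` evaluated at `x` is `w'(φ)` evaluated at the image of `x` under `w`, so the point is
moved by the leftmost letter first. -/
def act (ω : UpperHalfPlane) : List ℕ → PState → PState
  | [], x => x
  | k :: w, x => act ω w (sRefl ω k x)

/-- The composite can be evaluated at `x` step by step, each `s_k` being defined at the point it is
applied to and (as its own inverse) at the image. -/
def DefinedAlong (ω : UpperHalfPlane) : List ℕ → PState → Prop
  | [], _ => True
  | k :: w, x => Defined ω k x ∧ Defined ω k (sRefl ω k x) ∧ DefinedAlong ω w (sRefl ω k x)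

/-- The word `s_{c-1} s_{c-2} ⋯ s_j`, which sends `e_j` to `e_c`. -/
def down (c j : ℕ) : List ℕ := (List.range (c - j)).map fun t => c - 1 - t

/-- A word for a permutation sending `e₁, e₂, e₃` to `e_a, e_b, e_c`, where `a < b < c`. -/
def permWord (a b c : ℕ) : List ℕ := down a 1 ++ down b 2 ++ down c 3

/-- A word for the reflection `s_{abc}` in the root `e₀ - e_a - e_b - e_c`, where `a < b < c`. -/
def reflWord (a b c : ℕ) : List ℕ := permWord a b c ++ [0] ++ (permWord a b c).reverse

/-- The translation `T = s₁₂₆ s₃₄₆ s₅₈₉ s₃₄₆ s₁₂₆ s₆₇` along the root `α₆ = e₆ - e₇`. -/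
def transWord : List ℕ :=
  reflWord 1 2 6 ++ reflWord 3 4 6 ++ reflWord 5 8 9 ++ reflWord 3 4 6 ++ reflWord 1 2 6 ++ [6]

/-- `δ = 3 ε₀ - ε₁ - ⋯ - ε₉`. -/
def delta (ε : ℕ → ℂ) : ℂ := 3 * ε 0 - ∑ i ∈ Finset.Icc 1 9, ε i

/-- A solution of the elliptic Painlevé equation for the translation `T`: a sequence of points of
the phase space, each being the image of the preceding one under `T`. -/
def IsSolution (ω : UpperHalfPlane) (x : ℤ → PState) : Prop :=
  ∀ n, DefinedAlong ω transWord (x n) ∧ x (n + 1) = act ω transWord (x n)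

/-- `[st] = [s - t]`, in terms of the values of the parameters. -/
def br2 (ω : UpperHalfPlane) (s t : ℂ) : ℂ := th ω (s - t)

/-- `[str] = [ε₀ - s - t - r]`, in terms of the values of the parameters. -/
def br3 (ω : UpperHalfPlane) (ε : ℕ → ℂ) (s t r : ℂ) : ℂ := th ω (ε 0 - s - t - r)

/-- `ε₇ + δ` -/
def bar7 (ε : ℕ → ℂ) : ℂ := ε 7 + delta ε

/-- `ε₆ + δ` -/
def under6 (ε : ℕ → ℂ) : ℂ := ε 6 + delta ε

/-- Coordinates `([23i]/[1i] : [13i]/[2i] : [12i]/[3i])` of the point `P_i`; used for `i ≥ 4`. -/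
def pt (ω : UpperHalfPlane) (ε : ℕ → ℂ) (i : ℕ) : Fin 3 → ℂ :=
  ![br3 ω ε (ε 2) (ε 3) (ε i) / br2 ω (ε 1) (ε i),
    br3 ω ε (ε 1) (ε 3) (ε i) / br2 ω (ε 2) (ε i),
    br3 ω ε (ε 1) (ε 2) (ε i) / br2 ω (ε 3) (ε i)]

/-- The point with coordinate vector `p` lies on the line `a₁ z₁ + a₂ z₂ + a₃ z₃ = 0`. -/
def OnLine (a p : Fin 3 → ℂ) : Prop := ∑ i, a i * p i = 0

/-- The points `P₄`, `P₅`, `P₉` and `P₁₀ = (f₁ : f₂ : f₃)` lie on the line with coefficients `a`. -/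
def FourOnLine (ω : UpperHalfPlane) (a : Fin 3 → ℂ) (x : PState) : Prop :=
  OnLine a (pt ω x.ε 4) ∧ OnLine a (pt ω x.ε 5) ∧ OnLine a (pt ω x.ε 9) ∧
    OnLine a ![x.f 1, x.f 2, x.f 3]

/-- General position of the nine points apart from the possible collinearity of `P₄, P₅, P₉`: they
are pairwise distinct (`[ij] ≠ 0`), no other three of them are collinear (`[ijk] ≠ 0`), and `P₆`
differs from the point with parameter `ε₇ + δ`. -/
def GeneralPosition (ω : UpperHalfPlane) (ε : ℕ → ℂ) : Prop :=
  (∀ i j, 1 ≤ i → i < j → j ≤ 9 → br2 ω (ε i) (ε j) ≠ 0) ∧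
  (∀ i j k, 1 ≤ i → i < j → j < k → k ≤ 9 → ¬ (i = 4 ∧ j = 5 ∧ k = 9) →
    br3 ω ε (ε i) (ε j) (ε k) ≠ 0) ∧
  br2 ω (ε 6) (bar7 ε) ≠ 0

/-- `c₁ = [27][2 7̄][46][56][12 7̄][136][237][456] / [6 7̄]` -/
def c1 (ω : UpperHalfPlane) (ε : ℕ → ℂ) : ℂ :=
  br2 ω (ε 2) (ε 7) * br2 ω (ε 2) (bar7 ε) * br2 ω (ε 4) (ε 6) * br2 ω (ε 5) (ε 6)
    * br3 ω ε (ε 1) (ε 2) (bar7 ε) * br3 ω ε (ε 1) (ε 3) (ε 6) * br3 ω ε (ε 2) (ε 3) (ε 7)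
    * br3 ω ε (ε 4) (ε 5) (ε 6) / br2 ω (ε 6) (bar7 ε)

/-- `c₂ = [26][2 6̲][47][57][12 6̲][137][236][457] / [7 6̲]` -/
def c2 (ω : UpperHalfPlane) (ε : ℕ → ℂ) : ℂ :=
  br2 ω (ε 2) (ε 6) * br2 ω (ε 2) (under6 ε) * br2 ω (ε 4) (ε 7) * br2 ω (ε 5) (ε 7)
    * br3 ω ε (ε 1) (ε 2) (under6 ε) * br3 ω ε (ε 1) (ε 3) (ε 7) * br3 ω ε (ε 2) (ε 3) (ε 6)
    * br3 ω ε (ε 4) (ε 5) (ε 7) / br2 ω (ε 7) (under6 ε)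

/-- `c₃ = [24][25][76][123][1 7̄ 6][245][376]` -/
def c3 (ω : UpperHalfPlane) (ε : ℕ → ℂ) : ℂ :=
  br2 ω (ε 2) (ε 4) * br2 ω (ε 2) (ε 5) * br2 ω (ε 7) (ε 6) * br3 ω ε (ε 1) (ε 2) (ε 3)
    * br3 ω ε (ε 1) (bar7 ε) (ε 6) * br3 ω ε (ε 2) (ε 4) (ε 5) * br3 ω ε (ε 3) (ε 7) (ε 6)

/-- The linear three-term equation between the values `Fup`, `F`, `Fdn` of the unknown at the
successor of a point with parameters `ε`, at the point itself, and at its predecessor. -/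
def ThreeTerm (ω : UpperHalfPlane) (ε : ℕ → ℂ) (Fup F Fdn : ℂ) : Prop :=
  c1 ω ε * (br2 ω (ε 2) (ε 6) * br3 ω ε (ε 1) (ε 3) (bar7 ε)
      / (br2 ω (ε 2) (bar7 ε) * br3 ω ε (ε 1) (ε 3) (ε 6)) * Fup - F)
    - c2 ω ε * (br2 ω (ε 2) (ε 7) * br3 ω ε (ε 1) (ε 3) (under6 ε)
      / (br2 ω (ε 2) (under6 ε) * br3 ω ε (ε 1) (ε 3) (ε 7)) * Fdn - F)
  = c3 ω ε * F

/-- The elliptic hypergeometric equation of `₁₀E₉` at the parameters `u₀, …, u₇`, between the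
values `Φup = Φ(6⁻7⁺)`, `Φ` and `Φdn = Φ(7⁻6⁺)`. -/
def E9Equation (ω : UpperHalfPlane) (δ : ℂ) (u : Fin 8 → ℂ) (Φup Φ Φdn : ℂ) : Prop :=
  th ω (u 7) * th ω (u 0 - u 7) * th ω (δ + u 0 - u 7)
      * (∏ i ∈ Finset.Icc (1 : Fin 8) 5, th ω (δ + u 0 - u i - u 6))
      / (th ω (u 7 - u 6) * th ω (u 7 - u 6 + δ)) * (Φup - Φ)
  = th ω (u 6) * th ω (u 0 - u 6) * th ω (δ + u 0 - u 6)
      * (∏ i ∈ Finset.Icc (1 : Fin 8) 5, th ω (δ + u 0 - u i - u 7))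
      / (th ω (u 7 - u 6) * th ω (u 7 - u 6 - δ)) * (Φ - Φdn)
    + (∏ i ∈ Finset.Icc (1 : Fin 8) 5, th ω (u i)) * th ω (u 7 + u 6 - u 0 - δ) * Φ

/-- The change of parameters `ε ↦ (u₀, …, u₇)` to those of the `₁₀E₉` equation. -/
def uParam (ε : ℕ → ℂ) : Fin 8 → ℂ :=
  ![2 * ε 2 + ε 3 - ε 0 - delta ε,
    ε 2 - ε 4,
    ε 2 - ε 5,
    ε 2 + ε 4 + ε 5 - ε 0,
    ε 1 + ε 2 + ε 3 - ε 0,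
    ε 0 - ε 1 - ε 6 - ε 7 - delta ε,
    ε 2 + ε 3 + ε 6 - ε 0,
    ε 2 + ε 3 + ε 7 - ε 0]

/-- The shift `u₆ ↦ u₆ - δ`, `u₇ ↦ u₇ + δ`. -/
def shift67 (δ : ℂ) (u : Fin 8 → ℂ) : Fin 8 → ℂ :=
  ![u 0, u 1, u 2, u 3, u 4, u 5, u 6 - δ, u 7 + δ]

end EllipticPainleve

end

/-! The parameters ε₁, …, ε₉ mark points on a plane cubic. The line meeting the cubic at a and b is
the degree-three theta function `ell`. A point of the plane, usually off the cubic, is a linear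
functional L on functions, and `lineVal` is the value of a line at that point. The coordinates f are
the values at P₁₀ of the sides of the triangle P₁P₂P₃, divided by τ₁τ₂τ₃ (`Represents`). In this
language s_k with k ≥ 1 only renumbers points and keeps L (`Represents.sRefl`), while s_{abc} is the
quadratic transformation with those three centres (`exists_transforms`). Every computation rests on
the three-term theta identity `thW_three` and its geometric forms `lineVal_pencil` and
`lineVal_plucker`.

T is a palindrome `coreWord`, the reflection in δ − e₆ + e₇, followed by s₆. Two reflections inward
from either end one meets the middle factor s₅₈₉ (`exists_intermediate`). There the line P₄P_k has
become the conic through the points 1, 2, 4, 6 and k (`hat_sum_eq`, `Intermediate.sum_iff`).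
Collinearity of P₄, P₅, P₉ means [459] = 0, and P₁₀ on their line means that the middle point lies
on the conics for k = 5 and for k = 9. A conic through two of the three centres 5, 8, 9 goes to a
conic, so the incidence survives (`MidData.conic_after`). Since P₄, P₅, P₉ do not move in time
(`pt_coreParam`), the line stays the same.

On the conic, the present f₁, f₂ and the next f₁ are linear forms in the same two quantities, hence
linearly dependent (`intermediate_relation`, `MidData.relation`). The core is an involution, so the
preceding point arises from the present one by exchanging 6 and 7 and applying the core again. The
same relation therefore links f₁, f₂ to the previous f₁, and eliminating f₂ gives (∗)
(`threeTerm_of_stepRelation`). In the parameters u the coefficients of (∗) become those of the ₁₀E₉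
equation up to a common factor (`e9Equation_iff`), and the gauge g removes the remaining quotients.
-/

namespace EllipticPainleve

open Complex

/-! ### The theta series, its oddness and the three-term identity. -/

/-- The general term of the series for `th`. -/
noncomputable def thTerm (ω : UpperHalfPlane) (x : ℂ) (n : ℤ) : ℂ :=
  cexp (Real.pi * I * (n + 1 / 2) ^ 2 * (ω : ℂ) + 2 * Real.pi * I * (n + 1 / 2) * (x + 1 / 2))

theorem summable_thTerm (ω : UpperHalfPlane) (x : ℂ) : Summable (thTerm ω x) := by
  have h := (summable_jacobiTheta₂_term_iff (x + 1 / 2 + ω / 2) (ω : ℂ)).2 ω.im_pos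
  refine (h.mul_left (cexp (Real.pi * I * ω / 4 + Real.pi * I * (x + 1 / 2)))).congr fun n => ?_
  rw [thTerm, jacobiTheta₂_term, ← Complex.exp_add]
  congr 1
  ring

theorem th_eq_tsum (ω : UpperHalfPlane) (x : ℂ) : th ω x = ∑' n, thTerm ω x n := rfl

theorem th_neg (ω : UpperHalfPlane) (x : ℂ) : th ω (-x) = -th ω x := by
  rw [th_eq_tsum, th_eq_tsum, ← tsum_neg]
  -- The substitution n ↦ −n − 1 changes the sign of n + 1/2.
  let e : ℤ ≃ ℤ := (Equiv.neg ℤ).trans (Equiv.subRight 1)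
  rw [← e.tsum_eq]
  refine tsum_congr fun n => ?_
  have he : ((e n : ℤ) : ℂ) = -n - 1 := by simp [e]
  rw [thTerm, thTerm, he]
  have h2 : Real.pi * I * (-(n : ℂ) - 1 + 1 / 2) ^ 2 * (ω : ℂ)
      + 2 * Real.pi * I * (-(n : ℂ) - 1 + 1 / 2) * (-x + 1 / 2)
      = (Real.pi * I * (n + 1 / 2) ^ 2 * (ω : ℂ) + 2 * Real.pi * I * (n + 1 / 2) * (x + 1 / 2))
        + (-(n + 1 : ℤ) * (2 * Real.pi * I) + Real.pi * I) := by
    push_cast; ring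
  rw [h2, Complex.exp_add _ (_ + Real.pi * I), Complex.exp_add _ (Real.pi * I),
    Complex.exp_pi_mul_I]
  have h3 : cexp (-((n + 1 : ℤ) : ℂ) * (2 * Real.pi * I)) = 1 := by
    have := Complex.exp_int_mul_two_pi_mul_I (-(n + 1))
    rwa [Int.cast_neg] at this
  rw [h3]; ring

/-- The even part of the series for a product of two theta functions. -/
noncomputable def evTerm (ω : UpperHalfPlane) (x : ℂ) (k : ℤ) : ℂ :=
  cexp (2 * Real.pi * I * ω * k ^ 2 + 4 * Real.pi * I * k * x)

/-- The odd part of the series for a product of two theta functions. -/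
noncomputable def odTerm (ω : UpperHalfPlane) (x : ℂ) (k : ℤ) : ℂ :=
  cexp (Real.pi * I * ω * (2 * k + 1) ^ 2 / 2 + 2 * Real.pi * I * (2 * k + 1) * x)

theorem two_mul_im_pos (ω : UpperHalfPlane) : 0 < (2 * (ω : ℂ)).im := by
  have := ω.im_pos
  simp only [Complex.mul_im, Complex.re_ofNat, Complex.im_ofNat, zero_mul, add_zero]
  exact mul_pos two_pos this

theorem summable_evTerm (ω : UpperHalfPlane) (x : ℂ) : Summable (evTerm ω x) := by
  have h := (summable_jacobiTheta₂_term_iff (2 * x) (2 * (ω : ℂ))).2 (two_mul_im_pos ω)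
  refine h.congr fun n => ?_
  rw [evTerm, jacobiTheta₂_term]
  congr 1
  ring

theorem summable_odTerm (ω : UpperHalfPlane) (x : ℂ) : Summable (odTerm ω x) := by
  have h := (summable_jacobiTheta₂_term_iff (2 * x + ω) (2 * (ω : ℂ))).2 (two_mul_im_pos ω)
  refine (h.mul_left (cexp (Real.pi * I * ω / 2 + 2 * Real.pi * I * x))).congr fun n => ?_
  rw [odTerm, jacobiTheta₂_term, ← Complex.exp_add]
  congr 1
  ring

/-- The double series is regrouped by the parity of the sum of its two indices. The right-hand side
is a 2×2 determinant in the vectors (even part, odd part) at a and b, which is what makes the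
three-term identity a Plücker relation. -/
theorem th_add_mul_th_sub (ω : UpperHalfPlane) (a b : ℂ) :
    th ω (a + b) * th ω (a - b)
      = (∑' k, evTerm ω a k) * (∑' k, odTerm ω b k)
        - (∑' k, odTerm ω a k) * (∑' k, evTerm ω b k) := by
  rw [th_eq_tsum, th_eq_tsum]
  have hs1 := (summable_thTerm ω (a + b)).norm
  have hs2 := (summable_thTerm ω (a - b)).norm
  have hL : HasSum (fun z : ℤ × ℤ => thTerm ω (a + b) z.1 * thTerm ω (a - b) z.2)
      ((∑' n, thTerm ω (a + b) n) * (∑' n, thTerm ω (a - b) n)) := by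
    rw [tsum_mul_tsum_of_summable_norm hs1 hs2]
    exact (summable_mul_of_summable_norm hs1 hs2).hasSum
  -- The summation is over half-integers m + 1/2 and n + 1/2: on the range of `i₁` their sum is the
  -- even number 2k and their difference 2l + 1; on the range of `i₂` these are 2k + 1 and 2l. The
  -- sign exp(πi(m + n + 1)) is 1 in the first case and −1 in the second.
  let i₁ : ℤ × ℤ → ℤ × ℤ := fun z => (z.1 + z.2, z.1 - z.2 - 1)
  let i₂ : ℤ × ℤ → ℤ × ℤ := fun z => (z.1 + z.2, z.1 - z.2)
  have hi₁ : Function.Injective i₁ := by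
    rintro ⟨a, b⟩ ⟨c, d⟩ h
    simp only [i₁, Prod.mk.injEq] at h ⊢
    omega
  have hi₂ : Function.Injective i₂ := by
    rintro ⟨a, b⟩ ⟨c, d⟩ h
    simp only [i₂, Prod.mk.injEq] at h ⊢
    omega
  have hc : IsCompl (Set.range i₁) (Set.range i₂) := by
    have h1 : ∀ m n : ℤ, (m, n) ∈ Set.range i₁ ↔ (m + n) % 2 = 1 := by
      refine fun m n => ⟨?_, fun h => ⟨((m + n + 1) / 2, m - (m + n + 1) / 2), ?_⟩⟩
      · rintro ⟨⟨k, l⟩, h⟩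
        simp only [i₁, Prod.mk.injEq] at h
        omega
      · simp only [i₁, Prod.mk.injEq]
        omega
    have h2 : ∀ m n : ℤ, (m, n) ∈ Set.range i₂ ↔ (m + n) % 2 = 0 := by
      refine fun m n => ⟨?_, fun h => ⟨((m + n) / 2, m - (m + n) / 2), ?_⟩⟩
      · rintro ⟨⟨k, l⟩, h⟩
        simp only [i₂, Prod.mk.injEq] at h
        omega
      · simp only [i₂, Prod.mk.injEq]
        omega
    rw [isCompl_comm, ← compl_eq_iff_isCompl]
    ext ⟨m, n⟩
    rw [Set.mem_compl_iff, h1, h2]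
    omega
  have hA : HasSum ((fun z : ℤ × ℤ => thTerm ω (a + b) z.1 * thTerm ω (a - b) z.2) ∘ i₁)
      ((∑' k, evTerm ω a k) * (∑' k, odTerm ω b k)) := by
    have h1 := (summable_evTerm ω a).norm
    have h2 := (summable_odTerm ω b).norm
    rw [tsum_mul_tsum_of_summable_norm h1 h2]
    refine HasSum.congr_fun (summable_mul_of_summable_norm h1 h2).hasSum ?_
    rintro ⟨k, l⟩
    simp only [Function.comp, i₁, thTerm, evTerm, odTerm]
    rw [← Complex.exp_add, ← Complex.exp_add]
    have h3 := Complex.exp_int_mul_two_pi_mul_I k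
    symm
    rw [← mul_one (cexp (_ + _)), ← h3, ← Complex.exp_add, h3]
    congr 1
    push_cast
    ring
  have hB : HasSum ((fun z : ℤ × ℤ => thTerm ω (a + b) z.1 * thTerm ω (a - b) z.2) ∘ i₂)
      (-((∑' k, odTerm ω a k) * (∑' k, evTerm ω b k))) := by
    have h1 := (summable_odTerm ω a).norm
    have h2 := (summable_evTerm ω b).norm
    rw [tsum_mul_tsum_of_summable_norm h1 h2]
    refine HasSum.congr_fun (summable_mul_of_summable_norm h1 h2).hasSum.neg ?_
    rintro ⟨k, l⟩
    simp only [Function.comp, i₂, thTerm, evTerm, odTerm]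
    rw [← Complex.exp_add, ← Complex.exp_add]
    have h3 := Complex.exp_int_mul_two_pi_mul_I k
    have h4 : cexp (k * (2 * Real.pi * I) + Real.pi * I) = -1 := by
      rw [Complex.exp_add, h3, Complex.exp_pi_mul_I, one_mul]
    rw [neg_eq_neg_one_mul, ← h4, ← Complex.exp_add]
    congr 1
    push_cast
    ring
  have hA' := hi₁.hasSum_range_iff.2 hA
  have hB' := hi₂.hasSum_range_iff.2 hB
  rw [hL.unique (HasSum.add_isCompl hc
    (f := fun z : ℤ × ℤ => thTerm ω (a + b) z.1 * thTerm ω (a - b) z.2) hA' hB')]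
  ring

/-- The basic bilinear theta expression, antisymmetric in `x`, `y`. -/
noncomputable def thW (ω : UpperHalfPlane) (s x y : ℂ) : ℂ := th ω (x - y) * th ω (s - x - y)

theorem thW_swap (ω : UpperHalfPlane) (s x y : ℂ) : thW ω s y x = -thW ω s x y := by
  rw [thW, thW, ← neg_sub x y, th_neg, show s - y - x = s - x - y by ring]
  ring

/-- The three-term identity for the theta function. -/
theorem thW_three (ω : UpperHalfPlane) (s x y z w : ℂ) :
    thW ω s x y * thW ω s z w - thW ω s x z * thW ω s y w + thW ω s x w * thW ω s y z = 0 := by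
  -- Each `thW` is a 2×2 minor of a matrix with two rows and one column per point, so the claim is
  -- the Plücker relation for four columns.
  have key : ∀ p q : ℂ, thW ω s p q
      = (∑' k, evTerm ω (s / 2 - q) k) * (∑' k, odTerm ω (s / 2 - p) k)
        - (∑' k, odTerm ω (s / 2 - q) k) * (∑' k, evTerm ω (s / 2 - p) k) := by
    intro p q
    rw [← th_add_mul_th_sub, thW, mul_comm]
    congr 2 <;> ring
  simp only [key]
  ring

theorem th_zero (ω : UpperHalfPlane) : th ω 0 = 0 := by
  have h := th_neg ω 0
  rw [neg_zero] at h
  linear_combination h / 2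

/-- Translation by a zero of the theta function. -/
theorem th_translate (ω : UpperHalfPlane) {c : ℂ} (hc : th ω c = 0) (s x y : ℂ) :
    th ω (x + c) * th ω (s - x + c) * (th ω y * th ω (s - y))
      = th ω (y + c) * th ω (s - y + c) * (th ω x * th ω (s - x)) := by
  -- The pair (0, c) contributes the factor `th ω (-c)`, which vanishes, so only two of the three
  -- terms remain. No quasi-periodicity of the series is needed.
  have h := thW_three ω (s + 2 * c) (x + c) 0 (y + c) c
  have h0 : thW ω (s + 2 * c) 0 c = 0 := by rw [thW, zero_sub, th_neg, hc, neg_zero, zero_mul]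
  rw [h0] at h
  simp only [thW] at h
  rw [show x + c - 0 = x + c by ring, show s + 2 * c - (x + c) - 0 = s - x + c by ring,
    show y + c - c = y by ring, show s + 2 * c - (y + c) - c = s - y by ring,
    show x + c - c = x by ring, show s + 2 * c - (x + c) - c = s - x by ring,
    show 0 - (y + c) = -(y + c) by ring, show s + 2 * c - 0 - (y + c) = s - y + c by ring,
    th_neg] at h
  linear_combination h

/-! ### Lines as theta functions, points as functionals, and quadratic transformations. -/

/-- The theta function of degree three `[z - a][z - b][e₀ - a - b - z]`. -/
noncomputable def ell (ω : UpperHalfPlane) (e₀ a b z : ℂ) : ℂ :=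
  th ω (z - a) * th ω (z - b) * th ω (e₀ - a - b - z)

/-- The line through the points with parameters `a`, `b`, evaluated at the point given by the
functional `L`. -/
noncomputable def lineVal (ω : UpperHalfPlane) (L : (ℂ → ℂ) →ₗ[ℂ] ℂ) (e₀ a b : ℂ) : ℂ :=
  L (ell ω e₀ a b)

variable {ω : UpperHalfPlane} {L L' : (ℂ → ℂ) →ₗ[ℂ] ℂ}

theorem ell_comm (e₀ a b : ℂ) : ell ω e₀ a b = ell ω e₀ b a := by
  funext z
  rw [ell, ell, show e₀ - a - b - z = e₀ - b - a - z by ring]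
  ring

theorem lineVal_comm (e₀ a b : ℂ) : lineVal ω L e₀ a b = lineVal ω L e₀ b a := by
  rw [lineVal, ell_comm, lineVal]

/-- Three lines through a common point are linearly dependent. -/
theorem ell_pencil (e₀ a b c d : ℂ) :
    thW ω (e₀ - a) b c • ell ω e₀ a d + thW ω (e₀ - a) c d • ell ω e₀ a b
      + thW ω (e₀ - a) d b • ell ω e₀ a c = 0 := by
  funext z
  have h := thW_three ω (e₀ - a) z b c d
  -- Lines through a share the factor [z − a]; what is left is the three-term identity for the
  -- points z, b, c, d.
  have hz : ∀ x, ell ω e₀ a x z = th ω (z - a) * thW ω (e₀ - a) z x := by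
    intro x
    rw [ell, thW, show e₀ - a - x - z = e₀ - a - z - x by ring]
    ring
  simp only [Pi.add_apply, Pi.smul_apply, smul_eq_mul, Pi.zero_apply, hz]
  rw [thW_swap ω (e₀ - a) b d]
  linear_combination th ω (z - a) * h

theorem lineVal_pencil (e₀ a b c d : ℂ) :
    thW ω (e₀ - a) b c * lineVal ω L e₀ a d + thW ω (e₀ - a) c d * lineVal ω L e₀ a b
      + thW ω (e₀ - a) d b * lineVal ω L e₀ a c = 0 := by
  have h := congrArg L (ell_pencil (ω := ω) e₀ a b c d)
  simpa only [map_add, map_smul, smul_eq_mul, map_zero, lineVal] using h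

/-- The quadratic relation between the six lines joining four points. -/
theorem lineVal_plucker (e₀ a b c d : ℂ) (h : th ω (e₀ - a - b - c) ≠ 0) :
    th ω (a - b) * th ω (c - d) * (lineVal ω L e₀ a b * lineVal ω L e₀ c d)
      - th ω (a - c) * th ω (b - d) * (lineVal ω L e₀ a c * lineVal ω L e₀ b d)
      + th ω (a - d) * th ω (b - c) * (lineVal ω L e₀ a d * lineVal ω L e₀ b c) = 0 := by
  -- The pencils at a, b, c all carry the coefficient [abc]; the weighted sum below is [abc] times
  -- the claim.
  have ha := lineVal_pencil (ω := ω) (L := L) e₀ a b c d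
  have hb := lineVal_pencil (ω := ω) (L := L) e₀ b a c d
  have hc := lineVal_pencil (ω := ω) (L := L) e₀ c a b d
  rw [thW_swap ω _ b d] at ha
  rw [thW_swap ω _ a d] at hb hc
  simp only [thW] at ha hb hc
  rw [lineVal_comm e₀ b a] at hb
  rw [lineVal_comm e₀ c a, lineVal_comm e₀ c b] at hc
  rw [show e₀ - b - a - c = e₀ - a - b - c by ring, show e₀ - b - c - d = e₀ - c - d - b by ring,
    show e₀ - b - a - d = e₀ - a - b - d by ring] at hb
  rw [show e₀ - c - a - b = e₀ - a - b - c by ring, show e₀ - c - b - d = e₀ - c - d - b by ring,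
    show e₀ - c - a - d = e₀ - a - c - d by ring] at hc
  apply mul_left_cancel₀ h
  rw [mul_zero]
  linear_combination th ω (a - d) * lineVal ω L e₀ b c * ha
    - th ω (b - d) * lineVal ω L e₀ a c * hb + th ω (c - d) * lineVal ω L e₀ a b * hc

/-- A functional is prescribed by its values on the sides of a triangle. -/
theorem exists_functional (e₀ a b c X Y Z : ℂ) (hab : th ω (a - b) ≠ 0) (hac : th ω (a - c) ≠ 0)
    (hbc : th ω (b - c) ≠ 0) (habc : th ω (e₀ - a - b - c) ≠ 0) :
    ∃ L : (ℂ → ℂ) →ₗ[ℂ] ℂ, lineVal ω L e₀ b c = X ∧ lineVal ω L e₀ a c = Y ∧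
      lineVal ω L e₀ a b = Z := by
  have hba : th ω (b - a) ≠ 0 := by rwa [← neg_sub, th_neg, neg_ne_zero]
  have hca : th ω (c - a) ≠ 0 := by rwa [← neg_sub, th_neg, neg_ne_zero]
  have hcb : th ω (c - b) ≠ 0 := by rwa [← neg_sub, th_neg, neg_ne_zero]
  have h1 : ell ω e₀ b c a ≠ 0 := by
    rw [ell, show e₀ - b - c - a = e₀ - a - b - c by ring]
    exact mul_ne_zero (mul_ne_zero hab hac) habc
  have h2 : ell ω e₀ a c b ≠ 0 := by
    rw [ell, show e₀ - a - c - b = e₀ - a - b - c by ring]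
    exact mul_ne_zero (mul_ne_zero hba hbc) habc
  have h3 : ell ω e₀ a b c ≠ 0 := by
    rw [ell]
    exact mul_ne_zero (mul_ne_zero hca hcb) habc
  have hz : ∀ x y, ell ω e₀ x y x = 0 ∧ ell ω e₀ y x x = 0 := by
    intro x y
    rw [ell, ell, sub_self, th_zero]
    constructor <;> ring
  -- Each side of the triangle vanishes at two of the vertices, so the evaluations at the vertices
  -- are dual to the sides up to scale.
  refine ⟨(X / ell ω e₀ b c a) • LinearMap.proj a + (Y / ell ω e₀ a c b) • LinearMap.proj b
    + (Z / ell ω e₀ a b c) • LinearMap.proj c, ?_, ?_, ?_⟩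
  · simp only [lineVal, LinearMap.add_apply, LinearMap.smul_apply, LinearMap.proj_apply,
      smul_eq_mul, (hz b c).1, (hz c b).2]
    field_simp
    ring
  · simp only [lineVal, LinearMap.add_apply, LinearMap.smul_apply, LinearMap.proj_apply,
      smul_eq_mul, (hz a c).1, (hz c a).2]
    field_simp
    ring
  · simp only [lineVal, LinearMap.add_apply, LinearMap.smul_apply, LinearMap.proj_apply,
      smul_eq_mul, (hz a b).1, (hz b a).2]
    field_simp
    ring

/-- Lines through a centre of a quadratic transformation are transformed to lines. -/
theorem lineVal_transform {e₀ a b c α T : ℂ} (hα : α = e₀ - a - b - c)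
    (hb : T * lineVal ω L' (e₀ + α) (a + α) (b + α) = lineVal ω L e₀ a c * lineVal ω L e₀ b c)
    (hc : T * lineVal ω L' (e₀ + α) (a + α) (c + α) = lineVal ω L e₀ a b * lineVal ω L e₀ b c)
    (hbc : th ω (b - c) ≠ 0) (hα0 : th ω α ≠ 0) (z : ℂ) :
    T * lineVal ω L' (e₀ + α) (a + α) z = lineVal ω L e₀ b c * lineVal ω L e₀ a z := by
  -- The shift by α interchanges the roles of b and c: up to sign, the coefficient of the image line
  -- through a + α and b + α equals that of the line ac in the original pencil. The two pencils
  -- therefore match term by term.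
  have h1 := lineVal_pencil (ω := ω) (L := L) e₀ a b c z
  have h2 := lineVal_pencil (ω := ω) (L := L') (e₀ + α) (a + α) (b + α) (c + α) z
  simp only [thW] at h1 h2
  rw [show b + α - (c + α) = b - c by ring,
    show e₀ + α - (a + α) - (b + α) - (c + α) = -α by rw [hα]; ring,
    show c + α - z = e₀ - a - z - b by rw [hα]; ring,
    show e₀ + α - (a + α) - (c + α) - z = -(z - b) by rw [hα]; ring,
    show z - (b + α) = -(e₀ - a - c - z) by rw [hα]; ring,
    show e₀ + α - (a + α) - z - (b + α) = c - z by rw [hα]; ring,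
    th_neg, th_neg, th_neg] at h2
  rw [show e₀ - a - b - c = α from hα.symm] at h1
  apply mul_left_cancel₀ (mul_ne_zero hbc hα0)
  linear_combination (-T) * h2 - lineVal ω L e₀ b c * h1
    - th ω (e₀ - a - z - b) * th ω (z - b) * hb - th ω (e₀ - a - c - z) * th ω (c - z) * hc

/-! ### The simple reflections acting on represented points. -/

/-- The product `τ₁ τ₂ τ₃`. -/
noncomputable def tauProd (x : PState) : ℂ := x.τ 1 * x.τ 2 * x.τ 3

/-- The functional `L` represents the point `(f₁ : f₂ : f₃)` of the state `x`. -/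
def Represents (ω : UpperHalfPlane) (L : (ℂ → ℂ) →ₗ[ℂ] ℂ) (x : PState) : Prop :=
  lineVal ω L (x.ε 0) (x.ε 2) (x.ε 3) = x.f 1 * tauProd x ∧
  lineVal ω L (x.ε 0) (x.ε 1) (x.ε 3) = x.f 2 * tauProd x ∧
  lineVal ω L (x.ε 0) (x.ε 1) (x.ε 2) = x.f 3 * tauProd x

theorem sRefl_ε {k : ℕ} (hk : 1 ≤ k) (x : PState) (i : ℕ) :
    (sRefl ω k x).ε i = x.ε (Equiv.swap k (k + 1) i) := by
  rw [sRefl, if_neg (by omega)]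

theorem sRefl_τ {k : ℕ} (hk : 1 ≤ k) (x : PState) (i : ℕ) :
    (sRefl ω k x).τ i = x.τ (Equiv.swap k (k + 1) i) := by
  rw [sRefl, if_neg (by omega)]

/-- The pencil at c, solved for one of its lines. The coefficients are the c_{i,j} in the formula
for s₃. -/
theorem ell_third (e₀ a b c d : ℂ) (hab : th ω (a - b) ≠ 0)
    (habc : th ω (e₀ - a - b - c) ≠ 0) :
    lineVal ω L e₀ c d = th ω (a - d) * th ω (e₀ - a - c - d) / (th ω (a - b)
        * th ω (e₀ - a - b - c)) * lineVal ω L e₀ c b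
      + th ω (b - d) * th ω (e₀ - b - c - d) / (th ω (b - a)
        * th ω (e₀ - a - b - c)) * lineVal ω L e₀ c a := by
  have h := lineVal_pencil (ω := ω) (L := L) e₀ c a b d
  have hba : th ω (b - a) ≠ 0 := by rwa [← neg_sub, th_neg, neg_ne_zero]
  rw [thW_swap ω _ a d] at h
  simp only [thW] at h
  rw [show e₀ - c - a - b = e₀ - a - b - c by ring, show e₀ - c - b - d = e₀ - b - c - d by ring,
    show e₀ - c - a - d = e₀ - a - c - d by ring] at h
  rw [show th ω (b - a) = -th ω (a - b) by rw [← th_neg, neg_sub]]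
  field_simp
  linear_combination h

/-- Renumbering the nine points does not move P₁₀, so the functional is unchanged. Only k = 3 alters
the triangle of reference beyond a permutation, and there `ell_third` is the change of coordinates.
-/
theorem Represents.sRefl {k : ℕ} (hk : 1 ≤ k) (hk8 : k ≤ 8) {x : PState}
    (hd : Defined ω k x) (h : Represents ω L x) : Represents ω L (sRefl ω k x) := by
  obtain ⟨h1, h2, h3⟩ := h
  unfold tauProd at h1 h2 h3
  rw [Represents, tauProd]
  simp only [sRefl_ε hk, sRefl_τ hk]
  obtain rfl | rfl | rfl | hk4 : k = 1 ∨ k = 2 ∨ k = 3 ∨ 4 ≤ k := by omega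
  · simp only [EllipticPainleve.sRefl, show Equiv.swap 1 (1 + 1) 0 = 0 by decide,
      show Equiv.swap 1 (1 + 1) 1 = 2 by decide, show Equiv.swap 1 (1 + 1) 2 = 1 by decide,
      show Equiv.swap 1 (1 + 1) 3 = 3 by decide]
    norm_num
    rw [h1, h2, lineVal_comm, h3, show Equiv.swap 1 2 3 = 3 by decide]
    refine ⟨by ring, by ring, by ring⟩
  · simp only [EllipticPainleve.sRefl, show Equiv.swap 2 (2 + 1) 0 = 0 by decide,
      show Equiv.swap 2 (2 + 1) 1 = 1 by decide, show Equiv.swap 2 (2 + 1) 2 = 3 by decide,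
      show Equiv.swap 2 (2 + 1) 3 = 2 by decide]
    norm_num
    rw [h2, h3, lineVal_comm, h1, show Equiv.swap 2 3 1 = 1 by decide]
    refine ⟨by ring, by ring, by ring⟩
  · simp only [EllipticPainleve.sRefl, show Equiv.swap 3 (3 + 1) 0 = 0 by decide,
      show Equiv.swap 3 (3 + 1) 1 = 1 by decide, show Equiv.swap 3 (3 + 1) 2 = 2 by decide,
      show Equiv.swap 3 (3 + 1) 3 = 4 by decide]
    obtain ⟨hτ, -, hn⟩ := hd
    obtain ⟨n13, n23, n0⟩ := hn rfl
    have t4 : x.τ 4 ≠ 0 := hτ 4 (by norm_num) (by norm_num)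
    norm_num
    have e1 := ell_third (L := L) (x.ε 0) (x.ε 1) (x.ε 3) (x.ε 2) (x.ε 4) n13
      (by rw [root0] at n0; rwa [show x.ε 0 - x.ε 1 - x.ε 3 - x.ε 2
        = x.ε 0 - x.ε 1 - x.ε 2 - x.ε 3 by ring])
    have e2 := ell_third (L := L) (x.ε 0) (x.ε 2) (x.ε 3) (x.ε 1) (x.ε 4) n23
      (by rw [root0] at n0; rwa [show x.ε 0 - x.ε 2 - x.ε 3 - x.ε 1
        = x.ε 0 - x.ε 1 - x.ε 2 - x.ε 3 by ring])
    rw [h1, lineVal_comm _ (x.ε 2) (x.ε 1), h3] at e1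
    rw [h2, h3] at e2
    refine ⟨?_, ?_, ?_⟩
    · rw [e1, cCoef, cCoef, root0]
      rw [show x.ε 0 - x.ε 1 - x.ε 2 - x.ε 3 + x.ε 3 - x.ε 4
          = x.ε 0 - x.ε 1 - x.ε 2 - x.ε 4 by ring,
        show x.ε 0 - x.ε 1 - x.ε 2 - x.ε 3 + x.ε 1 - x.ε 4
          = x.ε 0 - x.ε 3 - x.ε 2 - x.ε 4 by ring,
        show x.ε 0 - x.ε 1 - x.ε 3 - x.ε 2 = x.ε 0 - x.ε 1 - x.ε 2 - x.ε 3 by ring]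
      field_simp
    · rw [e2, cCoef, cCoef, root0]
      rw [show x.ε 0 - x.ε 1 - x.ε 2 - x.ε 3 + x.ε 3 - x.ε 4
          = x.ε 0 - x.ε 2 - x.ε 1 - x.ε 4 by ring,
        show x.ε 0 - x.ε 1 - x.ε 2 - x.ε 3 + x.ε 2 - x.ε 4
          = x.ε 0 - x.ε 3 - x.ε 1 - x.ε 4 by ring,
        show x.ε 0 - x.ε 2 - x.ε 3 - x.ε 1 = x.ε 0 - x.ε 1 - x.ε 2 - x.ε 3 by ring]
      field_simp
    · rw [h3]
      field_simp
  · have hs : ∀ i, i ≤ 3 → Equiv.swap k (k + 1) i = i := fun i hi =>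
      Equiv.swap_apply_of_ne_of_ne (by omega) (by omega)
    simp only [EllipticPainleve.sRefl, hs 0 (by omega), hs 1 (by omega), hs 2 (by omega),
      hs 3 (by omega), if_neg (show ¬k = 0 by omega), if_neg (show ¬k < 3 by omega),
      if_neg (show ¬k = 3 by omega)]
    exact ⟨h1, h2, h3⟩

/-! ### Words of reflections, and s_{abc} as a quadratic transformation. -/

/-- The permutation of indices effected by a word without the letter `0`. -/
def wordPerm : List ℕ → Equiv.Perm ℕ
  | [] => 1
  | k :: w => Equiv.swap k (k + 1) * wordPerm w

theorem wordPerm_append (v w : List ℕ) : wordPerm (v ++ w) = wordPerm v * wordPerm w := by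
  induction v with
  | nil => rw [List.nil_append, wordPerm, one_mul]
  | cons k v ih => rw [List.cons_append, wordPerm, wordPerm, ih, mul_assoc]

theorem wordPerm_reverse (w : List ℕ) : wordPerm w.reverse = (wordPerm w)⁻¹ := by
  induction w with
  | nil => rw [List.reverse_nil, wordPerm, inv_one]
  | cons k w ih =>
    rw [List.reverse_cons, wordPerm_append, ih, wordPerm, wordPerm, wordPerm, mul_one, mul_inv_rev,
      Equiv.swap_inv]

theorem act_append (v w : List ℕ) (x : PState) : act ω (v ++ w) x = act ω w (act ω v x) := by
  induction v generalizing x with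
  | nil => rfl
  | cons k v ih => exact ih _

theorem definedAlong_append (v w : List ℕ) (x : PState) :
    DefinedAlong ω (v ++ w) x ↔ DefinedAlong ω v x ∧ DefinedAlong ω w (act ω v x) := by
  induction v generalizing x with
  | nil => simp [DefinedAlong, act]
  | cons k v ih => simp only [List.cons_append, DefinedAlong, act, ih, and_assoc]

theorem act_ε {w : List ℕ} (hw : ∀ k ∈ w, 1 ≤ k ∧ k ≤ 8) (x : PState) (i : ℕ) :
    (act ω w x).ε i = x.ε (wordPerm w i) := by
  induction w generalizing x with
  | nil => rfl
  | cons k w ih =>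
    rw [act, ih (fun j hj => hw j (List.mem_cons_of_mem _ hj)),
      sRefl_ε (hw k List.mem_cons_self).1, wordPerm, Equiv.Perm.mul_apply]

theorem act_τ {w : List ℕ} (hw : ∀ k ∈ w, 1 ≤ k ∧ k ≤ 8) (x : PState) (i : ℕ) :
    (act ω w x).τ i = x.τ (wordPerm w i) := by
  induction w generalizing x with
  | nil => rfl
  | cons k w ih =>
    rw [act, ih (fun j hj => hw j (List.mem_cons_of_mem _ hj)),
      sRefl_τ (hw k List.mem_cons_self).1, wordPerm, Equiv.Perm.mul_apply]

theorem Represents.act {w : List ℕ} (hw : ∀ k ∈ w, 1 ≤ k ∧ k ≤ 8) {x : PState}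
    (hd : DefinedAlong ω w x) (h : Represents ω L x) : Represents ω L (act ω w x) := by
  induction w generalizing x with
  | nil => exact h
  | cons k w ih =>
    have hk := hw k List.mem_cons_self
    exact ih (fun j hj => hw j (List.mem_cons_of_mem _ hj)) hd.2.2 (h.sRefl hk.1 hk.2 hd.1)

/-- The functional `L'` represents the image of the point represented by `L` under the reflection
with centres `a`, `b`, `c`, which moves the state `x` to `x'`. -/
structure Transforms (ω : UpperHalfPlane) (L L' : (ℂ → ℂ) →ₗ[ℂ] ℂ) (x x' : PState)
    (a b c : ℕ) : Prop where
  ε_zero : x'.ε 0 = x.ε 0 + (x.ε 0 - x.ε a - x.ε b - x.ε c)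
  ε_a : x'.ε a = x.ε a + (x.ε 0 - x.ε a - x.ε b - x.ε c)
  ε_b : x'.ε b = x.ε b + (x.ε 0 - x.ε a - x.ε b - x.ε c)
  ε_c : x'.ε c = x.ε c + (x.ε 0 - x.ε a - x.ε b - x.ε c)
  ε_other : ∀ i, i ≠ 0 → i ≠ a → i ≠ b → i ≠ c → x'.ε i = x.ε i
  τ_a : x'.τ a * (x.τ b * x.τ c) = lineVal ω L (x.ε 0) (x.ε b) (x.ε c)
  τ_b : x'.τ b * (x.τ a * x.τ c) = lineVal ω L (x.ε 0) (x.ε a) (x.ε c)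
  τ_c : x'.τ c * (x.τ a * x.τ b) = lineVal ω L (x.ε 0) (x.ε a) (x.ε b)
  τ_other : ∀ i, i ≠ 0 → i ≠ a → i ≠ b → i ≠ c → x'.τ i = x.τ i
  a_ne : x.τ a ≠ 0
  b_ne : x.τ b ≠ 0
  c_ne : x.τ c ≠ 0
  bc_ne : lineVal ω L (x.ε 0) (x.ε b) (x.ε c) ≠ 0
  ac_ne : lineVal ω L (x.ε 0) (x.ε a) (x.ε c) ≠ 0
  ab_ne : lineVal ω L (x.ε 0) (x.ε a) (x.ε b) ≠ 0
  line_bc : x.τ a * x.τ b * x.τ c * lineVal ω L' (x'.ε 0) (x'.ε b) (x'.ε c)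
    = lineVal ω L (x.ε 0) (x.ε a) (x.ε b) * lineVal ω L (x.ε 0) (x.ε a) (x.ε c)
  line_ac : x.τ a * x.τ b * x.τ c * lineVal ω L' (x'.ε 0) (x'.ε a) (x'.ε c)
    = lineVal ω L (x.ε 0) (x.ε a) (x.ε b) * lineVal ω L (x.ε 0) (x.ε b) (x.ε c)
  line_ab : x.τ a * x.τ b * x.τ c * lineVal ω L' (x'.ε 0) (x'.ε a) (x'.ε b)
    = lineVal ω L (x.ε 0) (x.ε a) (x.ε c) * lineVal ω L (x.ε 0) (x.ε b) (x.ε c)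

/-- The word p brings the centres to positions 1, 2, 3, where s₀ acts on the values of the sides by
f ↦ 1/f. The nonvanishing of the three lines joining the centres is the nonvanishing of f required
for s₀. -/
theorem exists_transforms {p : List ℕ} {a b c : ℕ} (hp : ∀ k ∈ p, 1 ≤ k ∧ k ≤ 8)
    (h0 : wordPerm p 0 = 0) (h1 : wordPerm p 1 = a) (h2 : wordPerm p 2 = b)
    (h3 : wordPerm p 3 = c) {x : PState} (hL : Represents ω L x)
    (hd : DefinedAlong ω (p ++ [0] ++ p.reverse) x)
    (hab : th ω (x.ε a - x.ε b) ≠ 0) (hac : th ω (x.ε a - x.ε c) ≠ 0)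
    (hbc : th ω (x.ε b - x.ε c) ≠ 0) (habc : th ω (x.ε 0 - x.ε a - x.ε b - x.ε c) ≠ 0) :
    ∃ L', Represents ω L' (act ω (p ++ [0] ++ p.reverse) x) ∧
      Transforms ω L L' x (act ω (p ++ [0] ++ p.reverse) x) a b c := by
  rw [definedAlong_append, definedAlong_append] at hd
  obtain ⟨⟨hd1, hd2, -, -⟩, hd3⟩ := hd
  rw [act_append] at hd3
  rw [act_append, act_append]
  have hpr : ∀ k ∈ p.reverse, 1 ≤ k ∧ k ≤ 8 := fun k hk => hp k (List.mem_reverse.1 hk)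
  have hy := hL.act hp hd1
  have hyε := act_ε (ω := ω) hp x
  have hyτ := act_τ (ω := ω) hp x
  generalize act ω p x = y at *
  have hz : act ω [0] y = sRefl0 y := rfl
  rw [hz] at hd3 ⊢
  have hxε := act_ε (ω := ω) hpr (sRefl0 y)
  have hxτ := act_τ (ω := ω) hpr (sRefl0 y)
  obtain ⟨hτ, hf, -⟩ := hd2
  replace hf := hf rfl
  have hinv : ∀ i j, wordPerm p i = j → wordPerm p.reverse j = i := by
    intro i j h
    rw [wordPerm_reverse, Equiv.Perm.inv_eq_iff_eq, h]
  have hr0 := hinv _ _ h0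
  have hr1 := hinv _ _ h1
  have hr2 := hinv _ _ h2
  have hr3 := hinv _ _ h3
  obtain ⟨hy1, hy2, hy3⟩ := hy
  rw [tauProd] at hy1 hy2 hy3
  simp only [hyε, hyτ, h0, h1, h2, h3] at hy1 hy2 hy3
  have ta : x.τ a ≠ 0 := by have := hτ 1 le_rfl (by norm_num); rwa [hyτ, h1] at this
  have tb : x.τ b ≠ 0 := by have := hτ 2 (by norm_num) (by norm_num); rwa [hyτ, h2] at this
  have tc : x.τ c ≠ 0 := by have := hτ 3 (by norm_num) (by norm_num); rwa [hyτ, h3] at this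
  have f1 := hf 1 le_rfl (by norm_num)
  have f2 := hf 2 (by norm_num) (by norm_num)
  have f3 := hf 3 (by norm_num) (by norm_num)
  set α := x.ε 0 - x.ε a - x.ε b - x.ε c with hα
  -- The prescribed values are forced: after s₀ the product of the first three τ is f₁f₂f₃ times the
  -- old one, and multiplying by 1/f₁ leaves f₂f₃ times the old product, and so on.
  obtain ⟨L', hL1, hL2, hL3⟩ := exists_functional (ω := ω) (x.ε 0 + α) (x.ε a + α) (x.ε b + α)
    (x.ε c + α) (y.f 2 * y.f 3 * (x.τ a * x.τ b * x.τ c))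
    (y.f 1 * y.f 3 * (x.τ a * x.τ b * x.τ c)) (y.f 1 * y.f 2 * (x.τ a * x.τ b * x.τ c))
    (by rwa [add_sub_add_right_eq_sub]) (by rwa [add_sub_add_right_eq_sub])
    (by rwa [add_sub_add_right_eq_sub])
    (by rw [show x.ε 0 + α - (x.ε a + α) - (x.ε b + α) - (x.ε c + α) = -α by rw [hα]; ring,
          th_neg, neg_ne_zero]; exact habc)
  have z0 : (sRefl0 y).ε 0 = x.ε 0 + α := by
    simp [sRefl0, hyε, h0, h1, h2, h3, hα]; ring
  have z1 : (sRefl0 y).ε 1 = x.ε a + α := by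
    simp [sRefl0, hyε, h0, h1, h2, h3, hα]; ring
  have z2 : (sRefl0 y).ε 2 = x.ε b + α := by
    simp [sRefl0, hyε, h0, h1, h2, h3, hα]; ring
  have z3 : (sRefl0 y).ε 3 = x.ε c + α := by
    simp [sRefl0, hyε, h0, h1, h2, h3, hα]
  have u1 : (sRefl0 y).τ 1 = y.f 1 * x.τ a := by simp [sRefl0, hyτ, h1]
  have u2 : (sRefl0 y).τ 2 = y.f 2 * x.τ b := by simp [sRefl0, hyτ, h2]
  have u3 : (sRefl0 y).τ 3 = y.f 3 * x.τ c := by simp [sRefl0, hyτ, h3]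
  have hother : ∀ i, i ≠ 0 → i ≠ a → i ≠ b → i ≠ c → wordPerm p.reverse i ≠ 0 ∧
      wordPerm p.reverse i ≠ 1 ∧ wordPerm p.reverse i ≠ 2 ∧ wordPerm p.reverse i ≠ 3 := by
    intro i n0 na nb nc
    refine ⟨fun h => n0 ?_, fun h => na ?_, fun h => nb ?_, fun h => nc ?_⟩
    · exact (wordPerm p.reverse).injective (h.trans hr0.symm)
    · exact (wordPerm p.reverse).injective (h.trans hr1.symm)
    · exact (wordPerm p.reverse).injective (h.trans hr2.symm)
    · exact (wordPerm p.reverse).injective (h.trans hr3.symm)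
  have hback : ∀ i, wordPerm p (wordPerm p.reverse i) = i := by
    intro i
    rw [wordPerm_reverse, ← Equiv.Perm.mul_apply, mul_inv_cancel, Equiv.Perm.one_apply]
  have hrep : Represents ω L' (sRefl0 y) := by
    rw [Represents, tauProd, z0, z1, z2, z3, u1, u2, u3, hL1, hL2, hL3]
    have g1 : (sRefl0 y).f 1 = 1 / y.f 1 := rfl
    have g2 : (sRefl0 y).f 2 = 1 / y.f 2 := rfl
    have g3 : (sRefl0 y).f 3 = 1 / y.f 3 := rfl
    rw [g1, g2, g3]
    refine ⟨?_, ?_, ?_⟩ <;> field_simp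
  have hT : x.τ a * x.τ b * x.τ c ≠ 0 := mul_ne_zero (mul_ne_zero ta tb) tc
  refine ⟨L', hrep.act hpr hd3, ?_⟩
  constructor
  · rw [hxε, hr0, z0]
  · rw [hxε, hr1, z1]
  · rw [hxε, hr2, z2]
  · rw [hxε, hr3, z3]
  · intro i n0 na nb nc
    obtain ⟨m0, m1, m2, m3⟩ := hother i n0 na nb nc
    rw [hxε]
    simp only [sRefl0, if_neg m0, if_neg m1, if_neg m2, if_neg m3]
    rw [hyε, hback]
  · rw [hxτ, hr1, u1, hy1]; ring
  · rw [hxτ, hr2, u2, hy2]; ring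
  · rw [hxτ, hr3, u3, hy3]; ring
  · intro i n0 na nb nc
    obtain ⟨m0, m1, m2, m3⟩ := hother i n0 na nb nc
    rw [hxτ]
    simp only [sRefl0]
    rw [if_neg (by omega), hyτ, hback]
  · exact ta
  · exact tb
  · exact tc
  · rw [hy1]; exact mul_ne_zero f1 hT
  · rw [hy2]; exact mul_ne_zero f2 hT
  · rw [hy3]; exact mul_ne_zero f3 hT
  · rw [hxε, hxε, hxε, hr0, hr2, hr3, z0, z2, z3, hL1, hy2, hy3]; ring
  · rw [hxε, hxε, hxε, hr0, hr1, hr3, z0, z1, z3, hL2, hy1, hy3]; ring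
  · rw [hxε, hxε, hxε, hr0, hr1, hr2, z0, z1, z2, hL3, hy1, hy2]; ring

/-! ### The simple reflections are involutions, so words can be inverted. -/

theorem sRefl0_sRefl0 {x : PState} (h : ∀ i, 1 ≤ i → i ≤ 3 → x.f i ≠ 0) :
    sRefl0 (sRefl0 x) = x := by
  ext i
  · by_cases h0 : i = 0
    · subst h0; simp [sRefl0]; ring
    by_cases h1 : i = 1
    · subst h1; simp [sRefl0]; ring
    by_cases h2 : i = 2
    · subst h2; simp [sRefl0]; ring
    by_cases h3 : i = 3
    · subst h3; simp [sRefl0]; ring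
    simp [sRefl0, h0, h1, h2, h3]
  · simp only [sRefl0, one_div_one_div]
  · simp only [sRefl0]
    split_ifs with hi
    · have := h i hi.1 hi.2
      field_simp
    · rfl

/-- Replacing point 3 by point 4 in the triangle and then undoing this are inverse triangular
changes of coordinates; the two identities are the entries of their product. -/
theorem cCoef_swap {e e' : ℕ → ℂ} {i : ℕ} (h0 : e' 0 = e 0) (hi : i = 1 ∨ i = 2)
    (h1 : e' 1 = e 1) (h2 : e' 2 = e 2) (h3 : e' 3 = e 4) (h4 : e' 4 = e 3)
    (hn : th ω (e i - e 3) ≠ 0) (hr : th ω (root0 e) ≠ 0)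
    (hn' : th ω (e' i - e' 3) ≠ 0) (hr' : th ω (root0 e') ≠ 0) :
    cCoef ω e' i 3 * cCoef ω e i 3 = 1 ∧
      cCoef ω e' i 3 * cCoef ω e 3 i + cCoef ω e' 3 i = 0 := by
  have hei : e' i = e i := by rcases hi with rfl | rfl <;> assumption
  have h3i : ∀ f : ℕ → ℂ, th ω (f 3 - f i) = -th ω (f i - f 3) := fun f => by
    rw [← th_neg, neg_sub]
  have hr1 : root0 e + e 3 - e 4 = root0 e' := by
    simp only [root0, h0, h1, h2, h3]; ring
  have hr2 : root0 e' + e' 3 - e' 4 = root0 e := by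
    simp only [root0, h0, h1, h2, h3, h4]; ring
  have hr3 : root0 e' + e' i - e' 4 = root0 e + e i - e 4 := by
    simp only [root0, h0, h1, h2, h3, h4, hei]; ring
  have h34 : th ω (e' 3 - e' 4) = -th ω (e 3 - e 4) := by rw [h3, h4, ← th_neg, neg_sub]
  have hi3 : e i - e 4 = e' i - e' 3 := by rw [hei, h3]
  have hi4 : e' i - e' 4 = e i - e 3 := by rw [hei, h4]
  simp only [cCoef, hr1, hr2, hr3, h34, hi3, hi4, h3i]
  constructor
  · field_simp
  · field_simp
    ring

theorem sRefl_sRefl {k : ℕ} {x : PState} (hd : Defined ω k x) (hd' : Defined ω k (sRefl ω k x)) :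
    sRefl ω k (sRefl ω k x) = x := by
  rcases Nat.eq_zero_or_pos k with rfl | hk
  · simp only [sRefl, if_true]
    exact sRefl0_sRefl0 (hd.2.1 rfl)
  · ext i
    · rw [sRefl_ε hk, sRefl_ε hk, Equiv.swap_apply_self]
    · obtain rfl | rfl | rfl | hk4 : k = 1 ∨ k = 2 ∨ k = 3 ∨ 4 ≤ k := by omega
      · simp [sRefl]
      · simp [sRefl]
      · have t3 := hd.1 3 (by norm_num) (by norm_num)
        have t4 := hd.1 4 (by norm_num) (by norm_num)
        have hn := hd.2.2 rfl
        have hn' := hd'.2.2 rfl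
        have he : ∀ j, (sRefl ω 3 x).ε j = x.ε (Equiv.swap 3 4 j) := sRefl_ε hk x
        have ht : ∀ j, (sRefl ω 3 x).τ j = x.τ (Equiv.swap 3 4 j) := sRefl_τ hk x
        have hf3 : (sRefl ω 3 x).f 3 = x.τ 3 / x.τ 4 * x.f 3 := by simp [sRefl]
        have hc : ∀ j, j = 1 ∨ j = 2 → (sRefl ω 3 (sRefl ω 3 x)).f j = x.f j := by
          intro j hj
          have e0 : (sRefl ω 3 x).ε 0 = x.ε 0 := by rw [he]; congr 1
          have e1 : (sRefl ω 3 x).ε 1 = x.ε 1 := by rw [he]; congr 1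
          have e2 : (sRefl ω 3 x).ε 2 = x.ε 2 := by rw [he]; congr 1
          have e3 : (sRefl ω 3 x).ε 3 = x.ε 4 := by rw [he]; congr 1
          have e4 : (sRefl ω 3 x).ε 4 = x.ε 3 := by rw [he]; congr 1
          have u3 : (sRefl ω 3 x).τ 3 = x.τ 4 := by rw [ht]; congr 1
          have u4 : (sRefl ω 3 x).τ 4 = x.τ 3 := by rw [ht]; congr 1
          have hfj : (sRefl ω 3 x).f j
              = x.τ 3 / x.τ 4 * (cCoef ω x.ε j 3 * x.f j + cCoef ω x.ε 3 j * x.f 3) := by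
            simp only [sRefl, if_neg (show ¬(3 : ℕ) = 0 by norm_num),
              if_neg (show ¬(3 : ℕ) < 3 by norm_num), if_true, if_pos hj]
          have hfj' : (sRefl ω 3 (sRefl ω 3 x)).f j = x.τ 4 / x.τ 3
              * (cCoef ω (sRefl ω 3 x).ε j 3 * (sRefl ω 3 x).f j
                + cCoef ω (sRefl ω 3 x).ε 3 j * (sRefl ω 3 x).f 3) := by
            rw [← u3, ← u4]
            generalize sRefl ω 3 x = y
            simp only [sRefl, if_neg (show ¬(3 : ℕ) = 0 by norm_num),
              if_neg (show ¬(3 : ℕ) < 3 by norm_num), if_true, if_pos hj]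
          have hnj : th ω (x.ε j - x.ε 3) ≠ 0 := by
            rcases hj with rfl | rfl
            exacts [hn.1, hn.2.1]
          have hnj' : th ω ((sRefl ω 3 x).ε j - (sRefl ω 3 x).ε 3) ≠ 0 := by
            rcases hj with rfl | rfl
            exacts [hn'.1, hn'.2.1]
          obtain ⟨k1, k2⟩ := cCoef_swap e0 hj e1 e2 e3 e4 hnj hn.2.2 hnj' hn'.2.2
          rw [hfj', hfj, hf3]
          field_simp
          linear_combination x.f j * k1 + x.f 3 * k2
        by_cases h12 : i = 1 ∨ i = 2
        · exact hc i h12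
        · by_cases h3 : i = 3
          · subst h3
            have u3 : (sRefl ω 3 x).τ 3 = x.τ 4 := by rw [ht]; congr 1
            have u4 : (sRefl ω 3 x).τ 4 = x.τ 3 := by rw [ht]; congr 1
            have hf' : (sRefl ω 3 (sRefl ω 3 x)).f 3
                = x.τ 4 / x.τ 3 * (sRefl ω 3 x).f 3 := by
              rw [← u3, ← u4]
              generalize sRefl ω 3 x = y
              simp [sRefl]
            rw [hf', hf3]
            field_simp
          · simp [sRefl, h12, h3]
      · simp only [sRefl, if_neg (show ¬k = 0 by omega), if_neg (show ¬k < 3 by omega),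
          if_neg (show ¬k = 3 by omega)]
    · rw [sRefl_τ hk, sRefl_τ hk, Equiv.swap_apply_self]

/-- A composite that is defined along its word is inverted by the reversed word. -/
theorem definedAlong_reverse {w : List ℕ} {x : PState} (h : DefinedAlong ω w x) :
    DefinedAlong ω w.reverse (act ω w x) ∧ act ω w.reverse (act ω w x) = x := by
  induction w generalizing x with
  | nil => exact ⟨trivial, rfl⟩
  | cons k w ih =>
    obtain ⟨h1, h2, h3⟩ := h
    obtain ⟨i1, i2⟩ := ih h3
    have hs := sRefl_sRefl h1 h2
    rw [List.reverse_cons, definedAlong_append, act_append, act, i2]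
    refine ⟨⟨i1, h2, ?_, trivial⟩, hs⟩
    rwa [hs]

/-! ### The core reflection, general position, and the action on parameters. -/

/-- The word of the reflection which is followed by `s₆` in the translation. -/
def coreWord : List ℕ :=
  reflWord 1 2 6 ++ reflWord 3 4 6 ++ reflWord 5 8 9 ++ reflWord 3 4 6 ++ reflWord 1 2 6

theorem transWord_eq : transWord = coreWord ++ [6] := rfl

/-- Being a palindrome, the core is its own inverse wherever it is defined. This turns the backward
evolution into the forward one with 6 and 7 exchanged. -/
theorem coreWord_reverse : coreWord.reverse = coreWord := by decide

theorem wordPerm_permWord_126 : wordPerm (permWord 1 2 6) 0 = 0 ∧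
    wordPerm (permWord 1 2 6) 1 = 1 ∧ wordPerm (permWord 1 2 6) 2 = 2 ∧
    wordPerm (permWord 1 2 6) 3 = 6 := by decide

theorem wordPerm_permWord_346 : wordPerm (permWord 3 4 6) 0 = 0 ∧
    wordPerm (permWord 3 4 6) 1 = 3 ∧ wordPerm (permWord 3 4 6) 2 = 4 ∧
    wordPerm (permWord 3 4 6) 3 = 6 := by decide

theorem wordPerm_permWord_589 : wordPerm (permWord 5 8 9) 0 = 0 ∧
    wordPerm (permWord 5 8 9) 1 = 5 ∧ wordPerm (permWord 5 8 9) 2 = 8 ∧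
    wordPerm (permWord 5 8 9) 3 = 9 := by decide

/-- All differences of the parameters and all triples other than `{4, 5, 9}` are nondegenerate. -/
structure Generic (ω : UpperHalfPlane) (ε : ℕ → ℂ) : Prop where
  pair : ∀ i j, i ∈ Finset.Icc 1 9 → j ∈ Finset.Icc 1 9 → i ≠ j → th ω (ε i - ε j) ≠ 0
  triple : ∀ i j k, i ∈ Finset.Icc 1 9 → j ∈ Finset.Icc 1 9 → k ∈ Finset.Icc 1 9 → i ≠ j → i ≠ k →
    j ≠ k → ({i, j, k} : Finset ℕ) ≠ {4, 5, 9} → th ω (ε 0 - ε i - ε j - ε k) ≠ 0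

theorem GeneralPosition.generic {ε : ℕ → ℂ} (h : GeneralPosition ω ε) : Generic ω ε := by
  obtain ⟨h2, h3, -⟩ := h
  have key : ∀ i j k, 1 ≤ i → i < j → j < k → k ≤ 9 → ({i, j, k} : Finset ℕ) ≠ {4, 5, 9} →
      th ω (ε 0 - ε i - ε j - ε k) ≠ 0 := by
    intro i j k hi hij hjk hk hne
    refine h3 i j k hi hij hjk hk ?_
    rintro ⟨rfl, rfl, rfl⟩
    exact hne rfl
  constructor
  · intro i j hi hj hij
    rw [Finset.mem_Icc] at hi hj
    rcases lt_or_gt_of_ne hij with h | h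
    · exact h2 i j hi.1 h hj.2
    · have := h2 j i hj.1 h hi.2
      rwa [br2, ← neg_sub, th_neg, neg_ne_zero] at this
  · intro i j k hi hj hk hij hik hjk hne
    rw [Finset.mem_Icc] at hi hj hk
    have c1 : ({i, k, j} : Finset ℕ) = {i, j, k} := by rw [Finset.pair_comm]
    have c2 : ({j, i, k} : Finset ℕ) = {i, j, k} := Finset.insert_comm _ _ _
    have c3 : ({j, k, i} : Finset ℕ) = {i, j, k} := by
      rw [Finset.pair_comm, Finset.insert_comm]
    have c4 : ({k, i, j} : Finset ℕ) = {i, j, k} := by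
      rw [Finset.insert_comm, Finset.pair_comm]
    have c5 : ({k, j, i} : Finset ℕ) = {i, j, k} := by
      rw [Finset.pair_comm, c4]
    rcases lt_or_gt_of_ne hij with a | a <;> rcases lt_or_gt_of_ne hik with b | b <;>
      rcases lt_or_gt_of_ne hjk with c | c
    · exact key i j k hi.1 a c hk.2 hne
    · rw [show ε 0 - ε i - ε j - ε k = ε 0 - ε i - ε k - ε j by ring]
      exact key i k j hi.1 b c hj.2 (c1 ▸ hne)
    · omega
    · rw [show ε 0 - ε i - ε j - ε k = ε 0 - ε k - ε i - ε j by ring]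
      exact key k i j hk.1 b a hj.2 (c4 ▸ hne)
    · rw [show ε 0 - ε i - ε j - ε k = ε 0 - ε j - ε i - ε k by ring]
      exact key j i k hj.1 a b hk.2 (c2 ▸ hne)
    · omega
    · rw [show ε 0 - ε i - ε j - ε k = ε 0 - ε j - ε k - ε i by ring]
      exact key j k i hj.1 c b hi.2 (c3 ▸ hne)
    · rw [show ε 0 - ε i - ε j - ε k = ε 0 - ε k - ε j - ε i by ring]
      exact key k j i hk.1 c a hi.2 (c5 ▸ hne)

theorem Generic.congr {ε ε' : ℕ → ℂ} (h : Generic ω ε) (he : ∀ i, i ≤ 9 → ε' i = ε i) :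
    Generic ω ε' := by
  constructor
  · intro i j hi hj hij
    rw [he i (Finset.mem_Icc.1 hi).2, he j (Finset.mem_Icc.1 hj).2]
    exact h.pair i j hi hj hij
  · intro i j k hi hj hk hij hik hjk hne
    rw [he 0 (by norm_num), he i (Finset.mem_Icc.1 hi).2, he j (Finset.mem_Icc.1 hj).2,
      he k (Finset.mem_Icc.1 hk).2]
    exact h.triple i j k hi hj hk hij hik hjk hne

theorem Generic.swap {ε : ℕ → ℂ} (h : Generic ω ε) :
    Generic ω fun i => ε (Equiv.swap 6 7 i) := by
  have hmem : ∀ i ∈ Finset.Icc 1 9, Equiv.swap 6 7 i ∈ Finset.Icc 1 9 := by decide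
  have h0 : Equiv.swap 6 7 0 = 0 := by decide
  constructor
  · intro i j hi hj hij
    exact h.pair _ _ (hmem i hi) (hmem j hj) fun e => hij ((Equiv.swap 6 7).injective e)
  · intro i j k hi hj hk hij hik hjk hne
    simp only [h0]
    refine h.triple _ _ _ (hmem i hi) (hmem j hj) (hmem k hk)
      (fun e => hij ((Equiv.swap 6 7).injective e))
      (fun e => hik ((Equiv.swap 6 7).injective e))
      (fun e => hjk ((Equiv.swap 6 7).injective e)) fun e => hne ?_
    have e2 := congrArg (Finset.image (Equiv.swap 6 7)) e
    simpa [Finset.image_insert, Equiv.swap_apply_self, show Equiv.swap 6 7 4 = 4 by decide,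
      show Equiv.swap 6 7 5 = 5 by decide, show Equiv.swap 6 7 9 = 9 by decide] using e2

/-- The parameters transform linearly and independently of f and τ, so no definedness is needed
here. -/
theorem act_conj_ε {p : List ℕ} {a b c : ℕ} (hp : ∀ k ∈ p, 1 ≤ k ∧ k ≤ 8)
    (h0 : wordPerm p 0 = 0) (h1 : wordPerm p 1 = a) (h2 : wordPerm p 2 = b)
    (h3 : wordPerm p 3 = c) (x : PState) (i : ℕ) :
    (act ω (p ++ [0] ++ p.reverse) x).ε i = if i = 0 ∨ i = a ∨ i = b ∨ i = c
      then x.ε i + (x.ε 0 - x.ε a - x.ε b - x.ε c) else x.ε i := by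
  rw [act_append, act_append]
  have hpr : ∀ k ∈ p.reverse, 1 ≤ k ∧ k ≤ 8 := fun k hk => hp k (List.mem_reverse.1 hk)
  rw [act_ε hpr, wordPerm_reverse]
  have hz : ∀ y, act ω [0] y = sRefl0 y := fun _ => rfl
  rw [hz]
  obtain ⟨j, rfl⟩ := (wordPerm p).surjective i
  have hiff : ∀ {m n}, wordPerm p m = n → ∀ {j}, (wordPerm p j = n ↔ j = m) := by
    rintro m n rfl j
    exact (wordPerm p).injective.eq_iff
  have hback : (wordPerm p)⁻¹ (wordPerm p j) = j := by
    rw [← Equiv.Perm.mul_apply, inv_mul_cancel, Equiv.Perm.one_apply]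
  rw [hback]
  simp only [hiff h0, hiff h1, hiff h2, hiff h3]
  simp only [sRefl0, act_ε hp]
  by_cases j0 : j = 0
  · subst j0; simp [h0, h1, h2, h3]; ring
  by_cases j1 : j = 1
  · subst j1; simp [h0, h1, h2, h3]; ring
  by_cases j2 : j = 2
  · subst j2; simp [h0, h1, h2, h3]; ring
  by_cases j3 : j = 3
  · subst j3; simp [h0, h1, h2, h3]
  simp [j0, j1, j2, j3]

theorem act_reflWord_126_ε (x : PState) (i : ℕ) :
    (act ω (reflWord 1 2 6) x).ε i = if i = 0 ∨ i = 1 ∨ i = 2 ∨ i = 6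
      then x.ε i + (x.ε 0 - x.ε 1 - x.ε 2 - x.ε 6) else x.ε i :=
  act_conj_ε (by decide) wordPerm_permWord_126.1 wordPerm_permWord_126.2.1
    wordPerm_permWord_126.2.2.1 wordPerm_permWord_126.2.2.2 x i

theorem act_reflWord_346_ε (x : PState) (i : ℕ) :
    (act ω (reflWord 3 4 6) x).ε i = if i = 0 ∨ i = 3 ∨ i = 4 ∨ i = 6
      then x.ε i + (x.ε 0 - x.ε 3 - x.ε 4 - x.ε 6) else x.ε i :=
  act_conj_ε (by decide) wordPerm_permWord_346.1 wordPerm_permWord_346.2.1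
    wordPerm_permWord_346.2.2.1 wordPerm_permWord_346.2.2.2 x i

theorem act_reflWord_589_ε (x : PState) (i : ℕ) :
    (act ω (reflWord 5 8 9) x).ε i = if i = 0 ∨ i = 5 ∨ i = 8 ∨ i = 9
      then x.ε i + (x.ε 0 - x.ε 5 - x.ε 8 - x.ε 9) else x.ε i :=
  act_conj_ε (by decide) wordPerm_permWord_589.1 wordPerm_permWord_589.2.1
    wordPerm_permWord_589.2.2.1 wordPerm_permWord_589.2.2.2 x i

/-- The value of the root `δ - e₆ + e₇`. -/
noncomputable def rootγ (ε : ℕ → ℂ) : ℂ := delta ε - ε 6 + ε 7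

theorem delta_eq (ε : ℕ → ℂ) : delta ε = 3 * ε 0 - (ε 1 + ε 2 + ε 3 + ε 4 + ε 5 + ε 6 + ε 7
    + ε 8 + ε 9) := by
  rw [delta, show Finset.Icc 1 9 = {1, 2, 3, 4, 5, 6, 7, 8, 9} by decide]
  simp
  ring

/-- The parameters after the first two reflections. -/
noncomputable def midParam (ε : ℕ → ℂ) (i : ℕ) : ℂ :=
  if i = 0 ∨ i = 6 then ε i + (ε 0 - ε 1 - ε 2 - ε 6) + (ε 0 - ε 3 - ε 4 - ε 6)
  else if i = 1 ∨ i = 2 then ε i + (ε 0 - ε 1 - ε 2 - ε 6)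
  else if i = 3 ∨ i = 4 then ε i + (ε 0 - ε 3 - ε 4 - ε 6)
  else ε i

/-- The parameters after the five reflections. -/
noncomputable def coreParam (ε : ℕ → ℂ) (i : ℕ) : ℂ :=
  if i = 0 then ε i + 3 * rootγ ε
  else if i = 6 then ε i + 2 * rootγ ε
  else if i = 7 then ε i
  else ε i + rootγ ε

theorem act_mid_ε (x : PState) (i : ℕ) :
    (act ω (reflWord 3 4 6) (act ω (reflWord 1 2 6) x)).ε i = midParam x.ε i := by
  simp only [act_reflWord_346_ε, act_reflWord_126_ε, midParam]
  norm_num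
  by_cases h0 : i = 0
  · subst h0; norm_num; ring
  by_cases h6 : i = 6
  · subst h6; norm_num; ring
  by_cases h1 : i = 1
  · subst h1; norm_num
  by_cases h2 : i = 2
  · subst h2; norm_num
  by_cases h3 : i = 3
  · subst h3; norm_num; ring
  by_cases h4 : i = 4
  · subst h4; norm_num; ring
  simp [h0, h6, h1, h2, h3, h4]

/-- The multiples 3, 1, 2, 0 of γ are the coefficients, up to sign, of the root δ − e₆ + e₇. The
bound on i matters: the word fixes the entries beyond 9, whereas `coreParam` shifts them. -/
theorem act_coreWord_ε (x : PState) (i : ℕ) (hi : i ≤ 9) :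
    (act ω coreWord x).ε i = coreParam x.ε i := by
  rw [coreWord, act_append, act_append, act_append, act_append]
  simp only [act_reflWord_126_ε, act_reflWord_346_ε, act_reflWord_589_ε]
  simp only [coreParam, rootγ, delta_eq]
  interval_cases i <;> norm_num <;> ring

/-! ### The intermediate state, reached from both ends of the palindrome. -/

/-- The line through the `i`-th and the `j`-th point of a state, evaluated at the point given by
the functional `L`. -/
noncomputable def line (ω : UpperHalfPlane) (L : (ℂ → ℂ) →ₗ[ℂ] ℂ) (z : PState) (i j : ℕ) : ℂ :=
  lineVal ω L (z.ε 0) (z.ε i) (z.ε j)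

theorem line_comm (z : PState) (i j : ℕ) : line ω L z i j = line ω L z j i :=
  lineVal_comm _ _ _

/-- The three centres play symmetric roles, so facts proved for the first centre become available
for the other two. -/
theorem Transforms.rotate {x x' : PState} {a b c : ℕ} (h : Transforms ω L L' x x' a b c) :
    Transforms ω L L' x x' b c a where
  ε_zero := by rw [h.ε_zero]; ring
  ε_a := by rw [h.ε_b]; ring
  ε_b := by rw [h.ε_c]; ring
  ε_c := by rw [h.ε_a]; ring
  ε_other i n0 nb nc na := h.ε_other i n0 na nb nc
  τ_a := by rw [lineVal_comm, ← h.τ_b]; ring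
  τ_b := by rw [lineVal_comm, ← h.τ_c]; ring
  τ_c := by rw [← h.τ_a]
  τ_other i n0 nb nc na := h.τ_other i n0 na nb nc
  a_ne := h.b_ne
  b_ne := h.c_ne
  c_ne := h.a_ne
  bc_ne := by rw [lineVal_comm]; exact h.ac_ne
  ac_ne := by rw [lineVal_comm]; exact h.ab_ne
  ab_ne := h.bc_ne
  line_bc := by
    rw [lineVal_comm _ (x'.ε c), lineVal_comm _ (x.ε b) (x.ε a)]
    linear_combination h.line_ac
  line_ac := by
    rw [lineVal_comm _ (x'.ε b), lineVal_comm _ (x.ε c) (x.ε a)]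
    linear_combination h.line_ab
  line_ab := by
    rw [lineVal_comm _ (x.ε b) (x.ε a), lineVal_comm _ (x.ε c) (x.ε a)]
    linear_combination h.line_bc

theorem Transforms.line_through {x x' : PState} {a b c : ℕ} (h : Transforms ω L L' x x' a b c)
    (hbc : th ω (x.ε b - x.ε c) ≠ 0) (h0 : th ω (x.ε 0 - x.ε a - x.ε b - x.ε c) ≠ 0) {i : ℕ}
    (n0 : i ≠ 0) (na : i ≠ a) (nb : i ≠ b) (nc : i ≠ c) :
    x.τ a * x.τ b * x.τ c * line ω L' x' a i = line ω L x b c * line ω L x a i := by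
  have h1 := h.line_ab
  have h2 := h.line_ac
  rw [h.ε_zero, h.ε_a, h.ε_b] at h1
  rw [h.ε_zero, h.ε_a, h.ε_c] at h2
  rw [line, line, line, h.ε_zero, h.ε_a, h.ε_other i n0 na nb nc]
  exact lineVal_transform rfl h1 h2 hbc h0 _

theorem Transforms.mul_ne {x x' : PState} {a b c : ℕ} (h : Transforms ω L L' x x' a b c) :
    x.τ a * x.τ b * x.τ c ≠ 0 :=
  mul_ne_zero (mul_ne_zero h.a_ne h.b_ne) h.c_ne

/-- The coordinates `f` of the state `x` are given by lines at the intermediate state `z`. -/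
structure Intermediate (ω : UpperHalfPlane) (L : (ℂ → ℂ) →ₗ[ℂ] ℂ) (z x : PState) : Prop where
  τ3_ne : z.τ 3 ≠ 0
  τ6_ne : z.τ 6 ≠ 0
  ne_16 : line ω L z 1 6 ≠ 0
  ne_26 : line ω L z 2 6 ≠ 0
  ne_34 : line ω L z 3 4 ≠ 0
  ne_36 : line ω L z 3 6 ≠ 0
  ne_46 : line ω L z 4 6 ≠ 0
  f1 : x.f 1 * (z.τ 3 * line ω L z 2 6) = z.τ 6 * line ω L z 2 3
  f2 : x.f 2 * (z.τ 3 * line ω L z 1 6) = z.τ 6 * line ω L z 1 3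
  f3 : x.f 3 * (z.τ 3 * line ω L z 4 6) = z.τ 6 * line ω L z 4 3

/-- Every line that occurs passes through a centre of the reflection about to be applied, hence goes
to a line again up to known factors. The ratios f are carried through s₁₂₆ and then s₃₄₆. -/
theorem Intermediate.of_forward {L₀ L₁ L₂ : (ℂ → ℂ) →ₗ[ℂ] ℂ} {x x₁ x₂ : PState}
    (hL : Represents ω L₀ x) (h : Transforms ω L₀ L₁ x x₁ 1 2 6)
    (h' : Transforms ω L₁ L₂ x₁ x₂ 3 4 6)
    (n16 : th ω (x.ε 1 - x.ε 6) ≠ 0) (n26 : th ω (x.ε 2 - x.ε 6) ≠ 0)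
    (n126 : th ω (x.ε 0 - x.ε 1 - x.ε 2 - x.ε 6) ≠ 0)
    (n34 : th ω (x₁.ε 3 - x₁.ε 4) ≠ 0) (n46 : th ω (x₁.ε 4 - x₁.ε 6) ≠ 0)
    (n346 : th ω (x₁.ε 0 - x₁.ε 3 - x₁.ε 4 - x₁.ε 6) ≠ 0) :
    Intermediate ω L₂ x₂ x := by
  have hT := h.mul_ne
  have hT' := h'.mul_ne
  obtain ⟨r1, r2, r3⟩ := hL
  rw [tauProd] at r1 r2 r3
  change line ω L₀ x 2 3 = _ at r1
  change line ω L₀ x 1 3 = _ at r2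
  change line ω L₀ x 1 2 = _ at r3
  have neg : ∀ {a b : ℂ}, th ω (a - b) ≠ 0 → th ω (b - a) ≠ 0 := fun {a b} hh => by
    rwa [← neg_sub, th_neg, neg_ne_zero]
  have p1 := h.line_through n26 n126 (i := 3) (by norm_num) (by norm_num) (by norm_num)
    (by norm_num)
  have p2 := h.rotate.line_through (neg n16) (by rwa [show x.ε 0 - x.ε 2 - x.ε 6 - x.ε 1
    = x.ε 0 - x.ε 1 - x.ε 2 - x.ε 6 by ring]) (i := 3) (by norm_num) (by norm_num) (by norm_num)
    (by norm_num)
  have n346' : th ω (x₁.ε 0 - x₁.ε 6 - x₁.ε 3 - x₁.ε 4) ≠ 0 := by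
    rwa [show x₁.ε 0 - x₁.ε 6 - x₁.ε 3 - x₁.ε 4 = x₁.ε 0 - x₁.ε 3 - x₁.ε 4 - x₁.ε 6 by ring]
  have q1 := h'.line_through n46 n346 (i := 1) (by norm_num) (by norm_num) (by norm_num)
    (by norm_num)
  have q2 := h'.line_through n46 n346 (i := 2) (by norm_num) (by norm_num) (by norm_num)
    (by norm_num)
  have q1' := h'.rotate.rotate.line_through n34 n346' (i := 1) (by norm_num) (by norm_num)
    (by norm_num) (by norm_num)
  have q2' := h'.rotate.rotate.line_through n34 n346' (i := 2) (by norm_num) (by norm_num)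
    (by norm_num) (by norm_num)
  have l26 : x.τ 1 * x.τ 2 * x.τ 6 * line ω L₁ x₁ 2 6 = line ω L₀ x 1 2 * line ω L₀ x 1 6 :=
    h.line_bc
  have l16 : x.τ 1 * x.τ 2 * x.τ 6 * line ω L₁ x₁ 1 6 = line ω L₀ x 1 2 * line ω L₀ x 2 6 :=
    h.line_ac
  have l46 : x₁.τ 3 * x₁.τ 4 * x₁.τ 6 * line ω L₂ x₂ 4 6
    = line ω L₁ x₁ 3 4 * line ω L₁ x₁ 3 6 := h'.line_bc
  have l36 : x₁.τ 3 * x₁.τ 4 * x₁.τ 6 * line ω L₂ x₂ 3 6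
    = line ω L₁ x₁ 3 4 * line ω L₁ x₁ 4 6 := h'.line_ac
  have l34 : x₁.τ 3 * x₁.τ 4 * x₁.τ 6 * line ω L₂ x₂ 3 4
    = line ω L₁ x₁ 3 6 * line ω L₁ x₁ 4 6 := h'.line_ab
  have t6 : x₁.τ 6 * (x.τ 1 * x.τ 2) = line ω L₀ x 1 2 := h.τ_c
  have t3' : x₂.τ 3 * (x₁.τ 4 * x₁.τ 6) = line ω L₁ x₁ 4 6 := h'.τ_a
  have t6' : x₂.τ 6 * (x₁.τ 3 * x₁.τ 4) = line ω L₁ x₁ 3 4 := h'.τ_c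
  have m12 : line ω L₀ x 1 2 ≠ 0 := h.ab_ne
  have m16 : line ω L₀ x 1 6 ≠ 0 := h.ac_ne
  have m26 : line ω L₀ x 2 6 ≠ 0 := h.bc_ne
  have m34 : line ω L₁ x₁ 3 4 ≠ 0 := h'.ab_ne
  have m36 : line ω L₁ x₁ 3 6 ≠ 0 := h'.ac_ne
  have m46 : line ω L₁ x₁ 4 6 ≠ 0 := h'.bc_ne
  have t3 : x₁.τ 3 = x.τ 3 := h.τ_other 3 (by norm_num) (by norm_num) (by norm_num) (by norm_num)
  have a1 := h.a_ne
  have a2 := h.b_ne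
  have a6 := h.c_ne
  have b3 := h'.a_ne
  have b4 := h'.b_ne
  have b6 := h'.c_ne
  have m16' : line ω L₁ x₁ 1 6 ≠ 0 := by
    intro e; rw [e, mul_zero] at l16; exact mul_ne_zero m12 m26 l16.symm
  have m26' : line ω L₁ x₁ 2 6 ≠ 0 := by
    intro e; rw [e, mul_zero] at l26; exact mul_ne_zero m12 m16 l26.symm
  rw [line_comm _ 6 1] at q1'
  rw [line_comm x₁ 6 1] at q1'
  rw [line_comm _ 6 2] at q2'
  rw [line_comm x₁ 6 2] at q2'
  rw [line_comm x 6 1] at p2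
  -- After s₁₂₆ alone the first two coordinates already have the final form, and f₃ is just the
  -- quotient τ₆/τ₃.
  have e2 : x.f 1 * (x₁.τ 3 * line ω L₁ x₁ 2 6) = x₁.τ 6 * line ω L₁ x₁ 2 3 := by
    apply mul_left_cancel₀ (mul_ne_zero hT (mul_ne_zero a1 a2))
    rw [t3]
    linear_combination x.f 1 * x.τ 3 * x.τ 1 * x.τ 2 * l26 - x.τ 1 * x.τ 2 * x₁.τ 6 * p2
      - line ω L₀ x 1 6 * line ω L₀ x 2 3 * t6
      - line ω L₀ x 1 2 * line ω L₀ x 1 6 * r1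
  have e1 : x.f 2 * (x₁.τ 3 * line ω L₁ x₁ 1 6) = x₁.τ 6 * line ω L₁ x₁ 1 3 := by
    apply mul_left_cancel₀ (mul_ne_zero hT (mul_ne_zero a1 a2))
    rw [t3]
    linear_combination x.f 2 * x.τ 3 * x.τ 1 * x.τ 2 * l16 - x.τ 1 * x.τ 2 * x₁.τ 6 * p1
      - line ω L₀ x 2 6 * line ω L₀ x 1 3 * t6
      - line ω L₀ x 1 2 * line ω L₀ x 2 6 * r2
  have e3 : x.f 3 * x₁.τ 3 = x₁.τ 6 := by
    apply mul_left_cancel₀ (mul_ne_zero a1 a2)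
    rw [t3]
    linear_combination - t6 - r3
  have ne3 : x₂.τ 3 ≠ 0 := by
    intro e; rw [e, zero_mul] at t3'; exact m46 t3'.symm
  have ne6 : x₂.τ 6 ≠ 0 := by
    intro e; rw [e, zero_mul] at t6'; exact m34 t6'.symm
  constructor
  · exact ne3
  · exact ne6
  · intro e; rw [e, mul_zero] at q1'; exact mul_ne_zero m34 m16' q1'.symm
  · intro e; rw [e, mul_zero] at q2'; exact mul_ne_zero m34 m26' q2'.symm
  · intro e; rw [e, mul_zero] at l34; exact mul_ne_zero m36 m46 l34.symm
  · intro e; rw [e, mul_zero] at l36; exact mul_ne_zero m34 m46 l36.symm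
  · intro e; rw [e, mul_zero] at l46; exact mul_ne_zero m34 m36 l46.symm
  · apply mul_left_cancel₀ (mul_ne_zero hT' (mul_ne_zero (mul_ne_zero b3 b4) b6))
    rw [line_comm x₂ 2 3]
    rw [line_comm x₁ 2 3] at e2
    linear_combination x.f 1 * x₂.τ 3 * x₁.τ 3 * x₁.τ 4 * x₁.τ 6 * q2'
      - x₂.τ 6 * x₁.τ 3 * x₁.τ 4 * x₁.τ 6 * q2
      + x.f 1 * x₁.τ 3 * line ω L₁ x₁ 3 4 * line ω L₁ x₁ 2 6 * t3'
      - x₁.τ 6 * line ω L₁ x₁ 4 6 * line ω L₁ x₁ 3 2 * t6'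
      + line ω L₁ x₁ 3 4 * line ω L₁ x₁ 4 6 * e2
  · apply mul_left_cancel₀ (mul_ne_zero hT' (mul_ne_zero (mul_ne_zero b3 b4) b6))
    rw [line_comm x₂ 1 3]
    rw [line_comm x₁ 1 3] at e1
    linear_combination x.f 2 * x₂.τ 3 * x₁.τ 3 * x₁.τ 4 * x₁.τ 6 * q1'
      - x₂.τ 6 * x₁.τ 3 * x₁.τ 4 * x₁.τ 6 * q1
      + x.f 2 * x₁.τ 3 * line ω L₁ x₁ 3 4 * line ω L₁ x₁ 1 6 * t3'
      - x₁.τ 6 * line ω L₁ x₁ 4 6 * line ω L₁ x₁ 3 1 * t6'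
      + line ω L₁ x₁ 3 4 * line ω L₁ x₁ 4 6 * e1
  · apply mul_left_cancel₀ (mul_ne_zero hT' (mul_ne_zero (mul_ne_zero b3 b4) b6))
    rw [line_comm x₂ 4 3]
    linear_combination x.f 3 * x₂.τ 3 * x₁.τ 3 * x₁.τ 4 * x₁.τ 6 * l46
      - x₂.τ 6 * x₁.τ 3 * x₁.τ 4 * x₁.τ 6 * l34
      + x.f 3 * x₁.τ 3 * line ω L₁ x₁ 3 4 * line ω L₁ x₁ 3 6 * t3'
      - x₁.τ 6 * line ω L₁ x₁ 4 6 * line ω L₁ x₁ 3 6 * t6'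
      + line ω L₁ x₁ 3 4 * line ω L₁ x₁ 4 6 * line ω L₁ x₁ 3 6 * e3

/-- The last two reflections mirror the first two, so the final coordinates are the same quotients
of lines, now taken just after s₅₈₉. -/
theorem Intermediate.of_backward {L₃ L₄ L₅ : (ℂ → ℂ) →ₗ[ℂ] ℂ} {x₃ x₄ y : PState}
    (h : Transforms ω L₃ L₄ x₃ x₄ 3 4 6) (h' : Transforms ω L₄ L₅ x₄ y 1 2 6)
    (hL : Represents ω L₅ y)
    (n34 : th ω (x₃.ε 3 - x₃.ε 4) ≠ 0) (n46 : th ω (x₃.ε 4 - x₃.ε 6) ≠ 0)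
    (n346 : th ω (x₃.ε 0 - x₃.ε 3 - x₃.ε 4 - x₃.ε 6) ≠ 0)
    (n16 : th ω (x₄.ε 1 - x₄.ε 6) ≠ 0) (n26 : th ω (x₄.ε 2 - x₄.ε 6) ≠ 0)
    (n126 : th ω (x₄.ε 0 - x₄.ε 1 - x₄.ε 2 - x₄.ε 6) ≠ 0) :
    Intermediate ω L₃ x₃ y := by
  have hT := h.mul_ne
  have hT' := h'.mul_ne
  obtain ⟨r1, r2, r3⟩ := hL
  rw [tauProd] at r1 r2 r3
  change line ω L₅ y 2 3 = _ at r1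
  change line ω L₅ y 1 3 = _ at r2
  change line ω L₅ y 1 2 = _ at r3
  have neg : ∀ {a b : ℂ}, th ω (a - b) ≠ 0 → th ω (b - a) ≠ 0 := fun {a b} hh => by
    rwa [← neg_sub, th_neg, neg_ne_zero]
  have p1 := h'.line_through n26 n126 (i := 3) (by norm_num) (by norm_num) (by norm_num)
    (by norm_num)
  have p2 := h'.rotate.line_through (neg n16) (by rwa [show x₄.ε 0 - x₄.ε 2 - x₄.ε 6 - x₄.ε 1
    = x₄.ε 0 - x₄.ε 1 - x₄.ε 2 - x₄.ε 6 by ring]) (i := 3) (by norm_num) (by norm_num)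
    (by norm_num) (by norm_num)
  have n346' : th ω (x₃.ε 0 - x₃.ε 6 - x₃.ε 3 - x₃.ε 4) ≠ 0 := by
    rwa [show x₃.ε 0 - x₃.ε 6 - x₃.ε 3 - x₃.ε 4 = x₃.ε 0 - x₃.ε 3 - x₃.ε 4 - x₃.ε 6 by ring]
  have q1 := h.line_through n46 n346 (i := 1) (by norm_num) (by norm_num) (by norm_num)
    (by norm_num)
  have q2 := h.line_through n46 n346 (i := 2) (by norm_num) (by norm_num) (by norm_num)
    (by norm_num)
  have q1' := h.rotate.rotate.line_through n34 n346' (i := 1) (by norm_num) (by norm_num)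
    (by norm_num) (by norm_num)
  have q2' := h.rotate.rotate.line_through n34 n346' (i := 2) (by norm_num) (by norm_num)
    (by norm_num) (by norm_num)
  have l12 : x₄.τ 1 * x₄.τ 2 * x₄.τ 6 * line ω L₅ y 1 2
    = line ω L₄ x₄ 1 6 * line ω L₄ x₄ 2 6 := h'.line_ab
  have t1 : y.τ 1 * (x₄.τ 2 * x₄.τ 6) = line ω L₄ x₄ 2 6 := h'.τ_a
  have t2 : y.τ 2 * (x₄.τ 1 * x₄.τ 6) = line ω L₄ x₄ 1 6 := h'.τ_b
  have t3 : y.τ 3 = x₄.τ 3 := h'.τ_other 3 (by norm_num) (by norm_num) (by norm_num) (by norm_num)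
  have t3' : x₄.τ 3 * (x₃.τ 4 * x₃.τ 6) = line ω L₃ x₃ 4 6 := h.τ_a
  have t6' : x₄.τ 6 * (x₃.τ 3 * x₃.τ 4) = line ω L₃ x₃ 3 4 := h.τ_c
  have m34 : line ω L₃ x₃ 3 4 ≠ 0 := h.ab_ne
  have m36 : line ω L₃ x₃ 3 6 ≠ 0 := h.ac_ne
  have m46 : line ω L₃ x₃ 4 6 ≠ 0 := h.bc_ne
  have m16' : line ω L₄ x₄ 1 6 ≠ 0 := h'.ac_ne
  have m26' : line ω L₄ x₄ 2 6 ≠ 0 := h'.bc_ne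
  have a1 := h'.a_ne
  have a2 := h'.b_ne
  have a6 := h'.c_ne
  have b3 := h.a_ne
  have b4 := h.b_ne
  have b6 := h.c_ne
  rw [line_comm _ 6 1] at q1'
  rw [line_comm x₃ 6 1] at q1'
  rw [line_comm _ 6 2] at q2'
  rw [line_comm x₃ 6 2] at q2'
  rw [line_comm x₄ 6 1] at p2
  have ne4 : x₄.τ 3 ≠ 0 := by
    intro e; rw [e, zero_mul] at t3'; exact m46 t3'.symm
  have e2 : y.f 1 * (x₄.τ 3 * line ω L₄ x₄ 2 6) = x₄.τ 6 * line ω L₄ x₄ 2 3 := by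
    apply mul_left_cancel₀ m16'
    rw [r1, t3] at p2
    linear_combination x₄.τ 6 * p2 - y.f 1 * x₄.τ 3 * line ω L₄ x₄ 1 6 * t1
      - y.f 1 * x₄.τ 3 * y.τ 1 * x₄.τ 2 * x₄.τ 6 * t2
  have e1 : y.f 2 * (x₄.τ 3 * line ω L₄ x₄ 1 6) = x₄.τ 6 * line ω L₄ x₄ 1 3 := by
    apply mul_left_cancel₀ m26'
    rw [r2, t3] at p1
    linear_combination x₄.τ 6 * p1 - y.f 2 * x₄.τ 3 * line ω L₄ x₄ 1 6 * t1
      - y.f 2 * x₄.τ 3 * y.τ 1 * x₄.τ 2 * x₄.τ 6 * t2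
  have e3 : y.f 3 * x₄.τ 3 = x₄.τ 6 := by
    apply mul_left_cancel₀ (mul_ne_zero m16' m26')
    rw [r3, t3] at l12
    linear_combination x₄.τ 6 * l12 - y.f 3 * x₄.τ 3 * line ω L₄ x₄ 1 6 * t1
      - y.f 3 * x₄.τ 3 * y.τ 1 * x₄.τ 2 * x₄.τ 6 * t2
  constructor
  · exact b3
  · exact b6
  · intro e; rw [e, mul_zero] at q1'; exact mul_ne_zero h.rotate.rotate.mul_ne m16' q1'
  · intro e; rw [e, mul_zero] at q2'; exact mul_ne_zero h.rotate.rotate.mul_ne m26' q2'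
  · exact m34
  · exact m36
  · exact m46
  · apply mul_left_cancel₀ (mul_ne_zero m46 m34)
    rw [line_comm x₃ 2 3]
    rw [line_comm x₄ 2 3] at e2
    linear_combination (-y.f 1 * x₃.τ 3 * line ω L₃ x₃ 4 6) * q2'
      + x₃.τ 6 * line ω L₃ x₃ 3 4 * q2
      - y.f 1 * x₃.τ 3 * (x₃.τ 3 * x₃.τ 4 * x₃.τ 6 * line ω L₄ x₄ 2 6) * t3'
      + x₃.τ 6 * (x₃.τ 3 * x₃.τ 4 * x₃.τ 6 * line ω L₄ x₄ 3 2) * t6'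
      + x₃.τ 3 * (x₃.τ 3 * x₃.τ 4 * x₃.τ 6) * x₃.τ 4 * x₃.τ 6 * e2
  · apply mul_left_cancel₀ (mul_ne_zero m46 m34)
    rw [line_comm x₃ 1 3]
    rw [line_comm x₄ 1 3] at e1
    linear_combination (-y.f 2 * x₃.τ 3 * line ω L₃ x₃ 4 6) * q1'
      + x₃.τ 6 * line ω L₃ x₃ 3 4 * q1
      - y.f 2 * x₃.τ 3 * (x₃.τ 3 * x₃.τ 4 * x₃.τ 6 * line ω L₄ x₄ 1 6) * t3'
      + x₃.τ 6 * (x₃.τ 3 * x₃.τ 4 * x₃.τ 6 * line ω L₄ x₄ 3 1) * t6'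
      + x₃.τ 3 * (x₃.τ 3 * x₃.τ 4 * x₃.τ 6) * x₃.τ 4 * x₃.τ 6 * e1
  · rw [line_comm x₃ 4 3]
    linear_combination (-y.f 3 * x₃.τ 3) * t3' + x₃.τ 6 * t6'
      + x₃.τ 3 * x₃.τ 4 * x₃.τ 6 * e3

theorem th_ne_of_eq {a b : ℂ} (h : th ω a ≠ 0) (e : b = a) : th ω b ≠ 0 := e ▸ h

theorem th_ne_of_eq_neg {a b : ℂ} (h : th ω a ≠ 0) (e : b = -a) : th ω b ≠ 0 := by
  rwa [e, th_neg, neg_ne_zero]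

theorem exists_represents {x : PState} (hg : Generic ω x.ε) : ∃ L, Represents ω L x :=
  exists_functional (x.ε 0) (x.ε 1) (x.ε 2) (x.ε 3) _ _ _
    (hg.pair 1 2 (by decide) (by decide) (by decide))
    (hg.pair 1 3 (by decide) (by decide) (by decide))
    (hg.pair 2 3 (by decide) (by decide) (by decide))
    (hg.triple 1 2 3 (by decide) (by decide) (by decide) (by decide) (by decide) (by decide)
      (by decide))

/-- The nondegeneracy needed for the closing reflections comes in part from the image parameters,
since these reflections are the opening ones seen from the other end. The middle reflection needs
[γ] ≠ 0. -/
theorem exists_intermediate {x : PState} (hd : DefinedAlong ω coreWord x) (hg : Generic ω x.ε)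
    (hg' : Generic ω (coreParam x.ε)) (hγ : th ω (rootγ x.ε) ≠ 0) :
    ∃ (L L' : (ℂ → ℂ) →ₗ[ℂ] ℂ) (z z' : PState), (∀ i, z.ε i = midParam x.ε i) ∧
      Transforms ω L L' z z' 5 8 9 ∧ Intermediate ω L z x ∧
      Intermediate ω L' z' (act ω coreWord x) := by
  obtain ⟨L₀, hL₀⟩ := exists_represents hg
  rw [coreWord, definedAlong_append, definedAlong_append, definedAlong_append, definedAlong_append,
    act_append, act_append, act_append, act_append, act_append, act_append] at hd
  rw [coreWord, act_append, act_append, act_append, act_append]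
  obtain ⟨⟨⟨⟨d1, d2⟩, d3⟩, d4⟩, d5⟩ := hd
  have p12 := hg.pair 1 2 (by decide) (by decide) (by decide)
  have p34 := hg.pair 3 4 (by decide) (by decide) (by decide)
  have p16 := hg.pair 1 6 (by decide) (by decide) (by decide)
  have p26 := hg.pair 2 6 (by decide) (by decide) (by decide)
  have p58 := hg.pair 5 8 (by decide) (by decide) (by decide)
  have p59 := hg.pair 5 9 (by decide) (by decide) (by decide)
  have p89 := hg.pair 8 9 (by decide) (by decide) (by decide)
  have p126 := hg.triple 1 2 6 (by decide) (by decide) (by decide) (by decide) (by decide)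
    (by decide) (by decide)
  have p346 := hg.triple 3 4 6 (by decide) (by decide) (by decide) (by decide) (by decide)
    (by decide) (by decide)
  have p124 := hg.triple 1 2 4 (by decide) (by decide) (by decide) (by decide) (by decide)
    (by decide) (by decide)
  have p123 := hg.triple 1 2 3 (by decide) (by decide) (by decide) (by decide) (by decide)
    (by decide) (by decide)
  have r16 := hg'.pair 1 6 (by decide) (by decide) (by decide)
  have r26 := hg'.pair 2 6 (by decide) (by decide) (by decide)
  have r126 := hg'.triple 1 2 6 (by decide) (by decide) (by decide) (by decide) (by decide)
    (by decide) (by decide)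
  have r346 := hg'.triple 3 4 6 (by decide) (by decide) (by decide) (by decide) (by decide)
    (by decide) (by decide)
  simp only [coreParam] at r16 r26 r126 r346
  norm_num at r16 r26 r126 r346
  have e1 := act_reflWord_126_ε (ω := ω) x
  have e2 := act_mid_ε (ω := ω) x
  have e3 := act_reflWord_589_ε (ω := ω) (act ω (reflWord 3 4 6) (act ω (reflWord 1 2 6) x))
  have e4 := act_reflWord_346_ε (ω := ω)
    (act ω (reflWord 5 8 9) (act ω (reflWord 3 4 6) (act ω (reflWord 1 2 6) x)))
  obtain ⟨L₁, hL₁, h1⟩ := exists_transforms (by decide) wordPerm_permWord_126.1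
    wordPerm_permWord_126.2.1 wordPerm_permWord_126.2.2.1 wordPerm_permWord_126.2.2.2 hL₀ d1
    p12 p16 p26 p126
  change Represents ω L₁ (act ω (reflWord 1 2 6) x) at hL₁
  change Transforms ω L₀ L₁ x (act ω (reflWord 1 2 6) x) 1 2 6 at h1
  generalize act ω (reflWord 1 2 6) x = x₁ at *
  have n34 : th ω (x₁.ε 3 - x₁.ε 4) ≠ 0 :=
    th_ne_of_eq p34 (by simp only [e1]; norm_num)
  have n36 : th ω (x₁.ε 3 - x₁.ε 6) ≠ 0 :=
    th_ne_of_eq_neg p123 (by simp only [e1]; norm_num)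
  have n46 : th ω (x₁.ε 4 - x₁.ε 6) ≠ 0 :=
    th_ne_of_eq_neg p124 (by simp only [e1]; norm_num)
  have n346 : th ω (x₁.ε 0 - x₁.ε 3 - x₁.ε 4 - x₁.ε 6) ≠ 0 :=
    th_ne_of_eq p346 (by simp only [e1]; norm_num; ring)
  obtain ⟨L₂, hL₂, h2⟩ := exists_transforms (by decide) wordPerm_permWord_346.1
    wordPerm_permWord_346.2.1 wordPerm_permWord_346.2.2.1 wordPerm_permWord_346.2.2.2 hL₁ d2
    n34 n36 n46 n346
  change Represents ω L₂ (act ω (reflWord 3 4 6) x₁) at hL₂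
  change Transforms ω L₁ L₂ x₁ (act ω (reflWord 3 4 6) x₁) 3 4 6 at h2
  generalize act ω (reflWord 3 4 6) x₁ = x₂ at *
  have m58 : th ω (x₂.ε 5 - x₂.ε 8) ≠ 0 :=
    th_ne_of_eq p58 (by simp only [e2, midParam]; norm_num)
  have m59 : th ω (x₂.ε 5 - x₂.ε 9) ≠ 0 :=
    th_ne_of_eq p59 (by simp only [e2, midParam]; norm_num)
  have m89 : th ω (x₂.ε 8 - x₂.ε 9) ≠ 0 :=
    th_ne_of_eq p89 (by simp only [e2, midParam]; norm_num)
  have m589 : th ω (x₂.ε 0 - x₂.ε 5 - x₂.ε 8 - x₂.ε 9) ≠ 0 :=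
    th_ne_of_eq hγ (by simp only [e2, midParam, rootγ, delta_eq]; norm_num; ring)
  obtain ⟨L₃, hL₃, h3⟩ := exists_transforms (by decide) wordPerm_permWord_589.1
    wordPerm_permWord_589.2.1 wordPerm_permWord_589.2.2.1 wordPerm_permWord_589.2.2.2 hL₂ d3
    m58 m59 m89 m589
  change Represents ω L₃ (act ω (reflWord 5 8 9) x₂) at hL₃
  change Transforms ω L₂ L₃ x₂ (act ω (reflWord 5 8 9) x₂) 5 8 9 at h3
  generalize act ω (reflWord 5 8 9) x₂ = x₃ at *
  have k34 : th ω (x₃.ε 3 - x₃.ε 4) ≠ 0 :=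
    th_ne_of_eq p34 (by simp only [e3, e2, midParam]; norm_num)
  have k36 : th ω (x₃.ε 3 - x₃.ε 6) ≠ 0 :=
    th_ne_of_eq_neg p123 (by simp only [e3, e2, midParam]; norm_num)
  have k46 : th ω (x₃.ε 4 - x₃.ε 6) ≠ 0 :=
    th_ne_of_eq_neg p124 (by simp only [e3, e2, midParam]; norm_num)
  have k346 : th ω (x₃.ε 0 - x₃.ε 3 - x₃.ε 4 - x₃.ε 6) ≠ 0 :=
    th_ne_of_eq_neg r346 (by
      simp only [e3, e2, midParam, rootγ, delta_eq]; norm_num; ring)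
  obtain ⟨L₄, hL₄, h4⟩ := exists_transforms (by decide) wordPerm_permWord_346.1
    wordPerm_permWord_346.2.1 wordPerm_permWord_346.2.2.1 wordPerm_permWord_346.2.2.2 hL₃ d4
    k34 k36 k46 k346
  change Represents ω L₄ (act ω (reflWord 3 4 6) x₃) at hL₄
  change Transforms ω L₃ L₄ x₃ (act ω (reflWord 3 4 6) x₃) 3 4 6 at h4
  generalize act ω (reflWord 3 4 6) x₃ = x₄ at *
  have l12 : th ω (x₄.ε 1 - x₄.ε 2) ≠ 0 :=
    th_ne_of_eq p12 (by simp only [e4, e3, e2, midParam]; norm_num)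
  have l16 : th ω (x₄.ε 1 - x₄.ε 6) ≠ 0 :=
    th_ne_of_eq r16 (by simp only [e4, e3, e2, midParam, rootγ, delta_eq]; norm_num; ring)
  have l26 : th ω (x₄.ε 2 - x₄.ε 6) ≠ 0 :=
    th_ne_of_eq r26 (by simp only [e4, e3, e2, midParam, rootγ, delta_eq]; norm_num; ring)
  have l126 : th ω (x₄.ε 0 - x₄.ε 1 - x₄.ε 2 - x₄.ε 6) ≠ 0 :=
    th_ne_of_eq_neg r126 (by
      simp only [e4, e3, e2, midParam, rootγ, delta_eq]; norm_num; ring)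
  obtain ⟨L₅, hL₅, h5⟩ := exists_transforms (by decide) wordPerm_permWord_126.1
    wordPerm_permWord_126.2.1 wordPerm_permWord_126.2.2.1 wordPerm_permWord_126.2.2.2 hL₄ d5
    l12 l16 l26 l126
  exact ⟨L₂, L₃, x₂, x₃, e2, h3, .of_forward hL₀ h1 h2 p16 p26 p126 n34 n46 n346,
    .of_backward h4 h5 hL₅ k34 k46 k346 l16 l26 l126⟩

/-! ### Conics, and the relations between lines that hold on them. -/

theorem th_sub_comm (a b : ℂ) : th ω (a - b) = -th ω (b - a) := by rw [← th_neg, neg_sub]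

/-- The condition that a combination of `f₁, f₂, f₃` vanishes, in terms of lines joining four of the
points. -/
theorem sum_eq_conic {e₀ a b c d g s t f₁ f₂ f₃ P₁ P₂ P₄ : ℂ}
    (h1 : f₁ * (s * lineVal ω L e₀ b g) = t * lineVal ω L e₀ b c)
    (h2 : f₂ * (s * lineVal ω L e₀ a g) = t * lineVal ω L e₀ a c)
    (h3 : f₃ * (s * lineVal ω L e₀ d g) = t * lineVal ω L e₀ d c)
    (hP : th ω (b - g) * th ω (a - d) * P₂ - th ω (a - g) * th ω (b - d) * P₁
      - th ω (d - g) * th ω (a - b) * P₄ = 0)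
    (hbca : th ω (e₀ - b - c - a) ≠ 0) (hdca : th ω (e₀ - d - c - a) ≠ 0) :
    s * (lineVal ω L e₀ b g * lineVal ω L e₀ a g * lineVal ω L e₀ d g)
        * (th ω (a - g) * th ω (b - g) * th ω (d - g))
        * (th ω (a - d) * th ω (b - c) * P₂ * f₁ - th ω (b - d) * th ω (a - c) * P₁ * f₂
          - th ω (a - b) * th ω (d - c) * P₄ * f₃)
      = t * (th ω (c - g) * lineVal ω L e₀ c g)
        * (th ω (a - d) * th ω (b - g) * th ω (a - b) * th ω (d - g))
        * (P₄ * (lineVal ω L e₀ a d * lineVal ω L e₀ b g)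
          - P₂ * (lineVal ω L e₀ a b * lineVal ω L e₀ d g)) := by
  -- The relations for b, c, a, g and d, c, a, g replace the products of bc and dc with ag. The
  -- terms containing the line ac then cancel by `hP`, leaving a quadratic equation in lines joining
  -- a, b, d, g.
  have p2 := lineVal_plucker (L := L) e₀ b c a g hbca
  have p4 := lineVal_plucker (L := L) e₀ d c a g hdca
  rw [th_sub_comm b a, th_sub_comm c a, lineVal_comm e₀ b a, lineVal_comm e₀ c a] at p2
  rw [th_sub_comm d a, th_sub_comm c a, lineVal_comm e₀ d a, lineVal_comm e₀ c a] at p4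
  generalize lineVal ω L e₀ b g = Mbg at *
  generalize lineVal ω L e₀ a g = Mag at *
  generalize lineVal ω L e₀ d g = Mdg at *
  generalize lineVal ω L e₀ c g = Mcg at *
  generalize lineVal ω L e₀ b c = Mbc at *
  generalize lineVal ω L e₀ a c = Mac at *
  generalize lineVal ω L e₀ d c = Mdc at *
  generalize lineVal ω L e₀ a d = Mad at *
  generalize lineVal ω L e₀ a b = Mab at *
  generalize th ω (a - g) = ag at *
  generalize th ω (b - g) = bg at *
  generalize th ω (c - g) = cg at *
  generalize th ω (d - g) = dg at *
  generalize th ω (a - d) = ad at *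
  generalize th ω (b - d) = bd at *
  generalize th ω (a - b) = ab at *
  generalize th ω (b - c) = bc at *
  generalize th ω (a - c) = ac at *
  generalize th ω (d - c) = dc at *
  linear_combination ad * bc * P₂ * Mag * Mdg * ag * bg * dg * h1
    - bd * ac * P₁ * Mbg * Mdg * ag * bg * dg * h2
    - ab * dc * P₄ * Mbg * Mag * ag * bg * dg * h3
    + t * ad * P₂ * bg * dg * Mdg * p2 - t * ab * P₄ * dg * bg * Mbg * p4
    + t * ac * Mac * bg * Mbg * dg * Mdg * hP

/-- A point on the conic through the points `x, y, w, z, k`: the ratio of two lines through `k`. -/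
theorem line_ratio {e₀ x y w z k : ℂ} (hwz : th ω (w - z) ≠ 0)
    (h : th ω (e₀ - x - z - k) * th ω (e₀ - y - w - k)
        * (lineVal ω L e₀ x w * lineVal ω L e₀ y z)
      = th ω (e₀ - x - w - k) * th ω (e₀ - y - z - k)
        * (lineVal ω L e₀ x z * lineVal ω L e₀ y w)) :
    th ω (e₀ - y - w - z) * th ω (e₀ - x - w - k) * (lineVal ω L e₀ y k * lineVal ω L e₀ x z)
      = th ω (e₀ - x - w - z) * th ω (e₀ - y - w - k)
        * (lineVal ω L e₀ y z * lineVal ω L e₀ x k) := by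
  -- The pencils at x and y express the lines to k through the lines to w and z; the equation of the
  -- conic makes the two expressions proportional.
  have px := lineVal_pencil (ω := ω) (L := L) e₀ x w z k
  have py := lineVal_pencil (ω := ω) (L := L) e₀ y w z k
  simp only [thW] at px py
  rw [show e₀ - x - k - w = e₀ - x - w - k by ring] at px
  rw [show e₀ - y - k - w = e₀ - y - w - k by ring] at py
  apply mul_left_cancel₀ hwz
  linear_combination th ω (e₀ - x - w - k) * lineVal ω L e₀ x z * py
    - th ω (e₀ - y - w - k) * lineVal ω L e₀ y z * px + th ω (z - k) * h

/-- Two lines through `k` and `l` to a point on two conics through `x, y, w, z`. -/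
theorem line_ratio₂ {e₀ x y w z k l : ℂ} (hwz : th ω (w - z) ≠ 0)
    (hk : th ω (e₀ - x - z - k) * th ω (e₀ - y - w - k)
        * (lineVal ω L e₀ x w * lineVal ω L e₀ y z)
      = th ω (e₀ - x - w - k) * th ω (e₀ - y - z - k)
        * (lineVal ω L e₀ x z * lineVal ω L e₀ y w))
    (hl : th ω (e₀ - x - z - l) * th ω (e₀ - y - w - l)
        * (lineVal ω L e₀ x w * lineVal ω L e₀ y z)
      = th ω (e₀ - x - w - l) * th ω (e₀ - y - z - l)
        * (lineVal ω L e₀ x z * lineVal ω L e₀ y w))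
    (hx : lineVal ω L e₀ x z ≠ 0) (hy : lineVal ω L e₀ y z ≠ 0)
    (hxw : th ω (e₀ - x - w - z) ≠ 0) (hyw : th ω (e₀ - y - w - z) ≠ 0) :
    th ω (e₀ - l - x - w) * th ω (e₀ - k - y - w) * (lineVal ω L e₀ k x * lineVal ω L e₀ l y)
      = th ω (e₀ - k - x - w) * th ω (e₀ - l - y - w)
        * (lineVal ω L e₀ k y * lineVal ω L e₀ l x) := by
  have h1 := line_ratio hwz hk
  have h2 := line_ratio hwz hl
  rw [show e₀ - l - x - w = e₀ - x - w - l by ring, show e₀ - k - y - w = e₀ - y - w - k by ring,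
    show e₀ - k - x - w = e₀ - x - w - k by ring, show e₀ - l - y - w = e₀ - y - w - l by ring,
    lineVal_comm e₀ k x, lineVal_comm e₀ k y, lineVal_comm e₀ l x, lineVal_comm e₀ l y]
  apply mul_left_cancel₀ (mul_ne_zero (mul_ne_zero hx hy) (mul_ne_zero hxw hyw))
  linear_combination (-th ω (e₀ - x - w - z) * th ω (e₀ - y - w - l) * lineVal ω L e₀ x l
      * lineVal ω L e₀ y z) * h1
    + th ω (e₀ - x - w - z) * th ω (e₀ - y - w - k) * lineVal ω L e₀ x k
      * lineVal ω L e₀ y z * h2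

/-- The line joining two points not involved in a quadratic transformation. -/
theorem lineVal_transform_other {e₀ k m l γ T x y : ℂ} (hγ : γ = e₀ - k - m - l)
    (hkm : T * lineVal ω L' (e₀ + γ) (k + γ) (m + γ) = lineVal ω L e₀ k l * lineVal ω L e₀ m l)
    (hkl : T * lineVal ω L' (e₀ + γ) (k + γ) (l + γ) = lineVal ω L e₀ k m * lineVal ω L e₀ m l)
    (hml : T * lineVal ω L' (e₀ + γ) (m + γ) (l + γ) = lineVal ω L e₀ k m * lineVal ω L e₀ k l)
    (nml : th ω (m - l) ≠ 0) (nkm : th ω (k - m) ≠ 0) (nγ : th ω γ ≠ 0)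
    (nx : th ω (m - x) ≠ 0) (n1 : lineVal ω L e₀ k m ≠ 0) (n2 : lineVal ω L e₀ m l ≠ 0) :
    th ω (k - l) * th ω (x - y) * (T * lineVal ω L' (e₀ + γ) x y)
      = th ω (e₀ - m - l - x) * th ω (e₀ - k - m - y) * (lineVal ω L e₀ k x * lineVal ω L e₀ l y)
        - th ω (e₀ - m - l - y) * th ω (e₀ - k - m - x)
          * (lineVal ω L e₀ k y * lineVal ω L e₀ l x) := by
  have tk : ∀ z, T * lineVal ω L' (e₀ + γ) (k + γ) z = lineVal ω L e₀ m l * lineVal ω L e₀ k z :=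
    fun z => lineVal_transform hγ hkm hkl nml nγ z
  have tl : ∀ z, T * lineVal ω L' (e₀ + γ) (l + γ) z = lineVal ω L e₀ k m * lineVal ω L e₀ l z := by
    intro z
    refine lineVal_transform (by rw [hγ]; ring) ?_ ?_ nkm nγ z
    · rw [lineVal_comm, hkl, lineVal_comm e₀ l m, lineVal_comm]
      ring
    · rw [lineVal_comm, hml, lineVal_comm e₀ l k]
      ring
  -- In the image plane five of the six lines joining these points pass through a centre, so their
  -- values are known products; the relation is solved for the sixth.
  have p := lineVal_plucker (ω := ω) (L := L') (e₀ + γ) (k + γ) (l + γ) x y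
    (by rwa [show e₀ + γ - (k + γ) - (l + γ) - x = m - x by rw [hγ]; ring])
  rw [add_sub_add_right_eq_sub, show k + γ - x = e₀ - m - l - x by rw [hγ]; ring,
    show k + γ - y = e₀ - m - l - y by rw [hγ]; ring,
    show l + γ - x = e₀ - k - m - x by rw [hγ]; ring,
    show l + γ - y = e₀ - k - m - y by rw [hγ]; ring] at p
  have kx := tk x
  have ky := tk y
  have lx := tl x
  have ly := tl y
  apply mul_left_cancel₀ (mul_ne_zero n1 n2)
  linear_combination T ^ 2 * p - th ω (k - l) * th ω (x - y) * T * lineVal ω L' (e₀ + γ) x y * hkl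
    + th ω (e₀ - m - l - x) * th ω (e₀ - k - m - y) * (T * lineVal ω L' (e₀ + γ) (l + γ) y * kx
      + lineVal ω L e₀ m l * lineVal ω L e₀ k x * ly)
    - th ω (e₀ - m - l - y) * th ω (e₀ - k - m - x) * (T * lineVal ω L' (e₀ + γ) (l + γ) x * ky
      + lineVal ω L e₀ m l * lineVal ω L e₀ k y * lx)

theorem thW_swap_swap_sub (s x y z w : ℂ) :
    thW ω s x y * thW ω s z w - thW ω s x w * thW ω s z y = thW ω s x z * thW ω s y w := by
  have h := thW_three ω s x y z w
  rw [thW_swap ω s z y] at h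
  linear_combination h

/-- The three-term identity at e₀ − m − l, x, e₀ − k − m, y, where the first and third are the
residual points of lines on the cubic. The factor with 2e₀ is the bracket of a conic through six
points. -/
theorem th_four_one (e₀ k m l w x y : ℂ) :
    th ω (e₀ - m - l - x) * th ω (e₀ - k - m - y) * (th ω (e₀ - k - x - w) * th ω (e₀ - l - y - w))
      - th ω (e₀ - m - l - y) * th ω (e₀ - k - m - x)
        * (th ω (e₀ - l - x - w) * th ω (e₀ - k - y - w))
      = th ω (k - l) * th ω (x - y) * (th ω (m - w) * th ω (2 * e₀ - k - l - x - y - m - w)) := by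
  have h := thW_three ω (2 * e₀ - k - w - m - l) (e₀ - m - l) x (e₀ - k - m) y
  simp only [thW] at h
  rw [show 2 * e₀ - k - w - m - l - (e₀ - m - l) - x = e₀ - k - x - w by ring,
    show 2 * e₀ - k - w - m - l - (e₀ - k - m) - y = e₀ - l - y - w by ring,
    show e₀ - m - l - (e₀ - k - m) = k - l by ring,
    show 2 * e₀ - k - w - m - l - (e₀ - m - l) - (e₀ - k - m) = m - w by ring,
    show 2 * e₀ - k - w - m - l - x - y = 2 * e₀ - k - l - x - y - m - w by ring,
    show 2 * e₀ - k - w - m - l - (e₀ - m - l) - y = e₀ - k - y - w by ring,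
    show x - (e₀ - k - m) = -(e₀ - k - m - x) by ring,
    show 2 * e₀ - k - w - m - l - x - (e₀ - k - m) = e₀ - l - x - w by ring, th_neg] at h
  linear_combination h

/-- Comparison of the lines joining `x` and `y` before and after the transformation. -/
theorem lineVal_transform_ratio {e₀ k m l γ T x y w : ℂ}
    (hS : th ω (k - l) * th ω (x - y) * (T * lineVal ω L' (e₀ + γ) x y)
      = th ω (e₀ - m - l - x) * th ω (e₀ - k - m - y) * (lineVal ω L e₀ k x * lineVal ω L e₀ l y)
        - th ω (e₀ - m - l - y) * th ω (e₀ - k - m - x)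
          * (lineVal ω L e₀ k y * lineVal ω L e₀ l x))
    (hR : th ω (e₀ - l - x - w) * th ω (e₀ - k - y - w)
        * (lineVal ω L e₀ k x * lineVal ω L e₀ l y)
      = th ω (e₀ - k - x - w) * th ω (e₀ - l - y - w)
        * (lineVal ω L e₀ k y * lineVal ω L e₀ l x))
    (nkl : th ω (k - l) ≠ 0) (nxy : th ω (x - y) ≠ 0) (nk : th ω (e₀ - k - x - w) ≠ 0)
    (nl : th ω (e₀ - l - y - w) ≠ 0) (np : th ω (e₀ - k - x - y) ≠ 0) :
    T * lineVal ω L' (e₀ + γ) x y * (th ω (e₀ - k - l - w) * th ω (e₀ - x - y - w))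
        = lineVal ω L e₀ k l * lineVal ω L e₀ x y
          * (th ω (m - w) * th ω (2 * e₀ - k - l - x - y - m - w)) ∧
      th ω (e₀ - k - x - w) * th ω (e₀ - l - y - w) * (T * lineVal ω L' (e₀ + γ) x y)
        = lineVal ω L e₀ k x * lineVal ω L e₀ l y
          * (th ω (m - w) * th ω (2 * e₀ - k - l - x - y - m - w)) ∧
      th ω (e₀ - k - x - w) * th ω (e₀ - l - y - w) * (lineVal ω L e₀ k l * lineVal ω L e₀ x y)
        = lineVal ω L e₀ k x * lineVal ω L e₀ l y
          * (th ω (e₀ - k - l - w) * th ω (e₀ - x - y - w)) := by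
  have hp := lineVal_plucker (ω := ω) (L := L) e₀ x y k l
    (by rwa [show e₀ - x - y - k = e₀ - k - x - y by ring])
  rw [lineVal_comm e₀ x k, lineVal_comm e₀ y l, lineVal_comm e₀ x l, lineVal_comm e₀ y k,
    th_sub_comm x k, th_sub_comm y l, th_sub_comm x l, th_sub_comm y k] at hp
  have hf := th_four_one (ω := ω) e₀ k m l w x y
  have hw := thW_swap_swap_sub (ω := ω) (e₀ - w) k x l y
  simp only [thW] at hw
  simp only [show ∀ u v : ℂ, e₀ - w - u - v = e₀ - u - v - w by intros; ring] at hw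
  have hkl := mul_ne_zero nkl nxy
  -- `hR` trades the product of ky and lx for that of kx and ly. Both the new line xy and the old
  -- one then become multiples of the latter product, with a theta difference that factorises.
  have r2 : th ω (e₀ - k - x - w) * th ω (e₀ - l - y - w) * (T * lineVal ω L' (e₀ + γ) x y)
        = lineVal ω L e₀ k x * lineVal ω L e₀ l y
          * (th ω (m - w) * th ω (2 * e₀ - k - l - x - y - m - w)) := by
    apply mul_left_cancel₀ hkl
    linear_combination th ω (e₀ - k - x - w) * th ω (e₀ - l - y - w) * hS
      + lineVal ω L e₀ k x * lineVal ω L e₀ l y * hf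
      + th ω (e₀ - m - l - y) * th ω (e₀ - k - m - x) * hR
  have r3 : th ω (e₀ - k - x - w) * th ω (e₀ - l - y - w)
          * (lineVal ω L e₀ k l * lineVal ω L e₀ x y)
        = lineVal ω L e₀ k x * lineVal ω L e₀ l y
          * (th ω (e₀ - k - l - w) * th ω (e₀ - x - y - w)) := by
    apply mul_left_cancel₀ hkl
    linear_combination th ω (e₀ - k - x - w) * th ω (e₀ - l - y - w) * hp
      + lineVal ω L e₀ k x * lineVal ω L e₀ l y * hw
      + th ω (k - y) * th ω (l - x) * hR
  refine ⟨?_, r2, r3⟩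
  apply mul_left_cancel₀ (mul_ne_zero nk nl)
  linear_combination th ω (e₀ - k - l - w) * th ω (e₀ - x - y - w) * r2
    - (th ω (m - w) * th ω (2 * e₀ - k - l - x - y - m - w)) * r3

/-- On the conic the quotient of the lines xc and xy is a combination of two bracketed products that
do not involve x. The same two quantities therefore serve for different x. -/
theorem line_through_pair {e₀ k l c x y w : ℂ}
    (hR : th ω (e₀ - l - x - w) * th ω (e₀ - k - y - w)
        * (lineVal ω L e₀ k x * lineVal ω L e₀ l y)
      = th ω (e₀ - k - x - w) * th ω (e₀ - l - y - w)
        * (lineVal ω L e₀ k y * lineVal ω L e₀ l x))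
    (h3 : th ω (e₀ - k - x - w) * th ω (e₀ - l - y - w)
        * (lineVal ω L e₀ k l * lineVal ω L e₀ x y)
      = lineVal ω L e₀ k x * lineVal ω L e₀ l y
        * (th ω (e₀ - k - l - w) * th ω (e₀ - x - y - w)))
    (nt : th ω (e₀ - x - c - k) ≠ 0) (nkl : lineVal ω L e₀ k l ≠ 0)
    (nkx : lineVal ω L e₀ k x ≠ 0) :
    lineVal ω L e₀ x c * (lineVal ω L e₀ k y * lineVal ω L e₀ l y)
        * (th ω (k - l) * th ω (x - c) * (th ω (e₀ - k - l - w) * th ω (e₀ - x - y - w)))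
      = lineVal ω L e₀ x y
        * (th ω (k - x) * th ω (l - c) * th ω (e₀ - k - x - w)
            * (th ω (e₀ - l - y - w) * lineVal ω L e₀ l c * lineVal ω L e₀ k y)
          - th ω (k - c) * th ω (l - x) * th ω (e₀ - l - x - w)
            * (th ω (e₀ - k - y - w) * lineVal ω L e₀ k c * lineVal ω L e₀ l y)) := by
  have hp := lineVal_plucker (ω := ω) (L := L) e₀ x c k l nt
  rw [lineVal_comm e₀ x k, lineVal_comm e₀ c l, lineVal_comm e₀ x l, lineVal_comm e₀ c k,
    th_sub_comm x k, th_sub_comm c l, th_sub_comm x l, th_sub_comm c k] at hp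
  apply mul_left_cancel₀ (mul_ne_zero nkl nkx)
  linear_combination lineVal ω L e₀ k x * lineVal ω L e₀ k y * lineVal ω L e₀ l y
      * (th ω (e₀ - k - l - w) * th ω (e₀ - x - y - w)) * hp
    - (th ω (k - x) * th ω (l - c) * lineVal ω L e₀ k x * lineVal ω L e₀ l c
      - th ω (k - c) * th ω (l - x) * lineVal ω L e₀ k c * lineVal ω L e₀ l x)
        * lineVal ω L e₀ k y * h3
    + th ω (k - c) * th ω (l - x) * lineVal ω L e₀ k c * lineVal ω L e₀ k l
        * lineVal ω L e₀ x y * hR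

/-- The analogue of `line_through_pair` for the lines after the middle reflection, expressed in the
same two quantities before it. -/
theorem line_through_pair_transform {e₀ k m l γ T c x y w : ℂ}
    (hS : th ω (k - l) * th ω (x - c) * (T * lineVal ω L' (e₀ + γ) x c)
      = th ω (e₀ - m - l - x) * th ω (e₀ - k - m - c) * (lineVal ω L e₀ k x * lineVal ω L e₀ l c)
        - th ω (e₀ - m - l - c) * th ω (e₀ - k - m - x)
          * (lineVal ω L e₀ k c * lineVal ω L e₀ l x))
    (hR : th ω (e₀ - l - x - w) * th ω (e₀ - k - y - w)
        * (lineVal ω L e₀ k x * lineVal ω L e₀ l y)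
      = th ω (e₀ - k - x - w) * th ω (e₀ - l - y - w)
        * (lineVal ω L e₀ k y * lineVal ω L e₀ l x))
    (h2 : th ω (e₀ - k - x - w) * th ω (e₀ - l - y - w) * (T * lineVal ω L' (e₀ + γ) x y)
        = lineVal ω L e₀ k x * lineVal ω L e₀ l y
          * (th ω (m - w) * th ω (2 * e₀ - k - l - x - y - m - w)))
    (nT : T ≠ 0) (nkx : lineVal ω L e₀ k x ≠ 0) :
    lineVal ω L' (e₀ + γ) x c * (lineVal ω L e₀ k y * lineVal ω L e₀ l y)
        * (th ω (k - l) * th ω (x - c)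
          * (th ω (m - w) * th ω (2 * e₀ - k - l - x - y - m - w)))
      = lineVal ω L' (e₀ + γ) x y
        * (th ω (e₀ - m - l - x) * th ω (e₀ - k - m - c) * th ω (e₀ - k - x - w)
            * (th ω (e₀ - l - y - w) * lineVal ω L e₀ l c * lineVal ω L e₀ k y)
          - th ω (e₀ - m - l - c) * th ω (e₀ - k - m - x) * th ω (e₀ - l - x - w)
            * (th ω (e₀ - k - y - w) * lineVal ω L e₀ k c * lineVal ω L e₀ l y)) := by
  apply mul_left_cancel₀ (mul_ne_zero nT nkx)
  linear_combination lineVal ω L e₀ k x * lineVal ω L e₀ k y * lineVal ω L e₀ l y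
      * (th ω (m - w) * th ω (2 * e₀ - k - l - x - y - m - w)) * hS
    - (th ω (e₀ - m - l - x) * th ω (e₀ - k - m - c) * lineVal ω L e₀ k x * lineVal ω L e₀ l c
      - th ω (e₀ - m - l - c) * th ω (e₀ - k - m - x) * lineVal ω L e₀ k c * lineVal ω L e₀ l x)
        * lineVal ω L e₀ k y * h2
    + th ω (e₀ - m - l - c) * th ω (e₀ - k - m - x) * lineVal ω L e₀ k c * T
        * lineVal ω L' (e₀ + γ) x y * hR

theorem th_four_two (e₀ k m l a c w : ℂ) :
    th ω (e₀ - a - c - w) * th ω (e₀ - k - l - w)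
        * (th ω (e₀ - m - l - a) * th ω (e₀ - k - m - c))
      - th ω (2 * e₀ - k - l - a - c - m - w) * th ω (m - w) * (th ω (k - a) * th ω (l - c))
      = th ω (e₀ - k - c - w) * th ω (e₀ - l - a - w)
        * (th ω (e₀ - k - m - l) * th ω (e₀ - m - a - c)) := by
  have h := thW_three ω (2 * e₀ - k - l - a - c) m w (e₀ - a - l) (e₀ - k - l)
  simp only [thW] at h
  rw [show 2 * e₀ - k - l - a - c - m - (e₀ - a - l) = e₀ - k - m - c by ring,
    show e₀ - a - l - (e₀ - k - l) = k - a by ring,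
    show 2 * e₀ - k - l - a - c - (e₀ - a - l) - (e₀ - k - l) = l - c by ring,
    show m - (e₀ - a - l) = -(e₀ - m - l - a) by ring,
    show w - (e₀ - k - l) = -(e₀ - k - l - w) by ring,
    show 2 * e₀ - k - l - a - c - w - (e₀ - k - l) = e₀ - a - c - w by ring,
    show m - (e₀ - k - l) = -(e₀ - k - m - l) by ring,
    show 2 * e₀ - k - l - a - c - m - (e₀ - k - l) = e₀ - m - a - c by ring,
    show w - (e₀ - a - l) = -(e₀ - l - a - w) by ring,
    show 2 * e₀ - k - l - a - c - w - (e₀ - a - l) = e₀ - k - c - w by ring,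
    th_neg, th_neg, th_neg, th_neg] at h
  linear_combination -h

theorem th_four_three (e₀ k a b c w : ℂ) :
    th ω (e₀ - a - c - w) * th ω (a - c) * (th ω (k - b) * th ω (e₀ - k - b - w))
      - th ω (e₀ - b - c - w) * th ω (b - c) * (th ω (k - a) * th ω (e₀ - k - a - w))
      = th ω (a - b) * th ω (e₀ - a - b - w) * (th ω (k - c) * th ω (e₀ - k - c - w)) := by
  have h := thW_swap_swap_sub (ω := ω) (e₀ - w) a c k b
  simp only [thW] at h
  simp only [show ∀ u v : ℂ, e₀ - w - u - v = e₀ - u - v - w by intros; ring] at h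
  rw [th_sub_comm c b] at h
  rw [show e₀ - c - b - w = e₀ - b - c - w by ring] at h
  rw [show e₀ - a - k - w = e₀ - k - a - w by ring, th_sub_comm a k] at h
  linear_combination h

/-- The linear relation between the first coordinate at two consecutive times, in terms of the
parameters of the intermediate state; `a, b, c, d, g` and `k, m, l` stand for the points with
numbers `1, 2, 3, 4, 6` and `5, 8, 9`. -/
theorem intermediate_relation {e₀ a b c d g k m l γ s t f₁ f₂ F₁ : ℂ}
    (h1 : f₁ * (s * lineVal ω L e₀ b g) = t * lineVal ω L e₀ b c)
    (h2 : f₂ * (s * lineVal ω L e₀ a g) = t * lineVal ω L e₀ a c)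
    (h3 : F₁ * (s * lineVal ω L' (e₀ + γ) b g) = t * lineVal ω L' (e₀ + γ) b c)
    (hb : lineVal ω L e₀ b c * (lineVal ω L e₀ k g * lineVal ω L e₀ l g)
        * (th ω (k - l) * th ω (b - c) * (th ω (e₀ - k - l - d) * th ω (e₀ - b - g - d)))
      = lineVal ω L e₀ b g
        * (th ω (k - b) * th ω (l - c) * th ω (e₀ - k - b - d)
            * (th ω (e₀ - l - g - d) * lineVal ω L e₀ l c * lineVal ω L e₀ k g)
          - th ω (k - c) * th ω (l - b) * th ω (e₀ - l - b - d)
            * (th ω (e₀ - k - g - d) * lineVal ω L e₀ k c * lineVal ω L e₀ l g)))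
    (ha : lineVal ω L e₀ a c * (lineVal ω L e₀ k g * lineVal ω L e₀ l g)
        * (th ω (k - l) * th ω (a - c) * (th ω (e₀ - k - l - d) * th ω (e₀ - a - g - d)))
      = lineVal ω L e₀ a g
        * (th ω (k - a) * th ω (l - c) * th ω (e₀ - k - a - d)
            * (th ω (e₀ - l - g - d) * lineVal ω L e₀ l c * lineVal ω L e₀ k g)
          - th ω (k - c) * th ω (l - a) * th ω (e₀ - l - a - d)
            * (th ω (e₀ - k - g - d) * lineVal ω L e₀ k c * lineVal ω L e₀ l g)))
    (hT : lineVal ω L' (e₀ + γ) b c * (lineVal ω L e₀ k g * lineVal ω L e₀ l g)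
        * (th ω (k - l) * th ω (b - c)
          * (th ω (m - d) * th ω (2 * e₀ - k - l - b - g - m - d)))
      = lineVal ω L' (e₀ + γ) b g
        * (th ω (e₀ - m - l - b) * th ω (e₀ - k - m - c) * th ω (e₀ - k - b - d)
            * (th ω (e₀ - l - g - d) * lineVal ω L e₀ l c * lineVal ω L e₀ k g)
          - th ω (e₀ - m - l - c) * th ω (e₀ - k - m - b) * th ω (e₀ - l - b - d)
            * (th ω (e₀ - k - g - d) * lineVal ω L e₀ k c * lineVal ω L e₀ l g)))
    (ns : s ≠ 0) (nag : lineVal ω L e₀ a g ≠ 0)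
    (nbg : lineVal ω L e₀ b g ≠ 0) (nbg' : lineVal ω L' (e₀ + γ) b g ≠ 0)
    (nkg : lineVal ω L e₀ k g ≠ 0) (nlg : lineVal ω L e₀ l g ≠ 0)
    (nkl : th ω (k - l) ≠ 0) (nbc : th ω (b - c) ≠ 0) (nkld : th ω (e₀ - k - l - d) ≠ 0) :
    th ω (m - d) * th ω (e₀ - a - b - d) * (th ω (k - c) * th ω (l - c)) * th ω (a - b)
        * (th ω (e₀ - b - c - d) * th ω (2 * e₀ - k - l - b - g - m - d) * F₁
          - th ω (2 * e₀ - k - l - b - c - m - d) * th ω (e₀ - b - g - d) * f₁)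
      = th ω (e₀ - l - b - d) * th ω (e₀ - k - b - d)
        * (th ω (e₀ - k - m - l) * th ω (e₀ - m - b - c)) * th ω (a - c)
        * (th ω (e₀ - b - g - d) * th ω (e₀ - a - c - d) * f₁
          - th ω (e₀ - a - g - d) * th ω (e₀ - b - c - d) * f₂) := by
  have i1 := th_four_two (ω := ω) e₀ k m l b c d
  have i1' := th_four_two (ω := ω) e₀ l m k b c d
  rw [show e₀ - l - k - d = e₀ - k - l - d by ring, show e₀ - m - k - b = e₀ - k - m - b by ring,
    show e₀ - l - m - c = e₀ - m - l - c by ring, show e₀ - l - m - k = e₀ - k - m - l by ring,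
    show 2 * e₀ - l - k - b - c - m - d = 2 * e₀ - k - l - b - c - m - d by ring] at i1'
  have i2 := th_four_three (ω := ω) e₀ k a b c d
  have i2' := th_four_three (ω := ω) e₀ l a b c d
  generalize lineVal ω L e₀ b c = Mbc at *
  generalize lineVal ω L e₀ a c = Mac at *
  generalize lineVal ω L e₀ b g = Mbg at *
  generalize lineVal ω L e₀ a g = Mag at *
  generalize lineVal ω L' (e₀ + γ) b g = Nbg at *
  generalize lineVal ω L' (e₀ + γ) b c = Nbc at *
  -- A and B are the two common quantities; `g1`, `g2`, `g3` state that f₁, f₂, F₁ are linear forms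
  -- in them.
  generalize hA : th ω (e₀ - l - g - d) * lineVal ω L e₀ l c * lineVal ω L e₀ k g = A at *
  generalize hB : th ω (e₀ - k - g - d) * lineVal ω L e₀ k c * lineVal ω L e₀ l g = B at *
  generalize lineVal ω L e₀ k g = Mkg at *
  generalize lineVal ω L e₀ l g = Mlg at *
  have g1 : f₁ * s * (Mkg * Mlg) * th ω (k - l) * th ω (b - c)
      * (th ω (e₀ - k - l - d) * th ω (e₀ - b - g - d))
      = t * (th ω (k - b) * th ω (l - c) * th ω (e₀ - k - b - d) * A
        - th ω (k - c) * th ω (l - b) * th ω (e₀ - l - b - d) * B) := by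
    apply mul_left_cancel₀ nbg
    linear_combination t * hb + (Mkg * Mlg) * th ω (k - l) * th ω (b - c)
      * (th ω (e₀ - k - l - d) * th ω (e₀ - b - g - d)) * h1
  have g2 : f₂ * s * (Mkg * Mlg) * th ω (k - l) * th ω (a - c)
      * (th ω (e₀ - k - l - d) * th ω (e₀ - a - g - d))
      = t * (th ω (k - a) * th ω (l - c) * th ω (e₀ - k - a - d) * A
        - th ω (k - c) * th ω (l - a) * th ω (e₀ - l - a - d) * B) := by
    apply mul_left_cancel₀ nag
    linear_combination t * ha + (Mkg * Mlg) * th ω (k - l) * th ω (a - c)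
      * (th ω (e₀ - k - l - d) * th ω (e₀ - a - g - d)) * h2
  have g3 : F₁ * s * (Mkg * Mlg) * th ω (k - l) * th ω (b - c)
      * (th ω (m - d) * th ω (2 * e₀ - k - l - b - g - m - d))
      = t * (th ω (e₀ - m - l - b) * th ω (e₀ - k - m - c) * th ω (e₀ - k - b - d) * A
        - th ω (e₀ - m - l - c) * th ω (e₀ - k - m - b) * th ω (e₀ - l - b - d) * B) := by
    apply mul_left_cancel₀ nbg'
    linear_combination t * hT + (Mkg * Mlg) * th ω (k - l) * th ω (b - c)
      * (th ω (m - d) * th ω (2 * e₀ - k - l - b - g - m - d)) * h3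
  have hne : s * (Mkg * Mlg) * th ω (k - l) * th ω (b - c) * th ω (e₀ - k - l - d) ≠ 0 :=
    mul_ne_zero (mul_ne_zero (mul_ne_zero (mul_ne_zero ns (mul_ne_zero nkg nlg)) nkl) nbc) nkld
  apply mul_left_cancel₀ hne
  clear h1 h2 h3 hb ha hT hA hB hne
  generalize th ω (2 * e₀ - k - l - b - g - m - d) = Z at *
  generalize th ω (2 * e₀ - k - l - b - c - m - d) = Y at *
  generalize th ω (m - d) = md at *
  generalize th ω (e₀ - a - b - d) = abd at *
  generalize th ω (e₀ - b - c - d) = bcd at *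
  generalize th ω (e₀ - b - g - d) = bgd at *
  generalize th ω (e₀ - a - c - d) = acd at *
  generalize th ω (e₀ - a - g - d) = agd at *
  generalize th ω (e₀ - k - l - d) = kld at *
  generalize th ω (e₀ - l - b - d) = lbd at *
  generalize th ω (e₀ - k - b - d) = kbd at *
  generalize th ω (e₀ - k - m - l) = kml at *
  generalize th ω (e₀ - m - b - c) = mbc at *
  generalize th ω (e₀ - k - a - d) = kad at *
  generalize th ω (e₀ - l - a - d) = lad at *
  generalize th ω (e₀ - k - c - d) = kcd at *
  generalize th ω (e₀ - l - c - d) = lcd at *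
  generalize th ω (e₀ - m - l - b) = mlb at *
  generalize th ω (e₀ - k - m - c) = kmc at *
  generalize th ω (e₀ - m - l - c) = mlc at *
  generalize th ω (e₀ - k - m - b) = kmb at *
  generalize th ω (k - c) = kc at *
  generalize th ω (l - c) = lc at *
  generalize th ω (k - b) = kb at *
  generalize th ω (l - b) = lb at *
  generalize th ω (k - a) = ka at *
  generalize th ω (l - a) = la at *
  generalize th ω (a - b) = ab at *
  generalize th ω (a - c) = ac at *
  generalize th ω (b - c) = bc at *
  generalize th ω (k - l) = kl at *
  -- By `i1`, `i1'` the combination of F₁ and f₁ on the left is a multiple of kcd·A − lcd·B; by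
  -- `i2`, `i2'` so is the combination of f₁ and f₂ on the right.
  linear_combination abd * kc * lc * ab * bcd * kld * g3 - md * abd * kc * lc * ab * Y * g1
    - lbd * kbd * kml * mbc * ac * acd * g1 + lbd * kbd * kml * mbc * bcd * bc * g2
    + t * abd * kc * lc * ab * (kbd * A * i1 - lbd * B * i1')
    - t * lbd * kbd * kml * mbc * (lc * A * i2 - kc * B * i2')

/-! ### The middle reflection applied to a point of the conic. -/

/-- The point given by `L` lies on the conic through the points with numbers `1, 2, 4, 6` and the
point with parameter `k`. -/
def OnConic (ω : UpperHalfPlane) (L : (ℂ → ℂ) →ₗ[ℂ] ℂ) (q k : ℂ) (z : PState) : Prop :=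
  th ω (q - z.ε 1 - z.ε 2 - k) * th ω (q - z.ε 4 - z.ε 6 - k) * (line ω L z 1 4 * line ω L z 2 6)
    = th ω (q - z.ε 1 - z.ε 4 - k) * th ω (q - z.ε 2 - z.ε 6 - k)
      * (line ω L z 1 2 * line ω L z 4 6)

/-- This converts a linear condition on f into a conic at the intermediate state. Only q − k enters,
so the same q and k can be used after s₅₈₉, which shifts ε₀ and ε₅ equally. -/
theorem Intermediate.sum_iff {z x : PState} (h : Intermediate ω L z x) (q k : ℂ)
    (n12 : th ω (z.ε 1 - z.ε 2) ≠ 0) (n14 : th ω (z.ε 1 - z.ε 4) ≠ 0)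
    (n16 : th ω (z.ε 1 - z.ε 6) ≠ 0) (n26 : th ω (z.ε 2 - z.ε 6) ≠ 0)
    (n36 : th ω (z.ε 3 - z.ε 6) ≠ 0) (n46 : th ω (z.ε 4 - z.ε 6) ≠ 0)
    (n123 : th ω (z.ε 0 - z.ε 1 - z.ε 2 - z.ε 3) ≠ 0)
    (n134 : th ω (z.ε 0 - z.ε 1 - z.ε 3 - z.ε 4) ≠ 0) :
    th ω (z.ε 1 - z.ε 4) * th ω (z.ε 2 - z.ε 3)
          * (th ω (q - z.ε 1 - z.ε 4 - k) * th ω (q - z.ε 2 - z.ε 6 - k)) * x.f 1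
        - th ω (z.ε 2 - z.ε 4) * th ω (z.ε 1 - z.ε 3)
          * (th ω (q - z.ε 1 - z.ε 6 - k) * th ω (q - z.ε 2 - z.ε 4 - k)) * x.f 2
        - th ω (z.ε 1 - z.ε 2) * th ω (z.ε 4 - z.ε 3)
          * (th ω (q - z.ε 1 - z.ε 2 - k) * th ω (q - z.ε 4 - z.ε 6 - k)) * x.f 3 = 0
      ↔ OnConic ω L q k z := by
  have hw := thW_three ω (q - k) (z.ε 1) (z.ε 2) (z.ε 4) (z.ε 6)
  simp only [thW] at hw
  simp only [show ∀ u v : ℂ, q - k - u - v = q - u - v - k by intros; ring] at hw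
  have hs := sum_eq_conic (L := L) (P₂ := th ω (q - z.ε 1 - z.ε 4 - k) * th ω (q - z.ε 2 - z.ε 6 - k))
    (P₁ := th ω (q - z.ε 1 - z.ε 6 - k) * th ω (q - z.ε 2 - z.ε 4 - k))
    (P₄ := th ω (q - z.ε 1 - z.ε 2 - k) * th ω (q - z.ε 4 - z.ε 6 - k)) h.f1 h.f2 h.f3
    (by linear_combination -hw)
    (th_ne_of_eq n123 (by ring)) (th_ne_of_eq n134 (by ring))
  have c1 : z.τ 3 * (line ω L z 2 6 * line ω L z 1 6 * line ω L z 4 6)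
      * (th ω (z.ε 1 - z.ε 6) * th ω (z.ε 2 - z.ε 6) * th ω (z.ε 4 - z.ε 6)) ≠ 0 :=
    mul_ne_zero (mul_ne_zero h.τ3_ne (mul_ne_zero (mul_ne_zero h.ne_26 h.ne_16) h.ne_46))
      (mul_ne_zero (mul_ne_zero n16 n26) n46)
  have c2 : z.τ 6 * (th ω (z.ε 3 - z.ε 6) * line ω L z 3 6)
      * (th ω (z.ε 1 - z.ε 4) * th ω (z.ε 2 - z.ε 6) * th ω (z.ε 1 - z.ε 2)
        * th ω (z.ε 4 - z.ε 6)) ≠ 0 :=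
    mul_ne_zero (mul_ne_zero h.τ6_ne (mul_ne_zero n36 h.ne_36))
      (mul_ne_zero (mul_ne_zero (mul_ne_zero n14 n26) n12) n46)
  rw [OnConic, ← sub_eq_zero (a := _ * _ * (line ω L z 1 4 * _))]
  constructor
  · intro hz
    rw [hz, mul_zero] at hs
    exact (mul_eq_zero.1 hs.symm).resolve_left c2
  · intro hz
    change _ = _ * _ * _ * (_ * (line ω L z 1 4 * line ω L z 2 6)
      - _ * (line ω L z 1 2 * line ω L z 4 6)) at hs
    rw [hz, mul_zero] at hs
    exact (mul_eq_zero.1 hs).resolve_left c1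

/-- The nondegeneracy conditions at the intermediate state. -/
structure MidGeneric (ω : UpperHalfPlane) (e : ℕ → ℂ) : Prop where
  n12 : th ω (e 1 - e 2) ≠ 0
  n14 : th ω (e 1 - e 4) ≠ 0
  n16 : th ω (e 1 - e 6) ≠ 0
  n24 : th ω (e 2 - e 4) ≠ 0
  n26 : th ω (e 2 - e 6) ≠ 0
  n36 : th ω (e 3 - e 6) ≠ 0
  n46 : th ω (e 4 - e 6) ≠ 0
  n23 : th ω (e 2 - e 3) ≠ 0
  n58 : th ω (e 5 - e 8) ≠ 0
  n59 : th ω (e 5 - e 9) ≠ 0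
  n89 : th ω (e 8 - e 9) ≠ 0
  n81 : th ω (e 8 - e 1) ≠ 0
  n82 : th ω (e 8 - e 2) ≠ 0
  n84 : th ω (e 8 - e 4) ≠ 0
  n123 : th ω (e 0 - e 1 - e 2 - e 3) ≠ 0
  n134 : th ω (e 0 - e 1 - e 3 - e 4) ≠ 0
  n124 : th ω (e 0 - e 1 - e 2 - e 4) ≠ 0
  n126 : th ω (e 0 - e 1 - e 2 - e 6) ≠ 0
  n146 : th ω (e 0 - e 1 - e 4 - e 6) ≠ 0
  n246 : th ω (e 0 - e 2 - e 4 - e 6) ≠ 0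
  n125 : th ω (e 0 - e 1 - e 2 - e 5) ≠ 0
  n145 : th ω (e 0 - e 1 - e 4 - e 5) ≠ 0
  n245 : th ω (e 0 - e 2 - e 4 - e 5) ≠ 0
  n256 : th ω (e 0 - e 2 - e 5 - e 6) ≠ 0
  n156 : th ω (e 0 - e 1 - e 5 - e 6) ≠ 0
  n456 : th ω (e 0 - e 4 - e 5 - e 6) ≠ 0
  n135 : th ω (e 0 - e 1 - e 3 - e 5) ≠ 0
  n235 : th ω (e 0 - e 2 - e 3 - e 5) ≠ 0
  n249 : th ω (e 0 - e 2 - e 4 - e 9) ≠ 0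
  n269 : th ω (e 0 - e 2 - e 6 - e 9) ≠ 0
  n469 : th ω (e 0 - e 4 - e 6 - e 9) ≠ 0

/-- The new points 1, 2, 3, 4 are residual points of lines through P₆, and the new 6 is the residual
point of the conic through P₁, P₂, P₃, P₄, P₆. Each condition pulls back to a difference or a triple
at the original parameters, never to {4, 5, 9}. -/
theorem Generic.mid {ε e : ℕ → ℂ} (hg : Generic ω ε) (he : ∀ i, e i = midParam ε i) :
    MidGeneric ω e := by
  have e0 : e 0 = 3 * ε 0 - ε 1 - ε 2 - ε 3 - ε 4 - 2 * ε 6 := by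
    rw [he, midParam]; norm_num; ring
  have e1 : e 1 = ε 0 - ε 2 - ε 6 := by rw [he, midParam]; norm_num; ring
  have e2 : e 2 = ε 0 - ε 1 - ε 6 := by rw [he, midParam]; norm_num; ring
  have e3 : e 3 = ε 0 - ε 4 - ε 6 := by rw [he, midParam]; norm_num; ring
  have e4 : e 4 = ε 0 - ε 3 - ε 6 := by rw [he, midParam]; norm_num; ring
  have e6 : e 6 = 2 * ε 0 - ε 1 - ε 2 - ε 3 - ε 4 - ε 6 := by
    rw [he, midParam]; norm_num; ring
  have e5 : e 5 = ε 5 := by rw [he, midParam]; norm_num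
  have e8 : e 8 = ε 8 := by rw [he, midParam]; norm_num
  have e9 : e 9 = ε 9 := by rw [he, midParam]; norm_num
  constructor
  · exact th_ne_of_eq (hg.pair 1 2 (by decide) (by decide) (by decide))
      (by simp only [e1, e2]; ring)
  · exact th_ne_of_eq (hg.pair 3 2 (by decide) (by decide) (by decide))
      (by simp only [e1, e4]; ring)
  · exact th_ne_of_eq_neg (hg.triple 1 3 4 (by decide) (by decide) (by decide) (by decide)
      (by decide) (by decide) (by decide)) (by simp only [e1, e6]; ring)
  · exact th_ne_of_eq (hg.pair 3 1 (by decide) (by decide) (by decide))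
      (by simp only [e2, e4]; ring)
  · exact th_ne_of_eq_neg (hg.triple 2 3 4 (by decide) (by decide) (by decide) (by decide)
      (by decide) (by decide) (by decide)) (by simp only [e2, e6]; ring)
  · exact th_ne_of_eq_neg (hg.triple 1 2 3 (by decide) (by decide) (by decide) (by decide)
      (by decide) (by decide) (by decide)) (by simp only [e3, e6]; ring)
  · exact th_ne_of_eq_neg (hg.triple 1 2 4 (by decide) (by decide) (by decide) (by decide)
      (by decide) (by decide) (by decide)) (by simp only [e4, e6]; ring)
  · exact th_ne_of_eq (hg.pair 4 1 (by decide) (by decide) (by decide))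
      (by simp only [e2, e3]; ring)
  · rw [e5, e8]; exact hg.pair 5 8 (by decide) (by decide) (by decide)
  · rw [e5, e9]; exact hg.pair 5 9 (by decide) (by decide) (by decide)
  · rw [e8, e9]; exact hg.pair 8 9 (by decide) (by decide) (by decide)
  · exact th_ne_of_eq_neg (hg.triple 2 6 8 (by decide) (by decide) (by decide) (by decide)
      (by decide) (by decide) (by decide)) (by simp only [e8, e1]; ring)
  · exact th_ne_of_eq_neg (hg.triple 1 6 8 (by decide) (by decide) (by decide) (by decide)
      (by decide) (by decide) (by decide)) (by simp only [e8, e2]; ring)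
  · exact th_ne_of_eq_neg (hg.triple 3 6 8 (by decide) (by decide) (by decide) (by decide)
      (by decide) (by decide) (by decide)) (by simp only [e8, e4]; ring)
  · exact th_ne_of_eq (hg.pair 6 3 (by decide) (by decide) (by decide))
      (by simp only [e0, e1, e2, e3]; ring)
  · exact th_ne_of_eq (hg.pair 6 1 (by decide) (by decide) (by decide))
      (by simp only [e0, e1, e3, e4]; ring)
  · exact th_ne_of_eq (hg.pair 6 4 (by decide) (by decide) (by decide))
      (by simp only [e0, e1, e2, e4]; ring)
  · exact th_ne_of_eq_neg (hg.triple 1 2 6 (by decide) (by decide) (by decide) (by decide)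
      (by decide) (by decide) (by decide)) (by simp only [e0, e1, e2, e6]; ring)
  · exact th_ne_of_eq_neg (hg.triple 2 3 6 (by decide) (by decide) (by decide) (by decide)
      (by decide) (by decide) (by decide)) (by simp only [e0, e1, e4, e6]; ring)
  · exact th_ne_of_eq_neg (hg.triple 1 3 6 (by decide) (by decide) (by decide) (by decide)
      (by decide) (by decide) (by decide)) (by simp only [e0, e2, e4, e6]; ring)
  · exact th_ne_of_eq (hg.triple 3 4 5 (by decide) (by decide) (by decide) (by decide)
      (by decide) (by decide) (by decide)) (by simp only [e0, e1, e2, e5]; ring)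
  · exact th_ne_of_eq (hg.triple 1 4 5 (by decide) (by decide) (by decide) (by decide)
      (by decide) (by decide) (by decide)) (by simp only [e0, e1, e4, e5]; ring)
  · exact th_ne_of_eq (hg.triple 2 4 5 (by decide) (by decide) (by decide) (by decide)
      (by decide) (by decide) (by decide)) (by simp only [e0, e2, e4, e5]; ring)
  · exact th_ne_of_eq (hg.pair 1 5 (by decide) (by decide) (by decide))
      (by simp only [e0, e2, e5, e6]; ring)
  · exact th_ne_of_eq (hg.pair 2 5 (by decide) (by decide) (by decide))
      (by simp only [e0, e1, e5, e6]; ring)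
  · exact th_ne_of_eq (hg.pair 3 5 (by decide) (by decide) (by decide))
      (by simp only [e0, e4, e5, e6]; ring)
  · exact th_ne_of_eq (hg.triple 1 3 5 (by decide) (by decide) (by decide) (by decide)
      (by decide) (by decide) (by decide)) (by simp only [e0, e1, e3, e5]; ring)
  · exact th_ne_of_eq (hg.triple 2 3 5 (by decide) (by decide) (by decide) (by decide)
      (by decide) (by decide) (by decide)) (by simp only [e0, e2, e3, e5]; ring)
  · exact th_ne_of_eq (hg.triple 2 4 9 (by decide) (by decide) (by decide) (by decide)
      (by decide) (by decide) (by decide)) (by simp only [e0, e2, e4, e9]; ring)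
  · exact th_ne_of_eq (hg.pair 1 9 (by decide) (by decide) (by decide))
      (by simp only [e0, e2, e6, e9]; ring)
  · exact th_ne_of_eq (hg.pair 3 9 (by decide) (by decide) (by decide))
      (by simp only [e0, e4, e6, e9]; ring)

/-- The other two forms of the equation of a conic. -/
theorem OnConic.variants {z : PState} {k : ℂ} (h : OnConic ω L (z.ε 0) k z)
    (n16 : th ω (z.ε 1 - z.ε 6) ≠ 0) (n24 : th ω (z.ε 2 - z.ε 4) ≠ 0)
    (n124 : th ω (z.ε 0 - z.ε 1 - z.ε 2 - z.ε 4) ≠ 0) :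
    th ω (z.ε 0 - z.ε 1 - z.ε 2 - k) * th ω (z.ε 0 - z.ε 4 - z.ε 6 - k)
          * (line ω L z 1 6 * line ω L z 2 4)
        = th ω (z.ε 0 - z.ε 1 - z.ε 6 - k) * th ω (z.ε 0 - z.ε 2 - z.ε 4 - k)
          * (line ω L z 1 2 * line ω L z 4 6) ∧
      th ω (z.ε 0 - z.ε 1 - z.ε 4 - k) * th ω (z.ε 0 - z.ε 2 - z.ε 6 - k)
          * (line ω L z 1 6 * line ω L z 2 4)
        = th ω (z.ε 0 - z.ε 1 - z.ε 6 - k) * th ω (z.ε 0 - z.ε 2 - z.ε 4 - k)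
          * (line ω L z 1 4 * line ω L z 2 6) := by
  rw [OnConic] at h
  have hp : th ω (z.ε 1 - z.ε 2) * th ω (z.ε 4 - z.ε 6) * (line ω L z 1 2 * line ω L z 4 6)
      - th ω (z.ε 1 - z.ε 4) * th ω (z.ε 2 - z.ε 6) * (line ω L z 1 4 * line ω L z 2 6)
      + th ω (z.ε 1 - z.ε 6) * th ω (z.ε 2 - z.ε 4) * (line ω L z 1 6 * line ω L z 2 4) = 0 :=
    lineVal_plucker (z.ε 0) (z.ε 1) (z.ε 2) (z.ε 4) (z.ε 6) n124
  have hw := thW_three ω (z.ε 0 - k) (z.ε 1) (z.ε 2) (z.ε 4) (z.ε 6)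
  simp only [thW] at hw
  simp only [show ∀ u v : ℂ, z.ε 0 - k - u - v = z.ε 0 - u - v - k by intros; ring] at hw
  -- The three products of opposite lines and the three theta products satisfy the same linear
  -- relation. Proportionality of one pair of entries thus extends to the others.
  have hr := mul_ne_zero n16 n24
  constructor
  · apply mul_left_cancel₀ hr
    linear_combination th ω (z.ε 0 - z.ε 1 - z.ε 2 - k) * th ω (z.ε 0 - z.ε 4 - z.ε 6 - k) * hp
      - line ω L z 1 2 * line ω L z 4 6 * hw
      + th ω (z.ε 1 - z.ε 4) * th ω (z.ε 2 - z.ε 6) * h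
  · apply mul_left_cancel₀ hr
    linear_combination th ω (z.ε 0 - z.ε 1 - z.ε 4 - k) * th ω (z.ε 0 - z.ε 2 - z.ε 6 - k) * hp
      - line ω L z 1 4 * line ω L z 2 6 * hw
      + th ω (z.ε 1 - z.ε 2) * th ω (z.ε 4 - z.ε 6) * h

theorem OnConic.line_ne {z x : PState} (h : OnConic ω L (z.ε 0) (z.ε 5) z)
    (hi : Intermediate ω L z x) (hm : MidGeneric ω z.ε) :
    line ω L z 1 2 ≠ 0 ∧ line ω L z 1 4 ≠ 0 := by
  rw [OnConic] at h
  have n465 : th ω (z.ε 0 - z.ε 4 - z.ε 6 - z.ε 5) ≠ 0 := th_ne_of_eq hm.n456 (by ring)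
  have n265 : th ω (z.ε 0 - z.ε 2 - z.ε 6 - z.ε 5) ≠ 0 := th_ne_of_eq hm.n256 (by ring)
  have key : line ω L z 1 2 = 0 → line ω L z 1 4 = 0 → False := by
    intro h2 h4
    have hp : thW ω (z.ε 0 - z.ε 1) (z.ε 2) (z.ε 4) * line ω L z 1 6
        + thW ω (z.ε 0 - z.ε 1) (z.ε 4) (z.ε 6) * line ω L z 1 2
        + thW ω (z.ε 0 - z.ε 1) (z.ε 6) (z.ε 2) * line ω L z 1 4 = 0 := lineVal_pencil _ _ _ _ _
    rw [h2, h4, mul_zero, mul_zero, add_zero, add_zero] at hp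
    exact mul_ne_zero (mul_ne_zero hm.n24 hm.n124) hi.ne_16 hp
  constructor
  · intro h2
    refine key h2 ?_
    rw [h2, zero_mul, mul_zero] at h
    exact (mul_eq_zero.1 ((mul_eq_zero.1 h).resolve_left (mul_ne_zero hm.n125 n465))).resolve_right
      hi.ne_26
  · intro h4
    refine key ?_ h4
    rw [h4, zero_mul, mul_zero] at h
    exact (mul_eq_zero.1 ((mul_eq_zero.1 h.symm).resolve_left
      (mul_ne_zero hm.n145 n265))).resolve_right hi.ne_46

theorem Transforms.line_other {z z' : PState} (hT : Transforms ω L L' z z' 5 8 9)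
    (hm : MidGeneric ω z.ε) (hγ : th ω (z.ε 0 - z.ε 5 - z.ε 8 - z.ε 9) ≠ 0) (x y : ℂ)
    (hx : th ω (z.ε 8 - x) ≠ 0) :
    th ω (z.ε 5 - z.ε 9) * th ω (x - y) * (z.τ 5 * z.τ 8 * z.τ 9
        * lineVal ω L' (z.ε 0 + (z.ε 0 - z.ε 5 - z.ε 8 - z.ε 9)) x y)
      = th ω (z.ε 0 - z.ε 8 - z.ε 9 - x) * th ω (z.ε 0 - z.ε 5 - z.ε 8 - y)
          * (lineVal ω L (z.ε 0) (z.ε 5) x * lineVal ω L (z.ε 0) (z.ε 9) y)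
        - th ω (z.ε 0 - z.ε 8 - z.ε 9 - y) * th ω (z.ε 0 - z.ε 5 - z.ε 8 - x)
          * (lineVal ω L (z.ε 0) (z.ε 5) y * lineVal ω L (z.ε 0) (z.ε 9) x) := by
  have h1 := hT.line_ab
  have h2 := hT.line_ac
  have h3 := hT.line_bc
  rw [hT.ε_zero, hT.ε_a, hT.ε_b] at h1
  rw [hT.ε_zero, hT.ε_a, hT.ε_c] at h2
  rw [hT.ε_zero, hT.ε_b, hT.ε_c] at h3
  exact lineVal_transform_other rfl h1 h2 h3 hm.n89 hm.n58 hγ hx hT.ab_ne hT.bc_ne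

/-- The conditions relating the intermediate states before and after the middle reflection, when
the point lies on the two conics. -/
structure MidData (ω : UpperHalfPlane) (L L' : (ℂ → ℂ) →ₗ[ℂ] ℂ) (z z' x y : PState) : Prop where
  trans : Transforms ω L L' z z' 5 8 9
  before : Intermediate ω L z x
  after : Intermediate ω L' z' y
  generic : MidGeneric ω z.ε
  root : th ω (z.ε 0 - z.ε 5 - z.ε 8 - z.ε 9) ≠ 0
  n459 : th ω (z.ε 0 - z.ε 5 - z.ε 9 - z.ε 4) ≠ 0
  n259 : th ω (z.ε 0 - z.ε 5 - z.ε 9 - z.ε 2) ≠ 0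
  conic5 : OnConic ω L (z.ε 0) (z.ε 5) z
  conic9 : OnConic ω L (z.ε 0) (z.ε 9) z

theorem MidData.line_eq {z z' x y : PState} (h : MidData ω L L' z z' x y) {i j : ℕ}
    (hi : i ∈ ({1, 2, 3, 4, 6} : Finset ℕ)) (hj : j ∈ ({1, 2, 3, 4, 6} : Finset ℕ)) :
    line ω L' z' i j
      = lineVal ω L' (z.ε 0 + (z.ε 0 - z.ε 5 - z.ε 8 - z.ε 9)) (z.ε i) (z.ε j) := by
  have key : ∀ i ∈ ({1, 2, 3, 4, 6} : Finset ℕ), z'.ε i = z.ε i := by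
    intro i hi
    have : i ≠ 0 ∧ i ≠ 5 ∧ i ≠ 8 ∧ i ≠ 9 := by
      revert hi
      revert i
      decide
    exact h.trans.ε_other i this.1 this.2.1 this.2.2.1 this.2.2.2
  rw [line, h.trans.ε_zero, key i hi, key j hj]

/-- Here and in the next four lemmas the digits are the points x, y, w of `line_ratio₂`, the pair k,
l is 5, 9, and the auxiliary point is the remaining one of 1, 2, 4, 6. -/
theorem MidData.ratio_264 {z z' x y : PState} (h : MidData ω L L' z z' x y) :
    th ω (z.ε 0 - z.ε 9 - z.ε 2 - z.ε 4) * th ω (z.ε 0 - z.ε 5 - z.ε 6 - z.ε 4)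
        * (line ω L z 5 2 * line ω L z 9 6)
      = th ω (z.ε 0 - z.ε 5 - z.ε 2 - z.ε 4) * th ω (z.ε 0 - z.ε 9 - z.ε 6 - z.ε 4)
        * (line ω L z 5 6 * line ω L z 9 2) := by
  have hm := h.generic
  obtain ⟨n12, n14⟩ := h.conic5.line_ne h.before hm
  have v5 := (h.conic5.variants hm.n16 hm.n24 hm.n124).1
  have v9 := (h.conic9.variants hm.n16 hm.n24 hm.n124).1
  refine line_ratio₂ (z := z.ε 1) (by rw [th_sub_comm, neg_ne_zero]; exact hm.n14) ?_ ?_ ?_ ?_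
    (th_ne_of_eq hm.n124 (by ring)) (th_ne_of_eq hm.n146 (by ring))
  · rw [lineVal_comm _ (z.ε 6), lineVal_comm _ (z.ε 2) (z.ε 1), lineVal_comm _ (z.ε 6) (z.ε 4)]
    simp only [line, sub_right_comm _ (z.ε 2) (z.ε 1), sub_right_comm _ (z.ε 6) (z.ε 4),
      sub_right_comm _ (z.ε 6) (z.ε 1)] at v5 ⊢
    linear_combination v5
  · rw [lineVal_comm _ (z.ε 6), lineVal_comm _ (z.ε 2) (z.ε 1), lineVal_comm _ (z.ε 6) (z.ε 4)]
    simp only [line, sub_right_comm _ (z.ε 2) (z.ε 1), sub_right_comm _ (z.ε 6) (z.ε 4),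
      sub_right_comm _ (z.ε 6) (z.ε 1)] at v9 ⊢
    linear_combination v9
  · rw [lineVal_comm]; exact n12
  · rw [lineVal_comm]; exact h.before.ne_16

theorem MidData.ratio_164 {z z' x y : PState} (h : MidData ω L L' z z' x y) :
    th ω (z.ε 0 - z.ε 9 - z.ε 1 - z.ε 4) * th ω (z.ε 0 - z.ε 5 - z.ε 6 - z.ε 4)
        * (line ω L z 5 1 * line ω L z 9 6)
      = th ω (z.ε 0 - z.ε 5 - z.ε 1 - z.ε 4) * th ω (z.ε 0 - z.ε 9 - z.ε 6 - z.ε 4)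
        * (line ω L z 5 6 * line ω L z 9 1) := by
  have hm := h.generic
  obtain ⟨n12, n14⟩ := h.conic5.line_ne h.before hm
  have v5 := h.conic5
  have v9 := h.conic9
  refine line_ratio₂ (z := z.ε 2) (by rw [th_sub_comm, neg_ne_zero]; exact hm.n24) ?_ ?_ n12 ?_
    (th_ne_of_eq hm.n124 (by ring)) (th_ne_of_eq hm.n246 (by ring))
  · rw [lineVal_comm _ (z.ε 6) (z.ε 2), lineVal_comm _ (z.ε 6) (z.ε 4)]
    simp only [OnConic, line, sub_right_comm _ (z.ε 6) (z.ε 4),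
      sub_right_comm _ (z.ε 6) (z.ε 2)] at v5 ⊢
    linear_combination v5
  · rw [lineVal_comm _ (z.ε 6) (z.ε 2), lineVal_comm _ (z.ε 6) (z.ε 4)]
    simp only [OnConic, line, sub_right_comm _ (z.ε 6) (z.ε 4),
      sub_right_comm _ (z.ε 6) (z.ε 2)] at v9 ⊢
    linear_combination v9
  · rw [lineVal_comm]; exact h.before.ne_26

theorem MidData.ratio_124 {z z' x y : PState} (h : MidData ω L L' z z' x y) :
    th ω (z.ε 0 - z.ε 9 - z.ε 1 - z.ε 4) * th ω (z.ε 0 - z.ε 5 - z.ε 2 - z.ε 4)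
        * (line ω L z 5 1 * line ω L z 9 2)
      = th ω (z.ε 0 - z.ε 5 - z.ε 1 - z.ε 4) * th ω (z.ε 0 - z.ε 9 - z.ε 2 - z.ε 4)
        * (line ω L z 5 2 * line ω L z 9 1) := by
  have hm := h.generic
  have v5 := (h.conic5.variants hm.n16 hm.n24 hm.n124).2
  have v9 := (h.conic9.variants hm.n16 hm.n24 hm.n124).2
  refine line_ratio₂ (z := z.ε 6) hm.n46 ?_ ?_ h.before.ne_16 h.before.ne_26
    (th_ne_of_eq hm.n146 (by ring)) (th_ne_of_eq hm.n246 (by ring))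
  · simp only [line] at v5 ⊢
    linear_combination -v5
  · simp only [line] at v9 ⊢
    linear_combination -v9

theorem MidData.ratio_462 {z z' x y : PState} (h : MidData ω L L' z z' x y) :
    th ω (z.ε 0 - z.ε 9 - z.ε 4 - z.ε 2) * th ω (z.ε 0 - z.ε 5 - z.ε 6 - z.ε 2)
        * (line ω L z 5 4 * line ω L z 9 6)
      = th ω (z.ε 0 - z.ε 5 - z.ε 4 - z.ε 2) * th ω (z.ε 0 - z.ε 9 - z.ε 6 - z.ε 2)
        * (line ω L z 5 6 * line ω L z 9 4) := by
  have hm := h.generic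
  obtain ⟨n12, n14⟩ := h.conic5.line_ne h.before hm
  have v5 := (h.conic5.variants hm.n16 hm.n24 hm.n124).2
  have v9 := (h.conic9.variants hm.n16 hm.n24 hm.n124).2
  refine line_ratio₂ (z := z.ε 1) (by rw [th_sub_comm, neg_ne_zero]; exact hm.n12) ?_ ?_ ?_ ?_
    (th_ne_of_eq hm.n124 (by ring)) (th_ne_of_eq hm.n126 (by ring))
  · rw [lineVal_comm _ (z.ε 6) (z.ε 2), lineVal_comm _ (z.ε 6) (z.ε 1),
      lineVal_comm _ (z.ε 4) (z.ε 2), lineVal_comm _ (z.ε 4) (z.ε 1)]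
    simp only [line, sub_right_comm _ (z.ε 6) (z.ε 1),
      sub_right_comm _ (z.ε 6) (z.ε 2), sub_right_comm _ (z.ε 4) (z.ε 2),
      sub_right_comm _ (z.ε 4) (z.ε 1)] at v5 ⊢
    linear_combination v5
  · rw [lineVal_comm _ (z.ε 6) (z.ε 2), lineVal_comm _ (z.ε 6) (z.ε 1),
      lineVal_comm _ (z.ε 4) (z.ε 2), lineVal_comm _ (z.ε 4) (z.ε 1)]
    simp only [line, sub_right_comm _ (z.ε 6) (z.ε 1),
      sub_right_comm _ (z.ε 6) (z.ε 2), sub_right_comm _ (z.ε 4) (z.ε 2),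
      sub_right_comm _ (z.ε 4) (z.ε 1)] at v9 ⊢
    linear_combination v9
  · rw [lineVal_comm]; exact n14
  · rw [lineVal_comm]; exact h.before.ne_16

theorem MidData.ratio_142 {z z' x y : PState} (h : MidData ω L L' z z' x y) :
    th ω (z.ε 0 - z.ε 9 - z.ε 1 - z.ε 2) * th ω (z.ε 0 - z.ε 5 - z.ε 4 - z.ε 2)
        * (line ω L z 5 1 * line ω L z 9 4)
      = th ω (z.ε 0 - z.ε 5 - z.ε 1 - z.ε 2) * th ω (z.ε 0 - z.ε 9 - z.ε 4 - z.ε 2)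
        * (line ω L z 5 4 * line ω L z 9 1) := by
  have hm := h.generic
  have v5 := (h.conic5.variants hm.n16 hm.n24 hm.n124).1
  have v9 := (h.conic9.variants hm.n16 hm.n24 hm.n124).1
  refine line_ratio₂ (z := z.ε 6) hm.n26 ?_ ?_ h.before.ne_16 h.before.ne_46
    (th_ne_of_eq hm.n126 (by ring)) (th_ne_of_eq hm.n246 (by ring))
  · rw [lineVal_comm _ (z.ε 4) (z.ε 2)]
    simp only [line, sub_right_comm _ (z.ε 4) (z.ε 2)] at v5 ⊢
    linear_combination -v5
  · rw [lineVal_comm _ (z.ε 4) (z.ε 2)]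
    simp only [line, sub_right_comm _ (z.ε 4) (z.ε 2)] at v9 ⊢
    linear_combination -v9

/-- Each line ij is multiplied by a theta quotient depending on an auxiliary point w. Taking w = 4
for 12 and 26, and w = 2 for 46 and 14, makes the factors of the products 12·46 and 14·26 equal, so
the conic equation is preserved. -/
theorem MidData.conic_after {z z' x y : PState} (h : MidData ω L L' z z' x y) :
    OnConic ω L' (z.ε 0) (z.ε 5) z' := by
  have hm := h.generic
  have s := h.trans.line_other hm h.root
  have g12 := (lineVal_transform_ratio (s (z.ε 1) (z.ε 2) hm.n81) h.ratio_124 hm.n59 hm.n12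
    (th_ne_of_eq hm.n145 (by ring)) (th_ne_of_eq hm.n249 (by ring))
    (th_ne_of_eq hm.n125 (by ring))).1
  have g46 := (lineVal_transform_ratio (s (z.ε 4) (z.ε 6) hm.n84) h.ratio_462 hm.n59 hm.n46
    (th_ne_of_eq hm.n245 (by ring)) (th_ne_of_eq hm.n269 (by ring))
    (th_ne_of_eq hm.n456 (by ring))).1
  have g14 := (lineVal_transform_ratio (s (z.ε 1) (z.ε 4) hm.n81) h.ratio_142 hm.n59 hm.n14
    (th_ne_of_eq hm.n125 (by ring)) (th_ne_of_eq hm.n249 (by ring))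
    (th_ne_of_eq hm.n145 (by ring))).1
  have g26 := (lineVal_transform_ratio (s (z.ε 2) (z.ε 6) hm.n82) h.ratio_264 hm.n59 hm.n26
    (th_ne_of_eq hm.n245 (by ring)) (th_ne_of_eq hm.n469 (by ring))
    (th_ne_of_eq hm.n256 (by ring))).1
  have hc := h.conic5
  have e : ∀ i, i ≠ 0 → i ≠ 5 → i ≠ 8 → i ≠ 9 → z'.ε i = z.ε i := h.trans.ε_other
  rw [OnConic] at hc ⊢
  rw [h.line_eq (by decide) (by decide), h.line_eq (by decide) (by decide),
    h.line_eq (by decide) (by decide), h.line_eq (by decide) (by decide),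
    e 1 (by norm_num) (by norm_num) (by norm_num) (by norm_num),
    e 2 (by norm_num) (by norm_num) (by norm_num) (by norm_num),
    e 4 (by norm_num) (by norm_num) (by norm_num) (by norm_num),
    e 6 (by norm_num) (by norm_num) (by norm_num) (by norm_num)]
  have n124 := hm.n124
  have n246 := hm.n246
  have nT := h.trans.mul_ne
  have n4 := h.n459
  have n2 := h.n259
  rw [show z.ε 0 - z.ε 4 - z.ε 6 - z.ε 2 = z.ε 0 - z.ε 2 - z.ε 4 - z.ε 6 by ring,
    show 2 * z.ε 0 - z.ε 5 - z.ε 9 - z.ε 4 - z.ε 6 - z.ε 8 - z.ε 2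
      = 2 * z.ε 0 - z.ε 5 - z.ε 9 - z.ε 2 - z.ε 6 - z.ε 8 - z.ε 4 by ring] at g46
  rw [show z.ε 0 - z.ε 1 - z.ε 4 - z.ε 2 = z.ε 0 - z.ε 1 - z.ε 2 - z.ε 4 by ring,
    show 2 * z.ε 0 - z.ε 5 - z.ε 9 - z.ε 1 - z.ε 4 - z.ε 8 - z.ε 2
      = 2 * z.ε 0 - z.ε 5 - z.ε 9 - z.ε 1 - z.ε 2 - z.ε 8 - z.ε 4 by ring] at g14
  rw [show z.ε 0 - z.ε 2 - z.ε 6 - z.ε 4 = z.ε 0 - z.ε 2 - z.ε 4 - z.ε 6 by ring] at g26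
  simp only [line] at hc
  have hne := mul_ne_zero (mul_ne_zero nT nT) (mul_ne_zero (mul_ne_zero n124 n246)
    (mul_ne_zero n4 n2))
  apply mul_left_cancel₀ hne
  clear s hne
  generalize lineVal ω L' (z.ε 0 + (z.ε 0 - z.ε 5 - z.ε 8 - z.ε 9)) (z.ε 1) (z.ε 2) = N12 at *
  generalize lineVal ω L' (z.ε 0 + (z.ε 0 - z.ε 5 - z.ε 8 - z.ε 9)) (z.ε 1) (z.ε 4) = N14 at *
  generalize lineVal ω L' (z.ε 0 + (z.ε 0 - z.ε 5 - z.ε 8 - z.ε 9)) (z.ε 4) (z.ε 6) = N46 at *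
  generalize lineVal ω L' (z.ε 0 + (z.ε 0 - z.ε 5 - z.ε 8 - z.ε 9)) (z.ε 2) (z.ε 6) = N26 at *
  generalize lineVal ω L (z.ε 0) (z.ε 1) (z.ε 2) = M12 at *
  generalize lineVal ω L (z.ε 0) (z.ε 1) (z.ε 4) = M14 at *
  generalize lineVal ω L (z.ε 0) (z.ε 4) (z.ε 6) = M46 at *
  generalize lineVal ω L (z.ε 0) (z.ε 2) (z.ε 6) = M26 at *
  generalize lineVal ω L (z.ε 0) (z.ε 5) (z.ε 9) = M59 at *
  generalize z.τ 5 * z.τ 8 * z.τ 9 = T at *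
  generalize th ω (z.ε 0 - z.ε 5 - z.ε 9 - z.ε 4) = a4 at *
  generalize th ω (z.ε 0 - z.ε 5 - z.ε 9 - z.ε 2) = a2 at *
  generalize th ω (z.ε 0 - z.ε 1 - z.ε 2 - z.ε 4) = b124 at *
  generalize th ω (z.ε 0 - z.ε 2 - z.ε 4 - z.ε 6) = b246 at *
  generalize th ω (2 * z.ε 0 - z.ε 5 - z.ε 9 - z.ε 2 - z.ε 6 - z.ε 8 - z.ε 4) = Z1 at *
  generalize th ω (2 * z.ε 0 - z.ε 5 - z.ε 9 - z.ε 1 - z.ε 2 - z.ε 8 - z.ε 4) = Z2 at *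
  generalize th ω (z.ε 8 - z.ε 4) = d4 at *
  generalize th ω (z.ε 8 - z.ε 2) = d2 at *
  generalize th ω (z.ε 0 - z.ε 1 - z.ε 2 - z.ε 5) = p1 at *
  generalize th ω (z.ε 0 - z.ε 4 - z.ε 6 - z.ε 5) = p2 at *
  generalize th ω (z.ε 0 - z.ε 1 - z.ε 4 - z.ε 5) = p3 at *
  generalize th ω (z.ε 0 - z.ε 2 - z.ε 6 - z.ε 5) = p4 at *
  linear_combination p1 * p2 * (T * N26 * (a4 * b246) * g14 + M59 * M14 * (d2 * Z2) * g26)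
    - p3 * p4 * (T * N46 * (a2 * b246) * g12 + M59 * M12 * (d4 * Z2) * g46)
    + M59 ^ 2 * d4 * d2 * Z1 * Z2 * hc

/-- This is `intermediate_relation` for the actual points; most of the proof checks that the lines
from 5 and 9 used there do not vanish. -/
theorem MidData.relation {z z' x y : PState} (h : MidData ω L L' z z' x y) :
    th ω (z.ε 8 - z.ε 4) * th ω (z.ε 0 - z.ε 1 - z.ε 2 - z.ε 4)
        * (th ω (z.ε 5 - z.ε 3) * th ω (z.ε 9 - z.ε 3)) * th ω (z.ε 1 - z.ε 2)
        * (th ω (z.ε 0 - z.ε 2 - z.ε 3 - z.ε 4)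
            * th ω (2 * z.ε 0 - z.ε 5 - z.ε 9 - z.ε 2 - z.ε 6 - z.ε 8 - z.ε 4) * y.f 1
          - th ω (2 * z.ε 0 - z.ε 5 - z.ε 9 - z.ε 2 - z.ε 3 - z.ε 8 - z.ε 4)
            * th ω (z.ε 0 - z.ε 2 - z.ε 6 - z.ε 4) * x.f 1)
      = th ω (z.ε 0 - z.ε 9 - z.ε 2 - z.ε 4) * th ω (z.ε 0 - z.ε 5 - z.ε 2 - z.ε 4)
        * (th ω (z.ε 0 - z.ε 5 - z.ε 8 - z.ε 9) * th ω (z.ε 0 - z.ε 8 - z.ε 2 - z.ε 3))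
        * th ω (z.ε 1 - z.ε 3)
        * (th ω (z.ε 0 - z.ε 2 - z.ε 6 - z.ε 4) * th ω (z.ε 0 - z.ε 1 - z.ε 3 - z.ε 4) * x.f 1
          - th ω (z.ε 0 - z.ε 1 - z.ε 6 - z.ε 4) * th ω (z.ε 0 - z.ε 2 - z.ε 3 - z.ε 4)
            * x.f 2) := by
  have hm := h.generic
  have s := h.trans.line_other hm h.root
  have M59 : line ω L z 5 9 ≠ 0 := h.trans.ac_ne
  obtain ⟨-, r2, r3⟩ := lineVal_transform_ratio (s (z.ε 2) (z.ε 6) hm.n82) h.ratio_264 hm.n59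
    hm.n26 (th_ne_of_eq hm.n245 (by ring)) (th_ne_of_eq hm.n469 (by ring))
    (th_ne_of_eq hm.n256 (by ring))
  obtain ⟨-, -, q3⟩ := lineVal_transform_ratio (s (z.ε 1) (z.ε 6) hm.n81) h.ratio_164 hm.n59
    hm.n16 (th_ne_of_eq hm.n145 (by ring)) (th_ne_of_eq hm.n469 (by ring))
    (th_ne_of_eq hm.n156 (by ring))
  have n524 : th ω (z.ε 0 - z.ε 5 - z.ε 2 - z.ε 4) ≠ 0 := th_ne_of_eq hm.n245 (by ring)
  have n514 : th ω (z.ε 0 - z.ε 5 - z.ε 1 - z.ε 4) ≠ 0 := th_ne_of_eq hm.n145 (by ring)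
  have n964 : th ω (z.ε 0 - z.ε 9 - z.ε 6 - z.ε 4) ≠ 0 := th_ne_of_eq hm.n469 (by ring)
  have n564 : th ω (z.ε 0 - z.ε 5 - z.ε 6 - z.ε 4) ≠ 0 := th_ne_of_eq hm.n456 (by ring)
  have n924 : th ω (z.ε 0 - z.ε 9 - z.ε 2 - z.ε 4) ≠ 0 := th_ne_of_eq hm.n249 (by ring)
  have hl := mul_ne_zero (mul_ne_zero n524 n964) (mul_ne_zero M59 h.before.ne_26)
  have hl' := mul_ne_zero (mul_ne_zero n514 n964) (mul_ne_zero M59 h.before.ne_16)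
  have w := hl
  have w' := hl'
  simp only [line] at w w'
  rw [r3] at w
  rw [q3] at w'
  have M52 := (mul_ne_zero_iff.1 (mul_ne_zero_iff.1 w).1).1
  have M96 := (mul_ne_zero_iff.1 (mul_ne_zero_iff.1 w).1).2
  have M51 := (mul_ne_zero_iff.1 (mul_ne_zero_iff.1 w').1).1
  have M56 : line ω L z 5 6 ≠ 0 := by
    intro e
    have hr := h.ratio_264
    rw [e, zero_mul, mul_zero] at hr
    exact mul_ne_zero (mul_ne_zero n924 n564) (mul_ne_zero M52 M96) hr
  have e6 : z'.τ 6 = z.τ 6 := h.trans.τ_other 6 (by norm_num) (by norm_num) (by norm_num)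
    (by norm_num)
  have e3 : z'.τ 3 = z.τ 3 := h.trans.τ_other 3 (by norm_num) (by norm_num) (by norm_num)
    (by norm_num)
  have hy := h.after.f1
  have hy26 := h.after.ne_26
  rw [h.line_eq (by decide) (by decide)] at hy26
  rw [h.line_eq (by decide) (by decide), h.line_eq (by decide) (by decide), e6, e3] at hy
  exact intermediate_relation h.before.f1 h.before.f2 hy
    (line_through_pair h.ratio_264 r3 (th_ne_of_eq hm.n235 (by ring)) M59 M52)
    (line_through_pair h.ratio_164 q3 (th_ne_of_eq hm.n135 (by ring)) M59 M51)
    (line_through_pair_transform (s (z.ε 2) (z.ε 3) hm.n82) h.ratio_264 r2 h.trans.mul_ne M52)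
    h.before.τ3_ne h.before.ne_16 h.before.ne_26 hy26 M56 M96 hm.n59 hm.n23 h.n459

/-! ### The line through P₄, P₅, P₉ and one application of the core. -/

/-- Coefficients of the line through `P₄` and `P_k`. -/
noncomputable def hat (ω : UpperHalfPlane) (ε : ℕ → ℂ) (k : ℕ) : Fin 3 → ℂ :=
  ![th ω (ε 2 - ε 3) * th ω (ε 1 - ε 4) * (th ω (ε 1 - ε k) * th ω (ε 0 - ε 1 - ε 4 - ε k)),
    th ω (ε 3 - ε 1) * th ω (ε 2 - ε 4) * (th ω (ε 2 - ε k) * th ω (ε 0 - ε 2 - ε 4 - ε k)),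
    th ω (ε 1 - ε 2) * th ω (ε 3 - ε 4) * (th ω (ε 3 - ε k) * th ω (ε 0 - ε 3 - ε 4 - ε k))]

theorem Generic.hat_ne {ε : ℕ → ℂ} (hg : Generic ω ε) {k : ℕ} (hk : k = 5 ∨ k = 9) :
    hat ω ε k 0 ≠ 0 := by
  have h1 := hg.pair 2 3 (by decide) (by decide) (by decide)
  have h2 := hg.pair 1 4 (by decide) (by decide) (by decide)
  rcases hk with rfl | rfl
  · exact mul_ne_zero (mul_ne_zero h1 h2)
      (mul_ne_zero (hg.pair 1 5 (by decide) (by decide) (by decide))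
        (hg.triple 1 4 5 (by decide) (by decide) (by decide) (by decide) (by decide) (by decide)
          (by decide)))
  · exact mul_ne_zero (mul_ne_zero h1 h2)
      (mul_ne_zero (hg.pair 1 9 (by decide) (by decide) (by decide))
        (hg.triple 1 4 9 (by decide) (by decide) (by decide) (by decide) (by decide) (by decide)
          (by decide)))

/-- By the three-term identity each 2×2 minor of the coordinates of P₄ and P_k factorises with the
common factor [123][4k], which is nonzero; `hat` collects the remaining factors. -/
theorem OnLine.hat_proportional {ε : ℕ → ℂ} (hg : Generic ω ε) {k : ℕ} (hk : k = 5 ∨ k = 9)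
    {a : Fin 3 → ℂ} (h4 : OnLine a (pt ω ε 4)) (h5 : OnLine a (pt ω ε k)) (i j : Fin 3) :
    a i * hat ω ε k j = a j * hat ω ε k i := by
  have hmem : k ∈ Finset.Icc 1 9 := by rcases hk with rfl | rfl <;> decide
  have n14 := hg.pair 1 4 (by decide) (by decide) (by decide)
  have n24 := hg.pair 2 4 (by decide) (by decide) (by decide)
  have n34 := hg.pair 3 4 (by decide) (by decide) (by decide)
  have n1k := hg.pair 1 k (by decide) hmem (by omega)
  have n2k := hg.pair 2 k (by decide) hmem (by omega)
  have n3k := hg.pair 3 k (by decide) hmem (by omega)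
  have n4k := hg.pair 4 k (by decide) hmem (by omega)
  have n123 := hg.triple 1 2 3 (by decide) (by decide) (by decide) (by decide) (by decide)
    (by decide) (by decide)
  have w1 := thW_three ω (ε 0 - ε 1) (ε 2) (ε 3) (ε 4) (ε k)
  have w2 := thW_three ω (ε 0 - ε 2) (ε 3) (ε 1) (ε 4) (ε k)
  have w3 := thW_three ω (ε 0 - ε 3) (ε 1) (ε 2) (ε 4) (ε k)
  simp only [thW] at w1 w2 w3
  rw [show ε 0 - ε 2 - ε 3 - ε 1 = ε 0 - ε 1 - ε 2 - ε 3 by ring,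
    show ε 0 - ε 2 - ε 1 - ε k = ε 0 - ε 1 - ε 2 - ε k by ring,
    show ε 0 - ε 2 - ε 1 - ε 4 = ε 0 - ε 1 - ε 2 - ε 4 by ring] at w2
  rw [show ε 0 - ε 3 - ε 1 - ε 2 = ε 0 - ε 1 - ε 2 - ε 3 by ring,
    show ε 0 - ε 3 - ε 1 - ε k = ε 0 - ε 1 - ε 3 - ε k by ring,
    show ε 0 - ε 3 - ε 1 - ε 4 = ε 0 - ε 1 - ε 3 - ε 4 by ring,
    show ε 0 - ε 3 - ε 2 - ε k = ε 0 - ε 2 - ε 3 - ε k by ring,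
    show ε 0 - ε 3 - ε 2 - ε 4 = ε 0 - ε 2 - ε 3 - ε 4 by ring] at w3
  simp only [OnLine, Fin.sum_univ_three, pt, br2, br3, Matrix.cons_val_zero, Matrix.cons_val_one,
    Matrix.cons_val] at h4 h5
  have g4 : a 0 * th ω (ε 0 - ε 2 - ε 3 - ε 4) * th ω (ε 2 - ε 4) * th ω (ε 3 - ε 4)
      + a 1 * th ω (ε 0 - ε 1 - ε 3 - ε 4) * th ω (ε 1 - ε 4) * th ω (ε 3 - ε 4)
      + a 2 * th ω (ε 0 - ε 1 - ε 2 - ε 4) * th ω (ε 1 - ε 4) * th ω (ε 2 - ε 4) = 0 := by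
    field_simp at h4
    linear_combination h4
  have g5 : a 0 * th ω (ε 0 - ε 2 - ε 3 - ε k) * th ω (ε 2 - ε k) * th ω (ε 3 - ε k)
      + a 1 * th ω (ε 0 - ε 1 - ε 3 - ε k) * th ω (ε 1 - ε k) * th ω (ε 3 - ε k)
      + a 2 * th ω (ε 0 - ε 1 - ε 2 - ε k) * th ω (ε 1 - ε k) * th ω (ε 2 - ε k) = 0 := by
    field_simp at h5
    linear_combination h5
  clear h4 h5
  have hne := mul_ne_zero n123 n4k
  have c01 : a 0 * hat ω ε k 1 = a 1 * hat ω ε k 0 := by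
    simp only [hat, Matrix.cons_val_zero, Matrix.cons_val_one]
    apply mul_left_cancel₀ hne
    linear_combination a 0 * th ω (ε 2 - ε 4) * th ω (ε 2 - ε k) * w2
      - a 1 * th ω (ε 1 - ε 4) * th ω (ε 1 - ε k) * w1
      + th ω (ε 0 - ε 1 - ε 2 - ε k) * th ω (ε 1 - ε k) * th ω (ε 2 - ε k) * g4
      - th ω (ε 0 - ε 1 - ε 2 - ε 4) * th ω (ε 1 - ε 4) * th ω (ε 2 - ε 4) * g5
  have c12 : a 1 * hat ω ε k 2 = a 2 * hat ω ε k 1 := by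
    simp only [hat, Matrix.cons_val_zero, Matrix.cons_val_one, Matrix.cons_val]
    apply mul_left_cancel₀ hne
    linear_combination a 1 * th ω (ε 3 - ε 4) * th ω (ε 3 - ε k) * w3
      - a 2 * th ω (ε 2 - ε 4) * th ω (ε 2 - ε k) * w2
      + th ω (ε 0 - ε 2 - ε 3 - ε k) * th ω (ε 2 - ε k) * th ω (ε 3 - ε k) * g4
      - th ω (ε 0 - ε 2 - ε 3 - ε 4) * th ω (ε 2 - ε 4) * th ω (ε 3 - ε 4) * g5
  have c02 : a 0 * hat ω ε k 2 = a 2 * hat ω ε k 0 := by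
    simp only [hat, Matrix.cons_val_zero, Matrix.cons_val]
    apply mul_left_cancel₀ hne
    linear_combination a 0 * th ω (ε 3 - ε 4) * th ω (ε 3 - ε k) * w3
      - a 2 * th ω (ε 1 - ε 4) * th ω (ε 1 - ε k) * w1
      - th ω (ε 0 - ε 1 - ε 3 - ε k) * th ω (ε 1 - ε k) * th ω (ε 3 - ε k) * g4
      + th ω (ε 0 - ε 1 - ε 3 - ε 4) * th ω (ε 1 - ε 4) * th ω (ε 3 - ε 4) * g5
  fin_cases i <;> fin_cases j <;> first | rfl | assumption | (symm; assumption)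

theorem onLine_iff_of_proportional {a h v : Fin 3 → ℂ} (ha : a ≠ 0) (h0 : h 0 ≠ 0)
    (hp : ∀ i j, a i * h j = a j * h i) : OnLine a v ↔ OnLine h v := by
  have ha0 : a 0 ≠ 0 := by
    intro e
    apply ha
    funext j
    have := hp 0 j
    rw [e, zero_mul] at this
    exact (mul_eq_zero.1 this.symm).resolve_right h0
  have key : a 0 * ∑ i, h i * v i = h 0 * ∑ i, a i * v i := by
    rw [Finset.mul_sum, Finset.mul_sum]
    refine Finset.sum_congr rfl fun i _ => ?_
    linear_combination v i * hp 0 i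
  rw [OnLine, OnLine]
  constructor
  · intro h
    rw [h, mul_zero] at key
    exact (mul_eq_zero.1 key).resolve_left ha0
  · intro h
    rw [h, mul_zero] at key
    exact (mul_eq_zero.1 key.symm).resolve_left h0

/-- If `P₄`, `P₅`, `P₉` are collinear, then `[459] = 0`. -/
theorem th_459_eq_zero {ε : ℕ → ℂ} (hg : Generic ω ε) {a : Fin 3 → ℂ} (ha : a ≠ 0)
    (h4 : OnLine a (pt ω ε 4)) (h5 : OnLine a (pt ω ε 5)) (h9 : OnLine a (pt ω ε 9)) :
    th ω (ε 0 - ε 4 - ε 5 - ε 9) = 0 := by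
  have p5 := OnLine.hat_proportional hg (.inl rfl) h4 h5
  have p9 := OnLine.hat_proportional hg (.inr rfl) h4 h9
  have n5 := hg.hat_ne (.inl rfl)
  have ha0 : a 0 ≠ 0 := by
    intro e
    apply ha
    funext j
    have := p5 0 j
    rw [e, zero_mul] at this
    exact (mul_eq_zero.1 this.symm).resolve_right n5
  have n12 := hg.pair 1 2 (by decide) (by decide) (by decide)
  have n59 := hg.pair 5 9 (by decide) (by decide) (by decide)
  have n23 := hg.pair 2 3 (by decide) (by decide) (by decide)
  have n31 := hg.pair 3 1 (by decide) (by decide) (by decide)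
  have n14 := hg.pair 1 4 (by decide) (by decide) (by decide)
  have n24 := hg.pair 2 4 (by decide) (by decide) (by decide)
  have n124 := hg.triple 1 2 4 (by decide) (by decide) (by decide) (by decide) (by decide)
    (by decide) (by decide)
  have hq : hat ω ε 5 1 * hat ω ε 9 0 = hat ω ε 5 0 * hat ω ε 9 1 := by
    apply mul_left_cancel₀ ha0
    linear_combination hat ω ε 9 0 * p5 0 1 - hat ω ε 5 0 * p9 0 1
  simp only [hat, Matrix.cons_val_zero, Matrix.cons_val_one] at hq
  -- Proportionality of the first two entries of the two `hat` vectors is a difference that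
  -- factorises as [12][124][59][459] times nonzero brackets.
  have w := thW_swap_swap_sub (ω := ω) (ε 0 - ε 4) (ε 1) (ε 5) (ε 2) (ε 9)
  simp only [thW] at w
  simp only [show ∀ u v : ℂ, ε 0 - ε 4 - u - v = ε 0 - u - ε 4 - v by intros; ring] at w
  rw [show ε 0 - ε 5 - ε 4 - ε 9 = ε 0 - ε 4 - ε 5 - ε 9 by ring,
    show ε 0 - ε 1 - ε 4 - ε 2 = ε 0 - ε 1 - ε 2 - ε 4 by ring] at w
  have hn := mul_ne_zero (mul_ne_zero (mul_ne_zero n23 n31) (mul_ne_zero n14 n24))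
    (mul_ne_zero (mul_ne_zero n12 n124) n59)
  apply mul_left_cancel₀ hn
  linear_combination -hq - th ω (ε 2 - ε 3) * th ω (ε 3 - ε 1) * th ω (ε 1 - ε 4)
    * th ω (ε 2 - ε 4) * w

/-- The reflections s₁₂₆ and s₃₄₆ carry the class e₀ − e₄ − e_k to 2e₀ − e₁ − e₂ − e₄ − e₆ − e_k.
The coefficients of the line and of the conic condition accordingly agree. -/
theorem hat_sum_eq {ε e f : ℕ → ℂ} (k : ℕ) (hk : e k = ε k) (he : ∀ i, e i = midParam ε i) :
    th ω (e 1 - e 4) * th ω (e 2 - e 3)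
          * (th ω (e 0 - e 1 - e 4 - e k) * th ω (e 0 - e 2 - e 6 - e k)) * f 1
        - th ω (e 2 - e 4) * th ω (e 1 - e 3)
          * (th ω (e 0 - e 1 - e 6 - e k) * th ω (e 0 - e 2 - e 4 - e k)) * f 2
        - th ω (e 1 - e 2) * th ω (e 4 - e 3)
          * (th ω (e 0 - e 1 - e 2 - e k) * th ω (e 0 - e 4 - e 6 - e k)) * f 3
      = ∑ i, hat ω ε k i * ![f 1, f 2, f 3] i := by
  have e0 : e 0 = 3 * ε 0 - ε 1 - ε 2 - ε 3 - ε 4 - 2 * ε 6 := by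
    rw [he, midParam]; norm_num; ring
  have e1 : e 1 = ε 0 - ε 2 - ε 6 := by rw [he, midParam]; norm_num; ring
  have e2 : e 2 = ε 0 - ε 1 - ε 6 := by rw [he, midParam]; norm_num; ring
  have e3 : e 3 = ε 0 - ε 4 - ε 6 := by rw [he, midParam]; norm_num; ring
  have e4 : e 4 = ε 0 - ε 3 - ε 6 := by rw [he, midParam]; norm_num; ring
  have e6 : e 6 = 2 * ε 0 - ε 1 - ε 2 - ε 3 - ε 4 - ε 6 := by
    rw [he, midParam]; norm_num; ring
  rw [hk]
  simp only [hat, Fin.sum_univ_three, Matrix.cons_val_zero, Matrix.cons_val_one, Matrix.cons_val]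
  rw [show e 1 - e 4 = ε 3 - ε 2 by rw [e1, e4]; ring,
    show e 2 - e 3 = ε 4 - ε 1 by rw [e2, e3]; ring,
    show e 0 - e 1 - e 4 - ε k = ε 0 - ε 1 - ε 4 - ε k by rw [e0, e1, e4]; ring,
    show e 0 - e 2 - e 6 - ε k = ε 1 - ε k by rw [e0, e2, e6]; ring,
    show e 2 - e 4 = ε 3 - ε 1 by rw [e2, e4]; ring,
    show e 1 - e 3 = ε 4 - ε 2 by rw [e1, e3]; ring,
    show e 0 - e 1 - e 6 - ε k = ε 2 - ε k by rw [e0, e1, e6]; ring,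
    show e 0 - e 2 - e 4 - ε k = ε 0 - ε 2 - ε 4 - ε k by rw [e0, e2, e4]; ring,
    show e 1 - e 2 = ε 1 - ε 2 by rw [e1, e2]; ring,
    show e 4 - e 3 = ε 4 - ε 3 by rw [e4, e3]; ring,
    show e 0 - e 1 - e 2 - ε k = ε 0 - ε 3 - ε 4 - ε k by rw [e0, e1, e2]; ring,
    show e 0 - e 4 - e 6 - ε k = ε 3 - ε k by rw [e0, e4, e6]; ring,
    th_sub_comm (ε 3) (ε 2), th_sub_comm (ε 4) (ε 1), th_sub_comm (ε 4) (ε 2),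
    th_sub_comm (ε 4) (ε 3)]
  ring

/-- One step of the evolution, without the final exchange of the points with numbers `6`, `7`. -/
theorem core_step {x : PState} (hd : DefinedAlong ω coreWord x) (hg : Generic ω x.ε)
    (hg' : Generic ω (coreParam x.ε)) (hγ : th ω (rootγ x.ε) ≠ 0)
    (h5 : OnLine (hat ω x.ε 5) ![x.f 1, x.f 2, x.f 3])
    (h9 : OnLine (hat ω x.ε 9) ![x.f 1, x.f 2, x.f 3])
    (hc : th ω (x.ε 0 - x.ε 4 - x.ε 5 - x.ε 9) = 0) :
    OnLine (hat ω x.ε 5) ![(act ω coreWord x).f 1, (act ω coreWord x).f 2,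
      (act ω coreWord x).f 3] ∧
    th ω (x.ε 1 - x.ε 2) * th ω (x.ε 4 - x.ε 6) * th ω (x.ε 5 - x.ε 6)
        * th ω (x.ε 0 - x.ε 4 - x.ε 5 - x.ε 6) * th ω (x.ε 0 - x.ε 1 - x.ε 2 - bar7 x.ε)
        * (th ω (x.ε 2 - x.ε 6) * th ω (x.ε 0 - x.ε 1 - x.ε 3 - bar7 x.ε)
            * (act ω coreWord x).f 1
          - th ω (x.ε 2 - bar7 x.ε) * th ω (x.ε 0 - x.ε 1 - x.ε 3 - x.ε 6) * x.f 1)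
      = -(th ω (x.ε 6 - bar7 x.ε) * th ω (x.ε 2 - x.ε 4) * th ω (x.ε 2 - x.ε 5)
        * th ω (x.ε 0 - x.ε 2 - x.ε 4 - x.ε 5) * th ω (x.ε 0 - x.ε 1 - bar7 x.ε - x.ε 6)
        * (th ω (x.ε 1 - x.ε 6) * th ω (x.ε 0 - x.ε 1 - x.ε 3 - x.ε 6) * x.f 1
          - th ω (x.ε 2 - x.ε 6) * th ω (x.ε 0 - x.ε 2 - x.ε 3 - x.ε 6) * x.f 2)) := by
  obtain ⟨L, L', z, z', he, hT, hi, hi'⟩ := exists_intermediate hd hg hg' hγ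
  generalize act ω coreWord x = y at *
  have hm := hg.mid he
  have e0 : z.ε 0 = 3 * x.ε 0 - x.ε 1 - x.ε 2 - x.ε 3 - x.ε 4 - 2 * x.ε 6 := by
    rw [he, midParam]; norm_num; ring
  have e1 : z.ε 1 = x.ε 0 - x.ε 2 - x.ε 6 := by rw [he, midParam]; norm_num; ring
  have e2 : z.ε 2 = x.ε 0 - x.ε 1 - x.ε 6 := by rw [he, midParam]; norm_num; ring
  have e3 : z.ε 3 = x.ε 0 - x.ε 4 - x.ε 6 := by rw [he, midParam]; norm_num; ring
  have e4 : z.ε 4 = x.ε 0 - x.ε 3 - x.ε 6 := by rw [he, midParam]; norm_num; ring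
  have e6 : z.ε 6 = 2 * x.ε 0 - x.ε 1 - x.ε 2 - x.ε 3 - x.ε 4 - x.ε 6 := by
    rw [he, midParam]; norm_num; ring
  have e5 : z.ε 5 = x.ε 5 := by rw [he, midParam]; norm_num
  have e8 : z.ε 8 = x.ε 8 := by rw [he, midParam]; norm_num
  have e9 : z.ε 9 = x.ε 9 := by rw [he, midParam]; norm_num
  -- The conditions on 5, 9 with 4 or 2 before s₅₈₉, and on the triples 123 and 134 after it, are
  -- conditions on the image parameters.
  have r3 := hg'.triple 3 6 8 (by decide) (by decide) (by decide) (by decide) (by decide)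
    (by decide) (by decide)
  have r1 := hg'.triple 1 6 8 (by decide) (by decide) (by decide) (by decide) (by decide)
    (by decide) (by decide)
  have r36 := hg'.pair 6 3 (by decide) (by decide) (by decide)
  have r16 := hg'.pair 6 1 (by decide) (by decide) (by decide)
  simp only [coreParam] at r3 r1 r36 r16
  norm_num at r3 r1 r36 r16
  have c5 : OnConic ω L (z.ε 0) (z.ε 5) z := by
    rw [← hi.sum_iff (z.ε 0) (z.ε 5) hm.n12 hm.n14 hm.n16 hm.n26 hm.n36 hm.n46 hm.n123 hm.n134]
    exact (hat_sum_eq 5 e5 he).trans h5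
  have c9 : OnConic ω L (z.ε 0) (z.ε 9) z := by
    rw [← hi.sum_iff (z.ε 0) (z.ε 9) hm.n12 hm.n14 hm.n16 hm.n26 hm.n36 hm.n46 hm.n123 hm.n134]
    exact (hat_sum_eq 9 e9 he).trans h9
  have md : MidData ω L L' z z' x y := {
    trans := hT
    before := hi
    after := hi'
    generic := hm
    root := th_ne_of_eq hγ (by rw [rootγ, delta_eq, e0, e5, e8, e9]; ring)
    n459 := th_ne_of_eq_neg r3 (by rw [rootγ, delta_eq, e0, e5, e4, e9]; ring)
    n259 := th_ne_of_eq_neg r1 (by rw [rootγ, delta_eq, e0, e5, e2, e9]; ring)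
    conic5 := c5
    conic9 := c9 }
  constructor
  · have hca := md.conic_after
    have eo : ∀ i, i ≠ 0 → i ≠ 5 → i ≠ 8 → i ≠ 9 → z'.ε i = z.ε i := hT.ε_other
    have o1 := eo 1 (by norm_num) (by norm_num) (by norm_num) (by norm_num)
    have o2 := eo 2 (by norm_num) (by norm_num) (by norm_num) (by norm_num)
    have o3 := eo 3 (by norm_num) (by norm_num) (by norm_num) (by norm_num)
    have o4 := eo 4 (by norm_num) (by norm_num) (by norm_num) (by norm_num)
    have o6 := eo 6 (by norm_num) (by norm_num) (by norm_num) (by norm_num)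
    rw [← hi'.sum_iff (z.ε 0) (z.ε 5) (by rw [o1, o2]; exact hm.n12) (by rw [o1, o4]; exact hm.n14)
      (by rw [o1, o6]; exact hm.n16) (by rw [o2, o6]; exact hm.n26) (by rw [o3, o6]; exact hm.n36)
      (by rw [o4, o6]; exact hm.n46)
      (th_ne_of_eq r36 (by
        rw [hT.ε_zero, o1, o2, o3, rootγ, delta_eq, e0, e1, e2, e3, e5, e8, e9]; ring))
      (th_ne_of_eq r16 (by
        rw [hT.ε_zero, o1, o3, o4, rootγ, delta_eq, e0, e1, e3, e4, e5, e8, e9]; ring)),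
      o1, o2, o3, o4, o6] at hca
    exact (hat_sum_eq 5 e5 he).symm.trans hca
  · have hr := md.relation
    have n368 : th ω (x.ε 0 - x.ε 3 - x.ε 6 - x.ε 8) ≠ 0 := hg.triple 3 6 8 (by decide)
      (by decide) (by decide) (by decide) (by decide) (by decide) (by decide)
    have n469 : th ω (x.ε 0 - x.ε 4 - x.ε 6 - x.ε 9) ≠ 0 := hg.triple 4 6 9 (by decide)
      (by decide) (by decide) (by decide) (by decide) (by decide) (by decide)
    -- Collinearity makes ε₀ − ε₄ − ε₅ − ε₉ a zero of theta. Translating by it replaces the brackets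
    -- containing 8 or 9 by brackets with 5 and ε₇ + δ.
    have ht := th_translate ω hc (x.ε 0 - x.ε 1 - x.ε 2 - x.ε 6 - bar7 x.ε + x.ε 5)
      (x.ε 5 - x.ε 2) (x.ε 5 - x.ε 6)
    rw [show x.ε 5 - x.ε 2 + (x.ε 0 - x.ε 4 - x.ε 5 - x.ε 9) = x.ε 0 - x.ε 2 - x.ε 4 - x.ε 9 by
        ring,
      show x.ε 0 - x.ε 1 - x.ε 2 - x.ε 6 - bar7 x.ε + x.ε 5 - (x.ε 5 - x.ε 2)
        + (x.ε 0 - x.ε 4 - x.ε 5 - x.ε 9) = -(x.ε 0 - x.ε 2 - x.ε 3 - x.ε 8) by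
        rw [bar7, delta_eq]; ring,
      show x.ε 0 - x.ε 1 - x.ε 2 - x.ε 6 - bar7 x.ε + x.ε 5 - (x.ε 5 - x.ε 6)
        = x.ε 0 - x.ε 1 - x.ε 2 - bar7 x.ε by ring,
      show x.ε 5 - x.ε 6 + (x.ε 0 - x.ε 4 - x.ε 5 - x.ε 9) = x.ε 0 - x.ε 4 - x.ε 6 - x.ε 9 by
        ring,
      show x.ε 0 - x.ε 1 - x.ε 2 - bar7 x.ε + (x.ε 0 - x.ε 4 - x.ε 5 - x.ε 9)
        = -(x.ε 0 - x.ε 3 - x.ε 6 - x.ε 8) by rw [bar7, delta_eq]; ring,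
      show x.ε 0 - x.ε 1 - x.ε 2 - x.ε 6 - bar7 x.ε + x.ε 5 - (x.ε 5 - x.ε 2)
        = x.ε 0 - x.ε 1 - bar7 x.ε - x.ε 6 by ring, th_neg, th_neg, th_sub_comm (x.ε 5) (x.ε 2)]
      at ht
    rw [show z.ε 8 - z.ε 4 = -(x.ε 0 - x.ε 3 - x.ε 6 - x.ε 8) by rw [e8, e4]; ring,
      show z.ε 0 - z.ε 1 - z.ε 2 - z.ε 4 = -(x.ε 4 - x.ε 6) by rw [e0, e1, e2, e4]; ring,
      show z.ε 5 - z.ε 3 = -(x.ε 0 - x.ε 4 - x.ε 5 - x.ε 6) by rw [e5, e3]; ring,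
      show z.ε 9 - z.ε 3 = -(x.ε 0 - x.ε 4 - x.ε 6 - x.ε 9) by rw [e9, e3]; ring,
      show z.ε 1 - z.ε 2 = x.ε 1 - x.ε 2 by rw [e1, e2]; ring,
      show z.ε 0 - z.ε 2 - z.ε 3 - z.ε 4 = -(x.ε 2 - x.ε 6) by rw [e0, e2, e3, e4]; ring,
      show 2 * z.ε 0 - z.ε 5 - z.ε 9 - z.ε 2 - z.ε 6 - z.ε 8 - z.ε 4
        = -(x.ε 0 - x.ε 1 - x.ε 3 - bar7 x.ε) by
        rw [e0, e5, e9, e2, e6, e8, e4, bar7, delta_eq]; ring,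
      show 2 * z.ε 0 - z.ε 5 - z.ε 9 - z.ε 2 - z.ε 3 - z.ε 8 - z.ε 4 = -(x.ε 2 - bar7 x.ε) by
        rw [e0, e5, e9, e2, e3, e8, e4, bar7, delta_eq]; ring,
      show z.ε 0 - z.ε 2 - z.ε 6 - z.ε 4 = -(x.ε 0 - x.ε 1 - x.ε 3 - x.ε 6) by
        rw [e0, e2, e6, e4]; ring,
      show z.ε 0 - z.ε 9 - z.ε 2 - z.ε 4 = x.ε 0 - x.ε 2 - x.ε 4 - x.ε 9 by
        rw [e0, e9, e2, e4]; ring,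
      show z.ε 0 - z.ε 5 - z.ε 2 - z.ε 4 = x.ε 0 - x.ε 2 - x.ε 4 - x.ε 5 by
        rw [e0, e5, e2, e4]; ring,
      show z.ε 0 - z.ε 5 - z.ε 8 - z.ε 9 = -(x.ε 6 - bar7 x.ε) by
        rw [e0, e5, e8, e9, bar7, delta_eq]; ring,
      show z.ε 0 - z.ε 8 - z.ε 2 - z.ε 3 = x.ε 0 - x.ε 2 - x.ε 3 - x.ε 8 by
        rw [e0, e8, e2, e3]; ring,
      show z.ε 1 - z.ε 3 = -(x.ε 2 - x.ε 4) by rw [e1, e3]; ring,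
      show z.ε 0 - z.ε 1 - z.ε 3 - z.ε 4 = -(x.ε 1 - x.ε 6) by rw [e0, e1, e3, e4]; ring,
      show z.ε 0 - z.ε 1 - z.ε 6 - z.ε 4 = -(x.ε 0 - x.ε 2 - x.ε 3 - x.ε 6) by
        rw [e0, e1, e6, e4]; ring] at hr
    simp only [th_neg] at hr
    apply mul_left_cancel₀ (mul_ne_zero n368 n469)
    linear_combination (th ω (x.ε 5 - x.ε 6) * th ω (x.ε 0 - x.ε 1 - x.ε 2 - bar7 x.ε)) * hr
      - th ω (x.ε 6 - bar7 x.ε) * th ω (x.ε 2 - x.ε 4) * th ω (x.ε 0 - x.ε 2 - x.ε 4 - x.ε 5)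
        * (th ω (x.ε 1 - x.ε 6) * th ω (x.ε 0 - x.ε 1 - x.ε 3 - x.ε 6) * x.f 1
          - th ω (x.ε 2 - x.ε 6) * th ω (x.ε 0 - x.ε 2 - x.ε 3 - x.ε 6) * x.f 2) * ht

/-! ### Evolution forward and backward in time. -/

/-- The linear relation between the first coordinates `F`, `f₁` at two consecutive times. -/
def StepRelation (ω : UpperHalfPlane) (ε f : ℕ → ℂ) (F : ℂ) : Prop :=
  th ω (ε 1 - ε 2) * th ω (ε 4 - ε 6) * th ω (ε 5 - ε 6) * th ω (ε 0 - ε 4 - ε 5 - ε 6)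
      * th ω (ε 0 - ε 1 - ε 2 - bar7 ε)
      * (th ω (ε 2 - ε 6) * th ω (ε 0 - ε 1 - ε 3 - bar7 ε) * F
        - th ω (ε 2 - bar7 ε) * th ω (ε 0 - ε 1 - ε 3 - ε 6) * f 1)
    = -(th ω (ε 6 - bar7 ε) * th ω (ε 2 - ε 4) * th ω (ε 2 - ε 5)
      * th ω (ε 0 - ε 2 - ε 4 - ε 5) * th ω (ε 0 - ε 1 - bar7 ε - ε 6)
      * (th ω (ε 1 - ε 6) * th ω (ε 0 - ε 1 - ε 3 - ε 6) * f 1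
        - th ω (ε 2 - ε 6) * th ω (ε 0 - ε 2 - ε 3 - ε 6) * f 2))

/-- The conditions under which one step of the evolution can be analysed. -/
structure Admissible (ω : UpperHalfPlane) (x : PState) : Prop where
  defined : DefinedAlong ω coreWord x
  generic : Generic ω x.ε
  generic_image : Generic ω (coreParam x.ε)
  root : th ω (rootγ x.ε) ≠ 0

/-- With ε₀ moved by 3γ and the other parameters involved by γ, all their brackets [ij] and [ijl]
are unchanged. So P₄, P₅, P₉ stand still and a single line can work for all n. -/
theorem pt_coreParam (ε : ℕ → ℂ) {k : ℕ} (hk : k = 4 ∨ k = 5 ∨ k = 9) :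
    pt ω (coreParam ε) k = pt ω ε k := by
  have h0 : coreParam ε 0 = ε 0 + 3 * rootγ ε := by simp [coreParam]
  have h1 : coreParam ε 1 = ε 1 + rootγ ε := by simp [coreParam]
  have h2 : coreParam ε 2 = ε 2 + rootγ ε := by simp [coreParam]
  have h3 : coreParam ε 3 = ε 3 + rootγ ε := by simp [coreParam]
  have hk : coreParam ε k = ε k + rootγ ε := by
    rcases hk with rfl | rfl | rfl <;> simp [coreParam]
  simp only [pt, br2, br3, h0, h1, h2, h3, hk, add_sub_add_right_eq_sub]
  have e : ∀ a b c : ℂ, ε 0 + 3 * rootγ ε - (a + rootγ ε) - (b + rootγ ε) - (c + rootγ ε)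
      = ε 0 - a - b - c := fun a b c => by ring
  simp only [e]

theorem pt_congr {ε ε' : ℕ → ℂ} {k : ℕ} (h0 : ε' 0 = ε 0) (h1 : ε' 1 = ε 1) (h2 : ε' 2 = ε 2)
    (h3 : ε' 3 = ε 3) (hk : ε' k = ε k) : pt ω ε' k = pt ω ε k := by
  simp only [pt, br2, br3, h0, h1, h2, h3, hk]

theorem Admissible.step {x : PState} (h : Admissible ω x) {a : Fin 3 → ℂ} (ha : a ≠ 0)
    (hx : FourOnLine ω a x) :
    FourOnLine ω a (act ω coreWord x) ∧ StepRelation ω x.ε x.f ((act ω coreWord x).f 1) := by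
  obtain ⟨h4, h5, h9, hf⟩ := hx
  have hε := act_coreWord_ε (ω := ω) x
  have hp : ∀ {k}, (k = 4 ∨ k = 5 ∨ k = 9) → pt ω (act ω coreWord x).ε k = pt ω x.ε k := by
    intro k hk
    rw [← pt_coreParam x.ε hk]
    exact pt_congr (hε 0 (by norm_num)) (hε 1 (by norm_num)) (hε 2 (by norm_num))
      (hε 3 (by norm_num)) (hε k (by omega))
  have p5 := fun v => onLine_iff_of_proportional (v := v) ha (h.generic.hat_ne (.inl rfl))
    (OnLine.hat_proportional h.generic (.inl rfl) h4 h5)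
  have p9 := fun v => onLine_iff_of_proportional (v := v) ha (h.generic.hat_ne (.inr rfl))
    (OnLine.hat_proportional h.generic (.inr rfl) h4 h9)
  obtain ⟨s1, s2⟩ := core_step h.defined h.generic h.generic_image h.root ((p5 _).1 hf)
    ((p9 _).1 hf) (th_459_eq_zero h.generic ha h4 h5 h9)
  refine ⟨⟨?_, ?_, ?_, (p5 _).2 s1⟩, s2⟩
  · rwa [hp (.inl rfl)]
  · rwa [hp (.inr (.inl rfl))]
  · rwa [hp (.inr (.inr rfl))]

theorem sRefl_six_ε (x : PState) (i : ℕ) : (sRefl ω 6 x).ε i = x.ε (Equiv.swap 6 7 i) :=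
  sRefl_ε (by norm_num) x i

theorem sRefl_six_f (x : PState) : (sRefl ω 6 x).f = x.f := by
  simp [sRefl]

theorem FourOnLine.sRefl_six {a : Fin 3 → ℂ} {x : PState} :
    FourOnLine ω a (sRefl ω 6 x) ↔ FourOnLine ω a x := by
  have hp : ∀ {k}, (k = 4 ∨ k = 5 ∨ k = 9) → pt ω (sRefl ω 6 x).ε k = pt ω x.ε k := by
    intro k hk
    have hs : ∀ i, i ≠ 6 → i ≠ 7 → (sRefl ω 6 x).ε i = x.ε i := fun i h6 h7 => by
      rw [sRefl_six_ε, Equiv.swap_apply_of_ne_of_ne h6 h7]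
    exact pt_congr (hs 0 (by norm_num) (by norm_num)) (hs 1 (by norm_num) (by norm_num))
      (hs 2 (by norm_num) (by norm_num)) (hs 3 (by norm_num) (by norm_num))
      (hs k (by omega) (by omega))
  rw [FourOnLine, FourOnLine, hp (.inl rfl), hp (.inr (.inl rfl)), hp (.inr (.inr rfl)),
    sRefl_six_f]

section Solution

variable {x : ℤ → PState}

theorem IsSolution.act_core (hsol : IsSolution ω x) (n : ℤ) :
    DefinedAlong ω coreWord (x n) ∧ x (n + 1) = sRefl ω 6 (act ω coreWord (x n)) ∧
      sRefl ω 6 (x (n + 1)) = act ω coreWord (x n) := by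
  obtain ⟨hd, hx⟩ := hsol n
  rw [transWord_eq, definedAlong_append] at hd
  rw [transWord_eq, act_append] at hx
  obtain ⟨d1, d2, d3, -⟩ := hd
  have hx' : x (n + 1) = sRefl ω 6 (act ω coreWord (x n)) := hx
  exact ⟨d1, hx', by rw [hx', sRefl_sRefl d2 d3]⟩

theorem IsSolution.ε_succ (hsol : IsSolution ω x) (n : ℤ) (i : ℕ) (hi : i ≤ 9) :
    (x (n + 1)).ε i = coreParam (x n).ε (Equiv.swap 6 7 i) := by
  rw [(hsol.act_core n).2.1, sRefl_six_ε, act_coreWord_ε]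
  revert hi
  revert i
  decide

theorem GeneralPosition.root {ε : ℕ → ℂ} (h : GeneralPosition ω ε) : th ω (rootγ ε) ≠ 0 :=
  th_ne_of_eq_neg h.2.2 (by rw [rootγ, bar7]; ring)

theorem rootγ_congr {ε ε' : ℕ → ℂ} (h : ∀ i, i ≤ 9 → ε' i = ε i) : rootγ ε' = rootγ ε := by
  simp only [rootγ, delta_eq, h 0 (by norm_num), h 1 (by norm_num), h 2 (by norm_num),
    h 3 (by norm_num), h 4 (by norm_num), h 5 (by norm_num), h 6 (by norm_num), h 7 (by norm_num),
    h 8 (by norm_num), h 9 (by norm_num)]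

theorem delta_coreParam (ε : ℕ → ℂ) : delta (coreParam ε) = delta ε := by
  simp only [delta_eq, coreParam, rootγ]
  norm_num
  ring

theorem rootγ_coreParam (ε : ℕ → ℂ) : rootγ (coreParam ε) = -rootγ ε := by
  rw [rootγ, delta_coreParam, rootγ]
  simp only [coreParam]
  norm_num
  rw [rootγ]
  ring

theorem IsSolution.generic_image (hsol : IsSolution ω x)
    (hgen : ∀ n, GeneralPosition ω (x n).ε) (n : ℤ) : Generic ω (coreParam (x n).ε) := by
  refine (hgen (n + 1)).generic.swap.congr fun i hi => ?_
  have hi' : Equiv.swap 6 7 i ≤ 9 := by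
    revert hi
    revert i
    decide
  rw [hsol.ε_succ n _ hi', Equiv.swap_apply_self]

theorem IsSolution.admissible (hsol : IsSolution ω x)
    (hgen : ∀ n, GeneralPosition ω (x n).ε) (n : ℤ) : Admissible ω (x n) where
  defined := (hsol.act_core n).1
  generic := (hgen n).generic
  generic_image := hsol.generic_image hgen n
  root := (hgen n).root

/-- The core inverts itself, so the preceding point is the core applied to the following point with
6 and 7 exchanged. -/
theorem IsSolution.act_core_back (hsol : IsSolution ω x) (n : ℤ) :
    DefinedAlong ω coreWord (sRefl ω 6 (x (n + 1))) ∧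
      act ω coreWord (sRefl ω 6 (x (n + 1))) = x n := by
  obtain ⟨h1, -, h3⟩ := hsol.act_core n
  have h := definedAlong_reverse h1
  rwa [coreWord_reverse, ← h3] at h

theorem IsSolution.admissible_back (hsol : IsSolution ω x)
    (hgen : ∀ n, GeneralPosition ω (x n).ε) (n : ℤ) : Admissible ω (sRefl ω 6 (x (n + 1))) where
  defined := (hsol.act_core_back n).1
  generic := (hgen (n + 1)).generic.swap.congr fun i _ => sRefl_six_ε _ i
  generic_image := by
    refine (hgen n).generic.congr fun i hi => ?_
    rw [← act_coreWord_ε (ω := ω) _ i hi, (hsol.act_core_back n).2]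
  root := by
    have h : rootγ (sRefl ω 6 (x (n + 1))).ε = -rootγ (x n).ε := by
      rw [← rootγ_coreParam]
      refine rootγ_congr fun i hi => ?_
      rw [(hsol.act_core n).2.2, act_coreWord_ε _ _ hi]
    exact th_ne_of_eq_neg (hgen n).root h

/-- The line through the four points does not depend on the time. -/
theorem IsSolution.fourOnLine (hsol : IsSolution ω x)
    (hgen : ∀ n, GeneralPosition ω (x n).ε) {a : Fin 3 → ℂ} (ha : a ≠ 0)
    (h0 : FourOnLine ω a (x 0)) (n : ℤ) : FourOnLine ω a (x n) := by
  induction n with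
  | zero => exact h0
  | succ n ih =>
    rw [(hsol.act_core n).2.1, FourOnLine.sRefl_six]
    exact ((hsol.admissible hgen n).step ha ih).1
  | pred n ih =>
    -- Going back in time is again a step of the core, and the exchange of 6 and 7 does not affect
    -- P₄, P₅, P₉, P₁₀.
    have hb := hsol.admissible_back hgen (-n - 1)
    have he := (hsol.act_core_back (-n - 1)).2
    rw [sub_add_cancel] at hb he
    rw [← he]
    exact (hb.step ha (FourOnLine.sRefl_six.2 ih)).1

end Solution

/-! ### The three-term equation and the change of parameters to u. -/

/-- The step relations forward and backward in time combine to the three-term equation. -/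
theorem threeTerm_of_stepRelation {ε ε' f : ℕ → ℂ} {Fup Fdn : ℂ}
    (he : ∀ i, ε' i = ε (Equiv.swap 6 7 i))
    (h : StepRelation ω ε f Fup) (h' : StepRelation ω ε' f Fdn)
    (n12 : th ω (ε 1 - ε 2) ≠ 0) (n2b : th ω (ε 2 - bar7 ε) ≠ 0)
    (n2u : th ω (ε 2 - under6 ε) ≠ 0) (n136 : th ω (ε 0 - ε 1 - ε 3 - ε 6) ≠ 0)
    (n137 : th ω (ε 0 - ε 1 - ε 3 - ε 7) ≠ 0) (n6b : th ω (ε 6 - bar7 ε) ≠ 0)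
    (n7u : th ω (ε 7 - under6 ε) ≠ 0) : ThreeTerm ω ε Fup (f 1) Fdn := by
  have s : ∀ i, i ≠ 6 → i ≠ 7 → ε' i = ε i := fun i h6 h7 => by
    rw [he, Equiv.swap_apply_of_ne_of_ne h6 h7]
  have s0 := s 0 (by norm_num) (by norm_num)
  have s1 := s 1 (by norm_num) (by norm_num)
  have s2 := s 2 (by norm_num) (by norm_num)
  have s3 := s 3 (by norm_num) (by norm_num)
  have s4 := s 4 (by norm_num) (by norm_num)
  have s5 := s 5 (by norm_num) (by norm_num)
  have s8 := s 8 (by norm_num) (by norm_num)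
  have s9 := s 9 (by norm_num) (by norm_num)
  have s6 : ε' 6 = ε 7 := by rw [he, Equiv.swap_apply_left]
  have s7 : ε' 7 = ε 6 := by rw [he, Equiv.swap_apply_right]
  have sb : bar7 ε' = under6 ε := by
    rw [bar7, under6, delta_eq, delta_eq, s0, s1, s2, s3, s4, s5, s6, s7, s8, s9]
    ring
  rw [StepRelation] at h h'
  rw [s0, s1, s2, s3, s4, s5, s6, sb,
    show ε 0 - ε 1 - under6 ε - ε 7 = ε 0 - ε 1 - bar7 ε - ε 6 by rw [under6, bar7]; ring] at h'
  -- Weighting the forward relation by [27][237] and the backward one by [26][236] cancels f₂. This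
  -- identity evaluates the remaining coefficient of f₁, producing [123][76][376] in c₃ and a factor
  -- [21] that is divided out.
  have hw := thW_swap_swap_sub (ω := ω) (ε 0 - ε 3) (ε 2) (ε 7) (ε 1) (ε 6)
  simp only [thW] at hw
  rw [th_sub_comm (ε 2) (ε 1), show ε 0 - ε 3 - ε 2 - ε 7 = ε 0 - ε 2 - ε 3 - ε 7 by ring,
    show ε 0 - ε 3 - ε 1 - ε 6 = ε 0 - ε 1 - ε 3 - ε 6 by ring,
    show ε 0 - ε 3 - ε 2 - ε 6 = ε 0 - ε 2 - ε 3 - ε 6 by ring,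
    show ε 0 - ε 3 - ε 1 - ε 7 = ε 0 - ε 1 - ε 3 - ε 7 by ring,
    show ε 0 - ε 3 - ε 2 - ε 1 = ε 0 - ε 1 - ε 2 - ε 3 by ring] at hw
  simp only [ThreeTerm, c1, c2, c3, br2, br3]
  field_simp
  apply mul_left_cancel₀ n12
  linear_combination th ω (ε 7 - under6 ε) * th ω (ε 2 - ε 7) * th ω (ε 0 - ε 2 - ε 3 - ε 7) * h
    - th ω (ε 6 - bar7 ε) * th ω (ε 2 - ε 6) * th ω (ε 0 - ε 2 - ε 3 - ε 6) * h'
    - th ω (ε 6 - bar7 ε) * th ω (ε 7 - under6 ε) * th ω (ε 2 - ε 4) * th ω (ε 2 - ε 5)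
      * th ω (ε 0 - ε 2 - ε 4 - ε 5) * th ω (ε 0 - ε 1 - bar7 ε - ε 6) * f 1 * hw

theorem sum_uParam (ε : ℕ → ℂ) :
    2 * delta ε + 3 * uParam ε 0 - ∑ i ∈ Finset.Icc (1 : Fin 8) 7, uParam ε i = 0 := by
  rw [show Finset.Icc (1 : Fin 8) 7 = {1, 2, 3, 4, 5, 6, 7} by decide]
  simp [uParam]
  ring

/-- Solutions of a recursion of order one with nonvanishing coefficients on the integers. -/
theorem exists_int_recursion (ρ : ℤ → ℂ) (hρ : ∀ n, ρ n ≠ 0) :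
    ∃ g : ℤ → ℂ, ∀ n, g n ≠ 0 ∧ g (n + 1) = ρ n * g n := by
  let u : ℤ → ℂˣ := fun n => Units.mk0 (ρ n) (hρ n)
  let G : ℤ → ℂˣ := fun n => match n with
    | Int.ofNat n => ∏ i ∈ Finset.range n, u i
    | Int.negSucc n => ∏ i ∈ Finset.range (n + 1), (u (Int.negSucc i))⁻¹
  have hG : ∀ n, G (n + 1) = u n * G n := by
    rintro (n | n)
    · change ∏ i ∈ Finset.range (n + 1), u i = u n * ∏ i ∈ Finset.range n, u i
      rw [Finset.prod_range_succ, mul_comm]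
    · rcases n with _ | n
      · change ∏ i ∈ Finset.range 0, u i
          = u (Int.negSucc 0) * ∏ i ∈ Finset.range (0 + 1), (u (Int.negSucc i))⁻¹
        simp
      · have : Int.negSucc (n + 1) + 1 = Int.negSucc n := rfl
        rw [this]
        change ∏ i ∈ Finset.range (n + 1), (u (Int.negSucc i))⁻¹ = u (Int.negSucc (n + 1))
          * ∏ i ∈ Finset.range (n + 1 + 1), (u (Int.negSucc i))⁻¹
        rw [Finset.prod_range_succ _ (n + 1)]
        rw [mul_comm (∏ i ∈ Finset.range (n + 1), (u (Int.negSucc i))⁻¹), mul_inv_cancel_left]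
  refine ⟨fun n => G n, fun n => ⟨(G n).ne_zero, ?_⟩⟩
  have := congrArg Units.val (hG n)
  simpa [u] using this

/-- The `₁₀E₉` equation in terms of the coefficients `c₁`, `c₂`, `c₃`. -/
theorem e9Equation_iff {ε : ℕ → ℂ} (n76 : th ω (ε 7 - ε 6) ≠ 0) (n6b : th ω (ε 6 - bar7 ε) ≠ 0)
    (n7u : th ω (ε 7 - under6 ε) ≠ 0) (Φup Φ Φdn : ℂ) :
    E9Equation ω (delta ε) (uParam ε) Φup Φ Φdn ↔
      c1 ω ε * (Φup - Φ) - c2 ω ε * (Φdn - Φ) = c3 ω ε * Φ := by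
  have e : Finset.Icc (1 : Fin 8) 5 = {1, 2, 3, 4, 5} := by decide
  have u0 : uParam ε 0 = 2 * ε 2 + ε 3 - ε 0 - delta ε := rfl
  have u1 : uParam ε 1 = ε 2 - ε 4 := rfl
  have u2 : uParam ε 2 = ε 2 - ε 5 := rfl
  have u3 : uParam ε 3 = -(ε 0 - ε 2 - ε 4 - ε 5) := by
    change ε 2 + ε 4 + ε 5 - ε 0 = _; ring
  have u4 : uParam ε 4 = -(ε 0 - ε 1 - ε 2 - ε 3) := by
    change ε 1 + ε 2 + ε 3 - ε 0 = _; ring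
  have u5 : uParam ε 5 = ε 0 - ε 1 - bar7 ε - ε 6 := by
    change ε 0 - ε 1 - ε 6 - ε 7 - delta ε = _; rw [bar7]; ring
  have u6 : uParam ε 6 = -(ε 0 - ε 2 - ε 3 - ε 6) := by
    change ε 2 + ε 3 + ε 6 - ε 0 = _; ring
  have u7 : uParam ε 7 = -(ε 0 - ε 2 - ε 3 - ε 7) := by
    change ε 2 + ε 3 + ε 7 - ε 0 = _; ring
  have p : ∀ g : Fin 8 → ℂ, ∏ i ∈ Finset.Icc (1 : Fin 8) 5, g i
      = g 1 * g 2 * g 3 * g 4 * g 5 := by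
    intro g
    rw [e]
    simp [mul_assoc]
  have q : ∀ a b : ℂ, a - b = -(b - a) := fun a b => by ring
  rw [E9Equation, p, p, p]
  rw [show uParam ε 7 - uParam ε 6 + delta ε = -(ε 6 - bar7 ε) by rw [u7, u6, bar7]; ring,
    show uParam ε 7 - uParam ε 6 - delta ε = ε 7 - under6 ε by rw [u7, u6, under6]; ring,
    show uParam ε 7 - uParam ε 6 = ε 7 - ε 6 by rw [u7, u6]; ring,
    show delta ε + uParam ε 0 - uParam ε 7 = ε 2 - ε 7 by rw [u0, u7]; ring,
    show delta ε + uParam ε 0 - uParam ε 6 = ε 2 - ε 6 by rw [u0, u6]; ring,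
    show uParam ε 0 - uParam ε 7 = ε 2 - bar7 ε by rw [u0, u7, bar7]; ring,
    show uParam ε 0 - uParam ε 6 = ε 2 - under6 ε by rw [u0, u6, under6]; ring,
    show delta ε + uParam ε 0 - uParam ε 1 - uParam ε 6 = ε 4 - ε 6 by rw [u0, u1, u6]; ring,
    show delta ε + uParam ε 0 - uParam ε 2 - uParam ε 6 = ε 5 - ε 6 by rw [u0, u2, u6]; ring,
    show delta ε + uParam ε 0 - uParam ε 3 - uParam ε 6 = ε 0 - ε 4 - ε 5 - ε 6 by
      rw [u0, u3, u6]; ring,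
    show delta ε + uParam ε 0 - uParam ε 4 - uParam ε 6 = ε 0 - ε 1 - ε 3 - ε 6 by
      rw [u0, u4, u6]; ring,
    show delta ε + uParam ε 0 - uParam ε 5 - uParam ε 6 = -(ε 0 - ε 1 - ε 2 - bar7 ε) by
      rw [u0, u5, u6, bar7]; ring,
    show delta ε + uParam ε 0 - uParam ε 1 - uParam ε 7 = ε 4 - ε 7 by rw [u0, u1, u7]; ring,
    show delta ε + uParam ε 0 - uParam ε 2 - uParam ε 7 = ε 5 - ε 7 by rw [u0, u2, u7]; ring,
    show delta ε + uParam ε 0 - uParam ε 3 - uParam ε 7 = ε 0 - ε 4 - ε 5 - ε 7 by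
      rw [u0, u3, u7]; ring,
    show delta ε + uParam ε 0 - uParam ε 4 - uParam ε 7 = ε 0 - ε 1 - ε 3 - ε 7 by
      rw [u0, u4, u7]; ring,
    show delta ε + uParam ε 0 - uParam ε 5 - uParam ε 7 = -(ε 0 - ε 1 - ε 2 - under6 ε) by
      rw [u0, u5, u7, bar7, under6]; ring,
    show uParam ε 7 + uParam ε 6 - uParam ε 0 - delta ε = -(ε 0 - ε 3 - ε 7 - ε 6) by
      rw [u0, u6, u7]; ring, u1, u2, u3, u4, u5, u6, u7]
  -- After the substitutions the two equations differ only by the common factor −1/[76].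
  simp only [th_neg, c1, c2, c3, br2, br3]
  generalize th ω (ε 6 - bar7 ε) = b6 at *
  generalize th ω (ε 7 - under6 ε) = b7 at *
  generalize th ω (ε 7 - ε 6) = b76 at *
  constructor
  · intro h
    field_simp at h ⊢
    linear_combination -h
  · intro h
    field_simp at h ⊢
    linear_combination -h

/-! ### The time shift of the parameters and the gauge factor. -/

section Solution

variable {x : ℤ → PState}

theorem IsSolution.ε_succ_eq (hsol : IsSolution ω x) (n : ℤ) :
    (∀ i, i = 1 ∨ i = 2 ∨ i = 3 ∨ i = 4 ∨ i = 5 ∨ i = 8 ∨ i = 9 →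
      (x (n + 1)).ε i = (x n).ε i + rootγ (x n).ε) ∧
    (x (n + 1)).ε 0 = (x n).ε 0 + 3 * rootγ (x n).ε ∧ (x (n + 1)).ε 6 = (x n).ε 7 ∧
    (x (n + 1)).ε 7 = (x n).ε 6 + 2 * rootγ (x n).ε := by
  refine ⟨?_, ?_, ?_, ?_⟩
  · intro i hi
    rw [hsol.ε_succ n i (by omega), Equiv.swap_apply_of_ne_of_ne (by omega) (by omega)]
    simp only [coreParam]
    rw [if_neg (by omega), if_neg (by omega), if_neg (by omega)]
  · rw [hsol.ε_succ n 0 (by norm_num), Equiv.swap_apply_of_ne_of_ne (by norm_num) (by norm_num)]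
    simp [coreParam]
  · rw [hsol.ε_succ n 6 (by norm_num), Equiv.swap_apply_left]
    simp [coreParam]
  · rw [hsol.ε_succ n 7 (by norm_num), Equiv.swap_apply_right]
    simp [coreParam]

theorem IsSolution.delta_succ (hsol : IsSolution ω x) (n : ℤ) :
    delta (x (n + 1)).ε = delta (x n).ε := by
  obtain ⟨h, h0, h6, h7⟩ := hsol.ε_succ_eq n
  rw [delta_eq, h0, h6, h7, h 1 (by simp), h 2 (by simp), h 3 (by simp), h 4 (by simp),
    h 5 (by simp), h 8 (by simp), h 9 (by simp), rootγ, delta_eq]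
  ring

theorem IsSolution.uParam_succ (hsol : IsSolution ω x) (n : ℤ) :
    uParam (x (n + 1)).ε = shift67 (delta (x n).ε) (uParam (x n).ε) := by
  obtain ⟨h, h0, h6, h7⟩ := hsol.ε_succ_eq n
  have hd := hsol.delta_succ n
  simp only [uParam, shift67, h0, h6, h7, h 1 (by simp), h 2 (by simp), h 3 (by simp),
    h 4 (by simp), h 5 (by simp), hd, rootγ]
  funext i
  fin_cases i <;> simp <;> ring

theorem bar7_eq (ε : ℕ → ℂ) : bar7 ε = ε 6 + rootγ ε := by
  rw [bar7, rootγ]; ring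

/-- The nondegeneracy conditions involving the shifted parameters. -/
theorem IsSolution.shifted_ne (hsol : IsSolution ω x)
    (hgen : ∀ n, GeneralPosition ω (x n).ε) (n : ℤ) :
    th ω ((x n).ε 2 - bar7 (x n).ε) ≠ 0 ∧
      th ω ((x n).ε 0 - (x n).ε 1 - (x n).ε 3 - bar7 (x n).ε) ≠ 0 ∧
      th ω ((x n).ε 2 - under6 (x n).ε) ≠ 0 ∧
      th ω ((x n).ε 0 - (x n).ε 1 - (x n).ε 3 - under6 (x n).ε) ≠ 0 ∧
      th ω ((x n).ε 7 - under6 (x n).ε) ≠ 0 := by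
  have hg := hsol.generic_image hgen n
  have r26 := hg.pair 2 6 (by decide) (by decide) (by decide)
  have r136 := hg.triple 1 3 6 (by decide) (by decide) (by decide) (by decide) (by decide)
    (by decide) (by decide)
  simp only [coreParam] at r26 r136
  norm_num at r26 r136
  -- Conditions with ε₇ + δ follow from general position at the next time; those with ε₆ + δ are
  -- brackets at the previous time m.
  obtain ⟨m, rfl⟩ : ∃ m, n = m + 1 := ⟨n - 1, by ring⟩
  obtain ⟨h, h0, h6, h7⟩ := hsol.ε_succ_eq m
  have hd := hsol.delta_succ m
  have hb := (hgen m).root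
  have hm := (hgen m).generic
  refine ⟨th_ne_of_eq r26 (by rw [bar7_eq]; ring),
    th_ne_of_eq r136 (by rw [bar7_eq]; ring),
    th_ne_of_eq (hm.pair 2 6 (by decide) (by decide) (by decide)) ?_,
    th_ne_of_eq (hm.triple 1 3 6 (by decide) (by decide) (by decide) (by decide) (by decide)
      (by decide) (by decide)) ?_, th_ne_of_eq hb ?_⟩
  · rw [under6, hd, h 2 (by simp), h6, rootγ]; ring
  · rw [under6, hd, h0, h 1 (by simp), h 3 (by simp), h6, rootγ]; ring
  · rw [under6, hd, h6, h7, rootγ]; ring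

theorem IsSolution.threeTerm (hsol : IsSolution ω x)
    (hgen : ∀ n, GeneralPosition ω (x n).ε) {a : Fin 3 → ℂ} (ha : a ≠ 0)
    (h0 : FourOnLine ω a (x 0)) (n : ℤ) :
    ThreeTerm ω (x n).ε ((x (n + 1)).f 1) ((x n).f 1) ((x (n - 1)).f 1) := by
  obtain ⟨m, rfl⟩ : ∃ m, n = m + 1 := ⟨n - 1, by ring⟩
  have hline := hsol.fourOnLine hgen ha h0 (m + 1)
  have hg := (hgen (m + 1)).generic
  have h1 := ((hsol.admissible hgen (m + 1)).step ha hline).2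
  have h2 := ((hsol.admissible_back hgen m).step ha (FourOnLine.sRefl_six.2 hline)).2
  rw [(hsol.act_core_back m).2, sRefl_six_f] at h2
  have hf : (x (m + 1 + 1)).f = (act ω coreWord (x (m + 1))).f := by
    rw [(hsol.act_core (m + 1)).2.1, sRefl_six_f]
  obtain ⟨n1, -, n2, -, n3⟩ := hsol.shifted_ne hgen (m + 1)
  rw [add_sub_cancel_right, hf]
  exact threeTerm_of_stepRelation (sRefl_six_ε _) h1 h2
    (hg.pair 1 2 (by decide) (by decide) (by decide)) n1 n2
    (hg.triple 1 3 6 (by decide) (by decide) (by decide) (by decide) (by decide) (by decide)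
      (by decide))
    (hg.triple 1 3 7 (by decide) (by decide) (by decide) (by decide) (by decide) (by decide)
      (by decide)) (hgen (m + 1)).2.2 n3

/-- The factor of the gauge transformation. -/
noncomputable def gaugeRatio (ω : UpperHalfPlane) (ε : ℕ → ℂ) : ℂ :=
  br2 ω (ε 2) (bar7 ε) * br3 ω ε (ε 1) (ε 3) (ε 6)
    / (br2 ω (ε 2) (ε 6) * br3 ω ε (ε 1) (ε 3) (bar7 ε))

theorem IsSolution.gaugeRatio_ne (hsol : IsSolution ω x)
    (hgen : ∀ n, GeneralPosition ω (x n).ε) (n : ℤ) : gaugeRatio ω (x n).ε ≠ 0 := by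
  obtain ⟨n1, n2, -⟩ := hsol.shifted_ne hgen n
  have hg := (hgen n).generic
  exact div_ne_zero (mul_ne_zero n1 (hg.triple 1 3 6 (by decide) (by decide) (by decide)
      (by decide) (by decide) (by decide) (by decide)))
    (mul_ne_zero (hg.pair 2 6 (by decide) (by decide) (by decide)) n2)

/-- The coefficient of the backward term in (∗) is the gauge ratio of the preceding time, and that
of the forward term is the inverse of the present one. Hence one sequence g absorbs both. -/
theorem IsSolution.gaugeRatio_pred (hsol : IsSolution ω x) (n : ℤ) :
    br2 ω ((x (n + 1)).ε 2) ((x (n + 1)).ε 7)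
        * br3 ω (x (n + 1)).ε ((x (n + 1)).ε 1) ((x (n + 1)).ε 3) (under6 (x (n + 1)).ε)
        / (br2 ω ((x (n + 1)).ε 2) (under6 (x (n + 1)).ε)
          * br3 ω (x (n + 1)).ε ((x (n + 1)).ε 1) ((x (n + 1)).ε 3) ((x (n + 1)).ε 7))
      = gaugeRatio ω (x n).ε := by
  obtain ⟨h, h0, h6, h7⟩ := hsol.ε_succ_eq n
  have hd := hsol.delta_succ n
  rw [gaugeRatio]
  simp only [br2, br3, under6, bar7_eq]
  rw [hd, h0, h6, h7, h 1 (by simp), h 2 (by simp), h 3 (by simp)]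
  generalize hg : rootγ (x n).ε = γ
  have hδ : delta (x n).ε = γ + (x n).ε 6 - (x n).ε 7 := by rw [← hg, rootγ]; ring
  rw [hδ]
  congr 2 <;> congr 1 <;> ring

end Solution

end EllipticPainleve


theorem mainTheorem6 (ω : UpperHalfPlane) (x : ℤ → EllipticPainleve.PState)
    (hsol : EllipticPainleve.IsSolution ω x)
    (hgen : ∀ n, EllipticPainleve.GeneralPosition ω (x n).ε)
    (hline : ∃ a : Fin 3 → ℂ, a ≠ 0 ∧ EllipticPainleve.FourOnLine ω a (x 0)) :
    -- the four points stay on one fixed line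
    (∃ a : Fin 3 → ℂ, a ≠ 0 ∧ ∀ n, EllipticPainleve.FourOnLine ω a (x n)) ∧
    -- the equation reduces to the linear three-term equation for the first coordinate
    (∀ n, EllipticPainleve.ThreeTerm ω (x n).ε ((x (n + 1)).f 1) ((x n).f 1) ((x (n - 1)).f 1)) ∧
    -- the parameters `u` are balanced, and one time step is the shift of `u₆`, `u₇`
    (∀ n, 2 * EllipticPainleve.delta (x n).ε + 3 * EllipticPainleve.uParam (x n).ε 0
          - ∑ i ∈ Finset.Icc (1 : Fin 8) 7, EllipticPainleve.uParam (x n).ε i = 0 ∧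
        EllipticPainleve.delta (x (n + 1)).ε = EllipticPainleve.delta (x n).ε ∧
        EllipticPainleve.uParam (x (n + 1)).ε
          = EllipticPainleve.shift67 (EllipticPainleve.delta (x n).ε)
              (EllipticPainleve.uParam (x n).ε)) ∧
    -- a gauge transformation turns the three-term equation into the hypergeometric one
    ∃ g : ℤ → ℂ,
      (∀ n, g n ≠ 0 ∧
        g (n + 1) =
          EllipticPainleve.br2 ω ((x n).ε 2) (EllipticPainleve.bar7 (x n).ε)
            * EllipticPainleve.br3 ω (x n).ε ((x n).ε 1) ((x n).ε 3) ((x n).ε 6)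
            / (EllipticPainleve.br2 ω ((x n).ε 2) ((x n).ε 6)
              * EllipticPainleve.br3 ω (x n).ε ((x n).ε 1) ((x n).ε 3)
                (EllipticPainleve.bar7 (x n).ε)) * g n) ∧
      ∀ F Φ : ℤ → ℂ, (∀ n, F n = g n * Φ n) →
        ∀ n, EllipticPainleve.ThreeTerm ω (x n).ε (F (n + 1)) (F n) (F (n - 1)) ↔
          EllipticPainleve.E9Equation ω (EllipticPainleve.delta (x n).ε)
            (EllipticPainleve.uParam (x n).ε) (Φ (n + 1)) (Φ n) (Φ (n - 1)) := by
  open EllipticPainleve in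
  obtain ⟨a, ha, h0⟩ := hline
  refine ⟨⟨a, ha, hsol.fourOnLine hgen ha h0⟩, hsol.threeTerm hgen ha h0,
    fun n => ⟨sum_uParam _, hsol.delta_succ n, hsol.uParam_succ n⟩, ?_⟩
  obtain ⟨g, hg⟩ := exists_int_recursion (fun n => gaugeRatio ω (x n).ε)
    (hsol.gaugeRatio_ne hgen)
  refine ⟨g, hg, fun F Φ hF n => ?_⟩
  obtain ⟨m, rfl⟩ : ∃ m, n = m + 1 := ⟨n - 1, by ring⟩
  have hG := (hgen (m + 1)).generic
  obtain ⟨n1, n2, -, -, n3⟩ := hsol.shifted_ne hgen (m + 1)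
  rw [e9Equation_iff (hG.pair 7 6 (by decide) (by decide) (by decide)) (hgen (m + 1)).2.2 n3,
    ThreeTerm, hsol.gaugeRatio_pred m, add_sub_cancel_right]
  have hup : br2 ω ((x (m + 1)).ε 2) ((x (m + 1)).ε 6)
      * br3 ω (x (m + 1)).ε ((x (m + 1)).ε 1) ((x (m + 1)).ε 3) (bar7 (x (m + 1)).ε)
      / (br2 ω ((x (m + 1)).ε 2) (bar7 (x (m + 1)).ε)
        * br3 ω (x (m + 1)).ε ((x (m + 1)).ε 1) ((x (m + 1)).ε 3) ((x (m + 1)).ε 6))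
      * F (m + 1 + 1) = g (m + 1) * Φ (m + 1 + 1) := by
    have hr := hsol.gaugeRatio_ne hgen (m + 1)
    rw [hF, (hg (m + 1)).2]
    change _ * (gaugeRatio ω (x (m + 1)).ε * g (m + 1) * Φ (m + 1 + 1)) = _
    rw [← inv_div]
    change (gaugeRatio ω (x (m + 1)).ε)⁻¹ * _ = _
    field_simp
  have hdn : gaugeRatio ω (x m).ε * F m = g (m + 1) * Φ m := by
    rw [hF, (hg m).2]; ring
  -- All three terms now carry the same nonzero factor g, and dividing by it leaves the form of the
  -- ₁₀E₉ equation found in `e9Equation_iff`.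
  rw [hup, hdn, hF]
  have hne := (hg (m + 1)).1
  constructor
  · intro h
    apply mul_left_cancel₀ hne
    linear_combination h
  · intro h
    linear_combination g (m + 1) * h
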